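/- Let $d,n\ge 1$ and let $\Omega\subseteq\mathbb R^d$ be a (bounded or unbounded) domain. If $\partial\Omega\neq\emptyset$, assume that $\partial\Omega\in C^2$, that for some $\tau_0>0$ the distance $\tau$ along the inward unit normal to $\partial\Omega$ is a well-defined variable on $\{x\in\Omega:\operatorname{dist}(x,\partial\Omega)\le\tau_0\}$, and that there, for suitable local variables $s$ on $\partial\Omega$, the Jacobians of the passage from $x$ to $(\tau,s)$ are bounded and separated from zero uniformly and the first derivatives of $x$ in $(\tau,s)$ are uniformly bounded. Let $\mathfrak V$ be one of the Sobolev spaces $W_2^1(\Omega;\mathbb C^n)$ (Robin case) and $\mathring W_2^1(\Omega;\mathbb C^n)$ (Dirichlet case: zero trace on $\partial\Omega$), with the $W_2^1$-norm. Let $\mathfrak M_{1,0}$ be the space of multipliers from $\mathfrak V$ to $L_2(\Omega;\mathbb C^n)$, that is, of the measurable $n\times n$ matrix functions $Q$ on $\Omega$ such that $u\mapsto Qu$ is bounded from $\mathfrak V$ to $L_2(\Omega;\mathbb C^n)$, with the norm $$\|Q\|_{\mathfrak M_{1,0}}:=\sup_{0\neq u\in\mathfrak V}\frac{\|Qu\|_{L_2(\Omega;\mathbb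 C^n)}}{\|u\|_{\mathfrak V}} .$$ For a matrix $A=(a_{ij})$ put $|A|=\sum_{i,j}|a_{ij}|$; $L_\infty(\Omega;\mathbb M_n)$ is the space of $n\times n$ matrix functions with entries in $L_\infty(\Omega)$, with the norm $\operatorname{ess\,sup}_\Omega|Q(x)|$. Let $\Gamma$ be a fixed lattice in $\mathbb R^d$ with a (bounded, convex) periodicity cell $\square$, and for $\eta>0$ put $\square_\gamma^\eta:=\eta\square+\eta\gamma$ and $\Gamma_\eta:=\{\gamma\in\Gamma:\square_\gamma^\eta\subset\Omega\}$. (i) Let $Q^\varepsilon\in L_\infty(\Omega;\mathbb M_n)$ be a family of matrix functions bounded uniformly in $\varepsilon$ and let $Q^0\in L_\infty(\Omega;\mathbb M_n)$. There is a constant $C$ independent of $\varepsilon$, $\eta$ and $\rho_3$ such that, for all functions $\eta=\eta(\varepsilon)>0$ and $\rho_3=\rho_3(\varepsilon)\ge0$ with $\eta(\varepsilon)\to0$, $\rho_3(\varepsilon)\to0$ as $\varepsilon\to0$ and $$\int_{\square_\gamma^\eta}\eta^{-d}\,|Q^\varepsilon(x)-Q^0(x)|^2\,dx\le\rho_3(\varepsilon)\qquad\text{for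 each }\gamma\in\Gamma_\eta,\tag{1}$$ the family $Q^\varepsilon$ converges to $Q^0$ in $\mathfrak M_{1,0}$ as $\varepsilon\to0$ and $$\|Q^\varepsilon-Q^0\|_{\mathfrak M_{1,0}}\le C\big(\rho_3^{1/2}(\varepsilon)+\eta^{1/2}(\varepsilon)\big).$$ (ii) Conversely, if a uniformly bounded family $Q^\varepsilon\in L_\infty(\Omega;\mathbb M_n)$ converges to $Q^0\in L_\infty(\Omega;\mathbb M_n)$ in $\mathfrak M_{1,0}$ as $\varepsilon\to0$, then, with a constant $C$ independent of $\varepsilon$, condition (1) is satisfied with $$\eta(\varepsilon)=\|Q^\varepsilon-Q^0\|_{\mathfrak M_{1,0}}^{1/2},\qquad \rho_3(\varepsilon)=C\,\|Q^\varepsilon-Q^0\|_{\mathfrak M_{1,0}}^{1/2},$$ and these two functions tend to zero as $\varepsilon\to0$; here (1) is meant for those $\varepsilon$ for which $\|Q^\varepsilon-Q^0\|_{\mathfrak M_{1,0}}\neq0$, while for all other $\varepsilon$ one has $Q^\varepsilon=Q^0$ almost everywhere in $\Omega$. (iii) If $Q\in\mathfrak M_{1,0}$, then the pointwise adjoint $Q^*$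 belongs to $\mathfrak M_{1,0}$ and $\|Q^*\|_{\mathfrak M_{1,0}}\le\sqrt n\,\|Q\|_{\mathfrak M_{1,0}}$. -/

import Mathlib

open Set Filter Topology MeasureTheory
open scoped ENNReal NNReal Matrix ContDiff

noncomputable section

namespace Multipliers

/-- The Euclidean space `ℝ^d`. -/
abbrev Space (d : ℕ) := EuclideanSpace ℝ (Fin d)

/-- The Hermitian space `ℂ^n`. -/
abbrev CVec (n : ℕ) := EuclideanSpace ℂ (Fin n)

/-! ### Domains with a uniformly regular `C²` boundary -/

/-- `v` is the inward unit normal at the boundary point `y` of a set `Ω` whose boundary is of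
class `C²` near `y`: near `y` the set `Ω` is `{f > 0}` with `f` of class `C²`, `∇f(y) ≠ 0`, and
`v = ∇f(y) / |∇f(y)|`. -/
def IsInwardUnitNormal {d : ℕ} (Ω : Set (Space d)) (y v : Space d) : Prop :=
  ∃ f : Space d → ℝ, ContDiffAt ℝ 2 f y ∧ gradient f y ≠ 0 ∧
    (∀ᶠ x in 𝓝 y, x ∈ Ω ↔ 0 < f x) ∧ v = ‖gradient f y‖⁻¹ • gradient f y

/-- The boundary layer `Π(τ) = {x ∈ Ω : dist(x, ∂Ω) ≤ τ}` (empty if `∂Ω` is empty). -/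
def boundaryLayer {d : ℕ} (Ω : Set (Space d)) (τ : ℝ) : Set (Space d) :=
  Ω ∩ Metric.cthickening τ (frontier Ω)

/-- The coordinates `s = (z₁, …, z_m)` of the point `z = (τ, s) = (z₀, z₁, …, z_m)`. -/
def lateral {m : ℕ} (z : Space (m + 1)) : Space m :=
  WithLp.toLp 2 (fun i : Fin m => z i.succ)

/-- The passage from `(τ, s)` to `x = σ(s) + τ ν(σ(s))`, for a local parametrization `σ` of the
boundary and a normal field `ν`. -/
def tubularMap {m : ℕ} (ν : Space (m + 1) → Space (m + 1)) (σ : Space m → Space (m + 1))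
    (z : Space (m + 1)) : Space (m + 1) :=
  σ (lateral z) + z 0 • ν (σ (lateral z))

/-- The boundary of `Ω ⊆ ℝ^(m+1)` is empty, or it is of class `C²` and, for some `τ₀ > 0`, the
distance `τ` along the inward normal is a well-defined variable on `Π(τ₀)`, and for
suitable local variables `s` on `∂Ω` the Jacobians of the passage between `x` and `(τ, s)` on
`Π(τ₀)` are bounded and separated from zero uniformly and the first derivatives of `x` in
`(τ, s)` are uniformly bounded. -/
def HasRegularBoundary {m : ℕ} (Ω : Set (Space (m + 1))) : Prop :=
  ∃ (ν : Space (m + 1) → Space (m + 1)) (τ₀ M : ℝ), 0 < τ₀ ∧ 0 < M ∧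
    (∀ y ∈ frontier Ω, IsInwardUnitNormal Ω y (ν y)) ∧
    BijOn (fun p : Space (m + 1) × ℝ => p.1 + p.2 • ν p.1)
      (frontier Ω ×ˢ Ioc 0 τ₀) (boundaryLayer Ω τ₀) ∧
    ∀ y ∈ frontier Ω, ∃ (U : Set (Space m)) (σ : Space m → Space (m + 1)),
      IsOpen U ∧ ContDiffOn ℝ 2 σ U ∧ InjOn σ U ∧ y ∈ σ '' U ∧
      (∃ W : Set (Space (m + 1)), IsOpen W ∧ σ '' U = frontier Ω ∩ W) ∧
      ∀ z : Space (m + 1), z 0 ∈ Ioc 0 τ₀ → lateral z ∈ U →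
        DifferentiableAt ℝ (tubularMap ν σ) z ∧
        ‖fderiv ℝ (tubularMap ν σ) z‖ ≤ M ∧
        M⁻¹ ≤ |(fderiv ℝ (tubularMap ν σ) z).det| ∧
        |(fderiv ℝ (tubularMap ν σ) z).det| ≤ M

/-! ### Sobolev spaces -/

/-- The space `L₂(Ω; ℂ^n)`, with `‖u‖² = ∫_Ω |u|²`. -/
abbrev L2 {d : ℕ} (Ω : Set (Space d)) (n : ℕ) := Lp (CVec n) 2 (volume.restrict Ω)

/-- Pairs `(u, (v_1, …, v_d))` of elements of `L₂(Ω; ℂ^n)`, with the norm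
`(‖u‖² + ∑_j ‖v_j‖²)^(1/2)`. -/
abbrev Jet {d : ℕ} (Ω : Set (Space d)) (n : ℕ) :=
  WithLp 2 (L2 Ω n × PiLp 2 (fun _ : Fin d => L2 Ω n))

/-- `v` is the weak partial derivative `∂u/∂x_j` on `Ω`. -/
def IsWeakDeriv {d n : ℕ} (Ω : Set (Space d)) (j : Fin d) (u v : Space d → CVec n) : Prop :=
  ∀ φ : Space d → ℝ, ContDiff ℝ ∞ φ → HasCompactSupport φ → tsupport φ ⊆ Ω →
    ∫ x in Ω, fderiv ℝ φ x (EuclideanSpace.single j 1) • u x = -∫ x in Ω, φ x • v x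

/-- The Sobolev space `W₂¹(Ω; ℂ^n)`. An element is a function `u` together with its weak gradient
(which `u` determines); the norm of `Jet Ω n` is the norm `(‖u‖² + ‖∇u‖²)^(1/2)` of `W₂¹`. -/
def sobolev {d : ℕ} (Ω : Set (Space d)) (n : ℕ) : Set (Jet Ω n) :=
  {p | ∀ j : Fin d, IsWeakDeriv Ω j p.fst (p.snd j)}

/-- The elements of `W₂¹(Ω; ℂ^n)` given by infinitely differentiable functions with compact
support in `Ω`. -/
def testFunctions {d : ℕ} (Ω : Set (Space d)) (n : ℕ) : Set (Jet Ω n) :=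
  {p | p ∈ sobolev Ω n ∧ ∃ φ : Space d → CVec n, ContDiff ℝ ∞ φ ∧ HasCompactSupport φ ∧
    tsupport φ ⊆ Ω ∧ p.fst =ᵐ[volume.restrict Ω] φ}

/-- The subspace of `W₂¹(Ω; ℂ^n)` of the functions that vanish on `∂Ω`: the closure in `W₂¹` of
the infinitely differentiable functions with compact support in `Ω`. -/
def sobolevZero {d : ℕ} (Ω : Set (Space d)) (n : ℕ) : Set (Jet Ω n) :=
  sobolev Ω n ∩ closure (testFunctions Ω n)

/-- The two kinds of boundary conditions. -/
inductive BoundaryCondition : Type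
  | dirichlet
  | robin

/-- The space `𝔙`: the functions of `W₂¹(Ω; ℂ^n)` with zero trace for the Dirichlet condition, and
all of `W₂¹(Ω; ℂ^n)` for the Robin condition. -/
def formDomain {d : ℕ} (bc : BoundaryCondition) (Ω : Set (Space d)) (n : ℕ) : Set (Jet Ω n) :=
  match bc with
  | .dirichlet => sobolevZero Ω n
  | .robin => sobolev Ω n

/-! ### Matrix functions and multipliers -/

/-- Matrix functions on `ℝ^d`; only their values on `Ω` matter. -/
abbrev MatFun (d n : ℕ) := Space d → Matrix (Fin n) (Fin n) ℂ

/-- `|A| = ∑_{i,j} |a_{ij}|`. -/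
def matAbs {n : ℕ} (A : Matrix (Fin n) (Fin n) ℂ) : ℝ := ∑ i, ∑ j, ‖A i j‖

/-- `Q ∈ L_∞(Ω; 𝕄_n)`. -/
def MemLinfty {d n : ℕ} (Ω : Set (Space d)) (Q : MatFun d n) : Prop :=
  ∀ i j, MemLp (fun x => Q x i j) ⊤ (volume.restrict Ω)

/-- The norm of `L_∞(Ω; 𝕄_n)`, the essential supremum of `|Q(x)|` over `Ω`. -/
def linftyNorm {d n : ℕ} (Ω : Set (Space d)) (Q : MatFun d n) : ℝ≥0∞ :=
  eLpNorm (fun x => matAbs (Q x)) ⊤ (volume.restrict Ω)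

/-- The function `x ↦ Q(x) u(x)`. -/
def mulFun {d n : ℕ} (Q : MatFun d n) (u : Space d → CVec n) : Space d → CVec n :=
  fun x => WithLp.toLp 2 (Q x *ᵥ WithLp.ofLp (u x))

/-- The supremum of `‖Q u‖_{L₂(Ω)} / ‖u‖_𝔙` over nonzero `u ∈ 𝔙`, as an extended number. -/
def multiplierENorm {d n : ℕ} (bc : BoundaryCondition) (Ω : Set (Space d)) (Q : MatFun d n) :
    ℝ≥0∞ :=
  ⨆ (u : Jet Ω n) (_ : u ∈ formDomain bc Ω n) (_ : u ≠ 0),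
    eLpNorm (mulFun Q u.fst) 2 (volume.restrict Ω) / ‖u‖ₑ

/-- The space `𝔐_{1,0}` of multipliers from `𝔙` into `L₂(Ω; ℂ^n)`: the measurable matrix functions
`Q` on `Ω` for which `u ↦ Q u` is a bounded operator from `𝔙` into `L₂(Ω; ℂ^n)`. -/
def MemM10 {d n : ℕ} (bc : BoundaryCondition) (Ω : Set (Space d)) (Q : MatFun d n) : Prop :=
  (∀ i j, AEStronglyMeasurable (fun x => Q x i j) (volume.restrict Ω)) ∧
    multiplierENorm bc Ω Q < ⊤

/-- The norm of `𝔐_{1,0}`. -/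
def normM10 {d n : ℕ} (bc : BoundaryCondition) (Ω : Set (Space d)) (Q : MatFun d n) : ℝ :=
  (multiplierENorm bc Ω Q).toReal

/-- The family `Q i` converges to `Q₀` in `𝔐_{1,0}` along the filter `l`. -/
def ConvergesM10 {d n : ℕ} {ι : Type*} (bc : BoundaryCondition) (Ω : Set (Space d))
    (l : Filter ι) (Q : ι → MatFun d n) (Q₀ : MatFun d n) : Prop :=
  (∀ i, MemM10 bc Ω (Q i)) ∧ MemM10 bc Ω Q₀ ∧
    Tendsto (fun i => normM10 bc Ω (Q i - Q₀)) l (𝓝 0)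

/-! ### Lattice cells -/

/-- `cell` is a periodicity cell of the lattice `Γ`: a bounded convex set whose translates by the
vectors of `Γ` cover the space and do not overlap, up to sets of measure zero. Examples are the
open, the half-open and the closed parallelepiped spanned by a basis of `Γ`. -/
def IsPeriodicityCell {d : ℕ} (Γ : Submodule ℤ (Space d)) (cell : Set (Space d)) : Prop :=
  Bornology.IsBounded cell ∧ Convex ℝ cell ∧ IsAddFundamentalDomain Γ cell volume

/-- The cell `η cell + η γ = {x : η⁻¹ x - γ ∈ cell}`. -/
def scaledCell {d : ℕ} (cell : Set (Space d)) (η : ℝ) (γ : Space d) : Set (Space d) :=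
  {x | η⁻¹ • x - γ ∈ cell}

/-- The set `Γ_η` of the `γ ∈ Γ` whose cell lies in `Ω`. -/
def innerLattice {d : ℕ} (Ω : Set (Space d)) (Γ : Submodule ℤ (Space d)) (cell : Set (Space d))
    (η : ℝ) : Set (Space d) :=
  {γ | γ ∈ Γ ∧ scaledCell cell η γ ⊆ Ω}

/-- The integral of `η^(-d) |R|²` over each cell of size `η` in `Ω` is at most `ρ`. -/
def CellBound {d n : ℕ} (Ω : Set (Space d)) (Γ : Submodule ℤ (Space d)) (cell : Set (Space d))
    (R : MatFun d n) (η ρ : ℝ) : Prop :=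
  ∀ γ ∈ innerLattice Ω Γ cell η,
    ∫ x in scaledCell cell η γ, (η ^ d)⁻¹ * matAbs (R x) ^ 2 ≤ ρ

end Multipliers

end

open Multipliers

namespace Multipliers

/-! ### Pointwise bounds for matrices -/

/-! Write `R` for the difference of the family and its limit, with `|R| ≤ K` uniformly.

Small cell averages imply a small multiplier norm. Up to a null set, `Ω` is covered by the lattice
cells of size `η` inside `Ω` and by a boundary layer of width `η D`, where `D` bounds the diameter
of the unit cell. On a cell `A`, the inequality `|u(x)|² ≤ 2|u(y)|² + 2|u(y) - u(x)|²` is multiplied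
by `|R(x)|²` and integrated over `A × A`. The first term involves only the mean of `|R|²`, hence
`ρ`. The second is controlled by `K²` and a Poincaré inequality on convex sets, and has order `η²`
(`lintegral_weight_mul_le`). In the layer `R` is merely bounded, but `u` has small mass there: along
each normal ray a trace-type estimate gives `∫ |u|² ≤ C t ‖u‖²` for width `t`
(`lintegral_boundaryLayer_le`). Adding up, the squared multiplier norm is `O(ρ + η)`.

Conversely, let `N` be the multiplier norm of `R` and test it on `χ e_k`, with `χ` a cutoff of a
cell of size `η`. This bounds `∫ |R|²` where `χ = 1` by a multiple of `N² (‖χ‖² + ‖∇χ‖²)`. A cutoff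
of transition width `a` has gradient of order `1/a`, living in an inner shell of relative volume of
order `a/η` (`exists_cutoff`, `volume_inner_shell_le`); the boundedness of `R` handles the shell
itself. The mean of `|R|²` over the cell is thus `O(N² + N²/(aη) + a/η)`, and `a = N`, `η = √N`
makes every term `O(√N)` (`exists_cellBound_of_normM10`).

Adjoints: the Frobenius norm is invariant under adjunction, and `|Q|²_F |u|² = ∑_{k,j} |Q (u_j
e_k)|²`. For fixed `k`, the functions `u_j e_k` lie in the form domain and their squared norms sum
to `‖u‖²`. The `n` choices of `k` give the factor `√n` (`multiplierENorm_conjTranspose_le`).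

Sobolev functions are treated by interior mollification: smooth estimates are proved at a positive
distance from the boundary with constants independent of that distance, then passed to the limit by
Fatou and exhaustion. No extension across the boundary is needed. -/

lemma matAbs_nonneg {n : ℕ} (A : Matrix (Fin n) (Fin n) ℂ) : 0 ≤ matAbs A :=
  Finset.sum_nonneg fun _ _ => Finset.sum_nonneg fun _ _ => norm_nonneg _

lemma matAbs_sub_le {n : ℕ} (A B : Matrix (Fin n) (Fin n) ℂ) :
    matAbs (A - B) ≤ matAbs A + matAbs B := by
  simp only [matAbs, ← Finset.sum_add_distrib]
  exact Finset.sum_le_sum fun i _ => Finset.sum_le_sum fun j _ => norm_sub_le _ _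

lemma matAbs_eq_zero {n : ℕ} {A : Matrix (Fin n) (Fin n) ℂ} (h : matAbs A = 0) : A = 0 := by
  ext i j
  have h1 := (Finset.sum_eq_zero_iff_of_nonneg
    (fun _ _ => Finset.sum_nonneg fun _ _ => norm_nonneg _)).1 h i (Finset.mem_univ _)
  simpa using (Finset.sum_eq_zero_iff_of_nonneg (fun _ _ => norm_nonneg _)).1 h1 j
    (Finset.mem_univ _)

/-- The square of the Frobenius norm. -/
noncomputable def frobSq {n : ℕ} (A : Matrix (Fin n) (Fin n) ℂ) : ℝ := ∑ i, ∑ j, ‖A i j‖ ^ 2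

lemma frobSq_nonneg {n : ℕ} (A : Matrix (Fin n) (Fin n) ℂ) : 0 ≤ frobSq A :=
  Finset.sum_nonneg fun _ _ => Finset.sum_nonneg fun _ _ => sq_nonneg _

lemma frobSq_conjTranspose {n : ℕ} (A : Matrix (Fin n) (Fin n) ℂ) : frobSq Aᴴ = frobSq A := by
  simp only [frobSq, Matrix.conjTranspose_apply, norm_star]
  exact Finset.sum_comm

lemma frobSq_le_matAbs_sq {n : ℕ} (A : Matrix (Fin n) (Fin n) ℂ) :
    frobSq A ≤ matAbs A ^ 2 := by
  have h1 : frobSq A ≤ ∑ i, (∑ j, ‖A i j‖) ^ 2 := Finset.sum_le_sum fun i _ =>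
    Finset.sum_sq_le_sq_sum_of_nonneg fun _ _ => norm_nonneg _
  exact h1.trans (Finset.sum_sq_le_sq_sum_of_nonneg fun _ _ =>
    Finset.sum_nonneg fun _ _ => norm_nonneg _)

lemma matAbs_sq_le_frobSq {n : ℕ} (A : Matrix (Fin n) (Fin n) ℂ) :
    matAbs A ^ 2 ≤ n ^ 2 * frobSq A := by
  have h0 : matAbs A ^ 2 ≤ n * ∑ i, (∑ j, ‖A i j‖) ^ 2 := by
    simpa [matAbs] using sq_sum_le_card_mul_sum_sq (s := (Finset.univ : Finset (Fin n)))
      (f := fun i => ∑ j, ‖A i j‖)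
  have h1 : ∑ i, (∑ j, ‖A i j‖) ^ 2 ≤ ∑ i, (n : ℝ) * ∑ j, ‖A i j‖ ^ 2 :=
    Finset.sum_le_sum fun i _ => by
      simpa using sq_sum_le_card_mul_sum_sq (s := (Finset.univ : Finset (Fin n)))
        (f := fun j => ‖A i j‖)
  rw [← Finset.mul_sum] at h1
  calc matAbs A ^ 2 ≤ n * ∑ i, (∑ j, ‖A i j‖) ^ 2 := h0
    _ ≤ n * (n * frobSq A) := by gcongr; exact h1
    _ = n ^ 2 * frobSq A := by ring

lemma norm_sq_mulVec_le_frobSq {n : ℕ} (A : Matrix (Fin n) (Fin n) ℂ) (v : CVec n) :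
    ‖(WithLp.toLp 2 (A *ᵥ WithLp.ofLp v) : CVec n)‖ ^ 2 ≤ frobSq A * ‖v‖ ^ 2 := by
  rw [EuclideanSpace.norm_sq_eq, EuclideanSpace.norm_sq_eq, frobSq, Finset.sum_mul]
  refine Finset.sum_le_sum fun i _ => ?_
  have h : ‖(A *ᵥ WithLp.ofLp v) i‖ ≤ ∑ j, ‖A i j‖ * ‖v j‖ := by
    simp only [Matrix.mulVec, dotProduct]
    refine (norm_sum_le _ _).trans (Finset.sum_le_sum fun j _ => (norm_mul _ _).le)
  calc ‖(A *ᵥ WithLp.ofLp v) i‖ ^ 2 ≤ (∑ j, ‖A i j‖ * ‖v j‖) ^ 2 := by gcongr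
    _ ≤ _ := Finset.sum_mul_sq_le_sq_mul_sq _ _ _

lemma norm_mulVec_le_matAbs {n : ℕ} (A : Matrix (Fin n) (Fin n) ℂ) (v : CVec n) :
    ‖(WithLp.toLp 2 (A *ᵥ WithLp.ofLp v) : CVec n)‖ ≤ matAbs A * ‖v‖ := by
  refine le_of_sq_le_sq ?_ (mul_nonneg (matAbs_nonneg _) (norm_nonneg _))
  rw [mul_pow]
  exact (norm_sq_mulVec_le_frobSq A v).trans
    (mul_le_mul_of_nonneg_right (frobSq_le_matAbs_sq A) (sq_nonneg _))

lemma sum_norm_sq_mulVec_single {n : ℕ} (A : Matrix (Fin n) (Fin n) ℂ) (c : ℂ) :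
    ∑ k, ‖(WithLp.toLp 2 (A *ᵥ WithLp.ofLp (EuclideanSpace.single k c : CVec n)) : CVec n)‖ ^ 2
      = frobSq A * ‖c‖ ^ 2 := by
  have h : ∀ k i, (A *ᵥ WithLp.ofLp (EuclideanSpace.single k c : CVec n)) i = A i k * c := by
    intro k i
    simp [Matrix.mulVec, dotProduct]
  simp only [EuclideanSpace.norm_sq_eq, h, norm_mul, mul_pow, ← Finset.sum_mul, frobSq]
  rw [Finset.sum_comm]

lemma enorm_mulFun_le {d n : ℕ} (Q : MatFun d n) (u : Space d → CVec n) (x : Space d) :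
    ‖mulFun Q u x‖ₑ ≤ ENNReal.ofReal (matAbs (Q x)) * ‖u x‖ₑ := by
  rw [← ofReal_norm, ← ofReal_norm, ← ENNReal.ofReal_mul (matAbs_nonneg _)]
  exact ENNReal.ofReal_le_ofReal (norm_mulVec_le_matAbs _ _)

/-! ### Norms as integrals -/

lemma enorm_sq_eq_ofReal {E : Type*} [SeminormedAddCommGroup E] (x : E) :
    ‖x‖ₑ ^ 2 = ENNReal.ofReal (‖x‖ ^ 2) := by
  rw [ENNReal.ofReal_pow (norm_nonneg _), ofReal_norm]

lemma eLpNorm_two_sq {α E : Type*} [MeasurableSpace α] [ENorm E] (μ : Measure α)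
    (f : α → E) : eLpNorm f 2 μ ^ 2 = ∫⁻ x, ‖f x‖ₑ ^ 2 ∂μ := by
  have h := eLpNorm_nnreal_pow_eq_lintegral (f := f) (μ := μ) (p := 2) (by norm_num)
  simpa using h

lemma L2.enorm_sq {d n : ℕ} {Ω : Set (Space d)} (f : L2 Ω n) :
    ‖f‖ₑ ^ 2 = ∫⁻ x in Ω, ‖f x‖ₑ ^ 2 := by
  rw [← eLpNorm_two_sq, Lp.enorm_def]

/-- The square of the length of the weak gradient. -/
noncomputable def gradSq {d n : ℕ} {Ω : Set (Space d)} (p : Jet Ω n) (x : Space d) : ℝ≥0∞ :=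
  ∑ j, ‖p.snd j x‖ₑ ^ 2

lemma Jet.enorm_sq {d n : ℕ} {Ω : Set (Space d)} (p : Jet Ω n) :
    ‖p‖ₑ ^ 2 = (∫⁻ x in Ω, ‖p.fst x‖ₑ ^ 2) + ∫⁻ x in Ω, gradSq p x := by
  have h1 : ∫⁻ x in Ω, gradSq p x = ∑ j, ‖p.snd j‖ₑ ^ 2 := by
    simp only [gradSq]
    rw [lintegral_finsetSum']
    · exact Finset.sum_congr rfl fun j _ => (L2.enorm_sq _).symm
    · intro j _
      exact ((Lp.aestronglyMeasurable (p.snd j)).enorm).pow_const 2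
  rw [h1, ← L2.enorm_sq, enorm_sq_eq_ofReal, WithLp.prod_norm_sq_eq_of_L2,
    PiLp.norm_sq_eq_of_L2, ENNReal.ofReal_add (sq_nonneg _)
      (Finset.sum_nonneg fun _ _ => sq_nonneg _),
    ENNReal.ofReal_sum_of_nonneg fun _ _ => sq_nonneg _]
  simp only [enorm_sq_eq_ofReal]

/-! ### Multiplier norm as an operator bound; bounded matrix functions -/

lemma eLpNorm_mulFun_le {d n : ℕ} {bc : BoundaryCondition} {Ω : Set (Space d)} {Q : MatFun d n}
    {u : Jet Ω n} (hu : u ∈ formDomain bc Ω n) :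
    eLpNorm (mulFun Q u.fst) 2 (volume.restrict Ω) ≤ multiplierENorm bc Ω Q * ‖u‖ₑ := by
  -- The supremum leaves out `u = 0`; there the representative vanishes almost everywhere.
  by_cases h0 : u = 0
  · have h : eLpNorm (mulFun Q u.fst) 2 (volume.restrict Ω) = 0 := by
      have hz : mulFun Q u.fst =ᵐ[volume.restrict Ω] 0 := by
        have : (u.fst : Space d → CVec n) =ᵐ[volume.restrict Ω] 0 := by
          rw [h0]; exact Lp.coeFn_zero _ _ _
        filter_upwards [this] with x hx
        simp [mulFun, hx]
      rw [eLpNorm_congr_ae hz, eLpNorm_zero]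
    rw [h]; exact zero_le
  · have h1 : ‖u‖ₑ ≠ 0 := by simpa using h0
    rw [← ENNReal.div_le_iff h1 (by simp)]
    exact le_iSup₂_of_le u hu (le_iSup_of_le h0 le_rfl)

lemma lintegral_mulFun_le {d n : ℕ} {bc : BoundaryCondition} {Ω : Set (Space d)} {Q : MatFun d n}
    {u : Jet Ω n} (hu : u ∈ formDomain bc Ω n) :
    ∫⁻ x in Ω, ‖mulFun Q u.fst x‖ₑ ^ 2 ≤ multiplierENorm bc Ω Q ^ 2 * ‖u‖ₑ ^ 2 := by
  rw [← eLpNorm_two_sq, ← mul_pow]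
  gcongr
  exact eLpNorm_mulFun_le hu

lemma multiplierENorm_le {d n : ℕ} {bc : BoundaryCondition} {Ω : Set (Space d)} {Q : MatFun d n}
    {C : ℝ≥0∞} (h : ∀ u ∈ formDomain bc Ω n,
      ∫⁻ x in Ω, ‖mulFun Q u.fst x‖ₑ ^ 2 ≤ C ^ 2 * ‖u‖ₑ ^ 2) :
    multiplierENorm bc Ω Q ≤ C := by
  refine iSup₂_le fun u hu => iSup_le fun h0 => ?_
  have h1 : ‖u‖ₑ ≠ 0 := by simpa using h0
  rw [ENNReal.div_le_iff h1 (by simp)]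
  have h2 := h u hu
  rw [← eLpNorm_two_sq, ← mul_pow] at h2
  exact (ENNReal.pow_le_pow_left_iff two_ne_zero).1 h2

lemma ae_matAbs_le {d n : ℕ} {Ω : Set (Space d)} {Q : MatFun d n} {K : ℝ≥0}
    (h : linftyNorm Ω Q ≤ K) : ∀ᵐ x ∂volume.restrict Ω, matAbs (Q x) ≤ K := by
  have h1 := ae_le_eLpNormEssSup (f := fun x => matAbs (Q x)) (μ := volume.restrict Ω)
  filter_upwards [h1] with x hx
  rw [linftyNorm, eLpNorm_exponent_top] at h
  have h2 := hx.trans h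
  rw [← ofReal_norm, Real.norm_of_nonneg (matAbs_nonneg _)] at h2
  rw [← ENNReal.ofReal_coe_nnreal] at h2
  exact (ENNReal.ofReal_le_ofReal_iff K.2).1 h2

lemma MemLinfty.exists_bound {d n : ℕ} {Ω : Set (Space d)} {Q : MatFun d n}
    (h : MemLinfty Ω Q) : ∃ K : ℝ≥0, linftyNorm Ω Q ≤ K := by
  have h1 : MemLp (fun x => matAbs (Q x)) ⊤ (volume.restrict Ω) := by
    simp only [matAbs]
    exact memLp_finsetSum _ fun i _ => memLp_finsetSum _ fun j _ => (h i j).norm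
  exact ⟨(eLpNorm (fun x => matAbs (Q x)) ⊤ (volume.restrict Ω)).toNNReal,
    (ENNReal.coe_toNNReal h1.2.ne).ge⟩

lemma MemLinfty.sub {d n : ℕ} {Ω : Set (Space d)} {Q Q' : MatFun d n}
    (h : MemLinfty Ω Q) (h' : MemLinfty Ω Q') : MemLinfty Ω (Q - Q') :=
  fun i j => (h i j).sub (h' i j)

lemma aestronglyMeasurable_matAbs {d n : ℕ} {Ω : Set (Space d)} {Q : MatFun d n}
    (h : ∀ i j, AEStronglyMeasurable (fun x => Q x i j) (volume.restrict Ω)) :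
    AEStronglyMeasurable (fun x => matAbs (Q x)) (volume.restrict Ω) := by
  simp only [matAbs]
  exact Finset.aestronglyMeasurable_fun_sum _ fun i _ =>
    Finset.aestronglyMeasurable_fun_sum _ fun j _ => (h i j).norm

lemma lintegral_mulFun_le_of_bound {d n : ℕ} {Ω : Set (Space d)} {Q : MatFun d n} {K : ℝ}
    (hK : ∀ᵐ x ∂volume.restrict Ω, matAbs (Q x) ≤ K) {S : Set (Space d)} (hS : S ⊆ Ω)
    (u : Space d → CVec n) :
    ∫⁻ x in S, ‖mulFun Q u x‖ₑ ^ 2 ≤ ENNReal.ofReal K ^ 2 * ∫⁻ x in S, ‖u x‖ₑ ^ 2 := by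
  rw [← lintegral_const_mul' _ _ (by simp)]
  refine lintegral_mono_ae ?_
  filter_upwards [ae_mono (Measure.restrict_mono hS le_rfl) hK] with x hx
  rw [← mul_pow]
  gcongr
  exact (enorm_mulFun_le _ _ _).trans (by gcongr)

lemma multiplierENorm_le_of_bound {d n : ℕ} {bc : BoundaryCondition} {Ω : Set (Space d)}
    {Q : MatFun d n} {K : ℝ} (hK : ∀ᵐ x ∂volume.restrict Ω, matAbs (Q x) ≤ K) :
    multiplierENorm bc Ω Q ≤ ENNReal.ofReal K := by
  refine multiplierENorm_le fun u _ =>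
    (lintegral_mulFun_le_of_bound hK subset_rfl _).trans ?_
  gcongr
  rw [Jet.enorm_sq]
  exact le_self_add

lemma MemLinfty.memM10 {d n : ℕ} {Ω : Set (Space d)} {Q : MatFun d n} (bc : BoundaryCondition)
    (h : MemLinfty Ω Q) : MemM10 bc Ω Q := by
  obtain ⟨K, hK⟩ := h.exists_bound
  exact ⟨fun i j => (h i j).1,
    (multiplierENorm_le_of_bound (ae_matAbs_le hK)).trans_lt ENNReal.ofReal_lt_top⟩

/-! ### Linear maps acting on the values of Sobolev functions -/

/-- The action of a linear map of the values on functions and their weak gradients. -/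
noncomputable def Jet.map {d n : ℕ} {Ω : Set (Space d)} (L : CVec n →L[ℂ] CVec n) (p : Jet Ω n) :
    Jet Ω n :=
  WithLp.toLp 2 (L.compLp p.fst, WithLp.toLp 2 fun j => L.compLp (p.snd j))

lemma Jet.continuous_map {d n : ℕ} {Ω : Set (Space d)} (L : CVec n →L[ℂ] CVec n) :
    Continuous (Jet.map L : Jet Ω n → Jet Ω n) := by
  have h : Continuous (fun f : L2 Ω n => (L.compLp f : L2 Ω n)) :=
    (L.compLpL 2 (volume.restrict Ω)).continuous
  have h2 : Continuous fun p : Jet Ω n => p.fst := by fun_prop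
  have h3 : ∀ j, Continuous fun p : Jet Ω n => p.snd j := by
    intro j
    fun_prop
  unfold Jet.map
  refine (WithLp.prod_continuous_toLp 2 _ _).comp ((h.comp h2).prodMk ?_)
  exact (PiLp.continuous_toLp 2 _).comp (continuous_pi fun j => h.comp (h3 j))

/-- A constant linear map commutes with the integrals against test functions that define the weak
derivative. -/
lemma IsWeakDeriv.map {d n : ℕ} {Ω : Set (Space d)} {j : Fin d} {u v : L2 Ω n}
    (h : IsWeakDeriv Ω j u v) (L : CVec n →L[ℂ] CVec n) :
    IsWeakDeriv Ω j (L.compLp u) (L.compLp v) := by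
  have key : ∀ (w : L2 Ω n) (ψ : Space d → ℝ), Continuous ψ → HasCompactSupport ψ →
      ∫ x in Ω, ψ x • (L.compLp w) x = L (∫ x in Ω, ψ x • w x) := by
    intro w ψ hψ hψc
    have hint : Integrable (fun x => ψ x • w x) (volume.restrict Ω) := by
      have := (hψ.memLp_of_hasCompactSupport (p := 2) (μ := volume.restrict Ω) hψc)
      exact memLp_one_iff_integrable.1 ((Lp.memLp w).smul this)
    rw [← L.integral_comp_comm hint]
    refine integral_congr_ae ?_
    filter_upwards [L.coeFn_compLp w] with x hx
    rw [hx, L.map_smul_of_tower]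
  intro φ hφ hφc hφs
  rw [key v φ hφ.continuous hφc, key u (fun x => fderiv ℝ φ x (EuclideanSpace.single j 1)) (by
    exact (hφ.continuous_fderiv (by simp)).clm_apply continuous_const)
    ((hφc.fderiv (𝕜 := ℝ)).comp_left (g := fun l : Space d →L[ℝ] ℝ =>
      l (EuclideanSpace.single j 1)) rfl), h φ hφ hφc hφs, map_neg]

lemma sobolev.map {d n : ℕ} {Ω : Set (Space d)} {p : Jet Ω n} (h : p ∈ sobolev Ω n)
    (L : CVec n →L[ℂ] CVec n) : p.map L ∈ sobolev Ω n :=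
  fun j => (h j).map L

lemma testFunctions.map {d n : ℕ} {Ω : Set (Space d)} {p : Jet Ω n} (h : p ∈ testFunctions Ω n)
    (L : CVec n →L[ℂ] CVec n) : p.map L ∈ testFunctions Ω n := by
  obtain ⟨hp, φ, h1, h2, h3, h4⟩ := h
  refine ⟨sobolev.map hp L, fun x => L (φ x), ?_, h2.comp_left (map_zero L), ?_, ?_⟩
  · exact (L.restrictScalars ℝ).contDiff.comp h1
  · exact (tsupport_comp_subset (map_zero L) φ).trans h3
  · filter_upwards [h4, L.coeFn_compLp p.fst] with x hx hx2
    rw [← hx]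
    exact hx2

/-- Makes `u_j e_k` admissible for both boundary conditions. In the Dirichlet case the map is
continuous and preserves test functions, hence also their closure. -/
lemma formDomain.map {d n : ℕ} {bc : BoundaryCondition} {Ω : Set (Space d)} {p : Jet Ω n}
    (h : p ∈ formDomain bc Ω n) (L : CVec n →L[ℂ] CVec n) : p.map L ∈ formDomain bc Ω n := by
  cases bc with
  | robin => exact sobolev.map h L
  | dirichlet =>
    refine ⟨sobolev.map h.1 L, ?_⟩
    exact map_mem_closure (Jet.continuous_map L) h.2 fun q hq => testFunctions.map hq L

/-! ### Adjoint multipliers -/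

/-- The map `v ↦ v_j e_k`. -/
noncomputable def coordMap {n : ℕ} (k j : Fin n) : CVec n →L[ℂ] CVec n :=
  (ContinuousLinearMap.toSpanSingleton ℂ (EuclideanSpace.single k (1 : ℂ) : CVec n)).comp
    (EuclideanSpace.proj j)

lemma coordMap_apply {n : ℕ} (k j : Fin n) (v : CVec n) :
    coordMap k j v = EuclideanSpace.single k (v j) := by
  ext i
  simp [coordMap]

lemma sum_enorm_coordMap {n : ℕ} (k : Fin n) (v : CVec n) :
    ∑ j, ‖coordMap k j v‖ₑ ^ 2 = ‖v‖ₑ ^ 2 := by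
  simp only [enorm_sq_eq_ofReal, coordMap_apply]
  rw [← ENNReal.ofReal_sum_of_nonneg fun _ _ => sq_nonneg _, EuclideanSpace.norm_sq_eq]
  simp

/-- `A (v_j e_k)` is `v_j` times column `k` of `A`, so the double sum factors. -/
lemma sum_enorm_mulVec_coordMap {n : ℕ} (A : Matrix (Fin n) (Fin n) ℂ) (v : CVec n) :
    ∑ k, ∑ j, ‖(WithLp.toLp 2 (A *ᵥ WithLp.ofLp (coordMap k j v)) : CVec n)‖ₑ ^ 2
      = ENNReal.ofReal (frobSq A) * ‖v‖ₑ ^ 2 := by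
  simp only [enorm_sq_eq_ofReal, coordMap_apply]
  rw [← ENNReal.ofReal_mul (frobSq_nonneg A), EuclideanSpace.norm_sq_eq, Finset.mul_sum,
    Finset.sum_comm, ENNReal.ofReal_sum_of_nonneg fun _ _ =>
      mul_nonneg (frobSq_nonneg A) (sq_nonneg _)]
  refine Finset.sum_congr rfl fun j _ => ?_
  rw [← ENNReal.ofReal_sum_of_nonneg fun _ _ => sq_nonneg _, sum_norm_sq_mulVec_single]

lemma sum_enorm_map_coordMap {d n : ℕ} {Ω : Set (Space d)} (p : Jet Ω n) (k : Fin n) :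
    ∑ j, ‖p.map (coordMap k j)‖ₑ ^ 2 = ‖p‖ₑ ^ 2 := by
  have key : ∀ f : L2 Ω n, ∑ j, ‖(coordMap k j).compLp f‖ₑ ^ 2 = ‖f‖ₑ ^ 2 := by
    intro f
    simp only [L2.enorm_sq]
    rw [← lintegral_finsetSum']
    · refine lintegral_congr_ae ?_
      filter_upwards [ae_all_iff.2 fun j => (coordMap k j).coeFn_compLp f] with x hx
      simp only [hx]
      exact sum_enorm_coordMap k (f x)
    · intro j _
      exact (Lp.aestronglyMeasurable _).enorm.pow_const 2
  have h2 : ∀ q : Jet Ω n, ‖q‖ₑ ^ 2 = ‖q.fst‖ₑ ^ 2 + ∑ i, ‖q.snd i‖ₑ ^ 2 := by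
    intro q
    rw [enorm_sq_eq_ofReal, WithLp.prod_norm_sq_eq_of_L2, PiLp.norm_sq_eq_of_L2,
      ENNReal.ofReal_add (sq_nonneg _) (Finset.sum_nonneg fun _ _ => sq_nonneg _),
      ENNReal.ofReal_sum_of_nonneg fun _ _ => sq_nonneg _]
    simp only [enorm_sq_eq_ofReal]
  rw [h2 p]
  simp only [h2 (p.map _), Finset.sum_add_distrib]
  congr 1
  · exact key p.fst
  · rw [Finset.sum_comm]
    exact Finset.sum_congr rfl fun i _ => key (p.snd i)

lemma multiplierENorm_conjTranspose_le {d n : ℕ} {bc : BoundaryCondition} {Ω : Set (Space d)}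
    {Q : MatFun d n} (hQ : ∀ i j, AEStronglyMeasurable (fun x => Q x i j) (volume.restrict Ω)) :
    multiplierENorm bc Ω (fun x => (Q x)ᴴ) ≤
      ENNReal.ofReal √(n : ℝ) * multiplierENorm bc Ω Q := by
  refine multiplierENorm_le fun u hu => ?_
  have hmeas : ∀ w : L2 Ω n, AEStronglyMeasurable (mulFun Q w) (volume.restrict Ω) := by
    intro w
    refine (PiLp.continuous_toLp 2 _).comp_aestronglyMeasurable ?_
    refine (aemeasurable_pi_lambda _ fun i => AEStronglyMeasurable.aemeasurable ?_).aestronglyMeasurable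
    simp only [Matrix.mulVec, dotProduct]
    refine Finset.aestronglyMeasurable_fun_sum _ fun j _ => (hQ i j).mul ?_
    exact (EuclideanSpace.proj (𝕜 := ℂ) j).continuous.comp_aestronglyMeasurable
      (Lp.aestronglyMeasurable w)
  -- Pointwise, the operator norm of the adjoint is at most its Frobenius norm, which is that of
  -- `Q`.
  have h1 : ∫⁻ x in Ω, ‖mulFun (fun x => (Q x)ᴴ) u.fst x‖ₑ ^ 2 ≤
      ∫⁻ x in Ω, ∑ k, ∑ j, ‖mulFun Q (u.map (coordMap k j)).fst x‖ₑ ^ 2 := by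
    refine lintegral_mono_ae ?_
    filter_upwards [ae_all_iff.2 fun k => ae_all_iff.2 fun j =>
      (coordMap k j).coeFn_compLp u.fst] with x hx
    have h2 : ∀ k j, (u.map (coordMap k j)).fst x = coordMap k j (u.fst x) := hx
    simp only [mulFun, h2]
    rw [sum_enorm_mulVec_coordMap, ← frobSq_conjTranspose, enorm_sq_eq_ofReal, enorm_sq_eq_ofReal,
      ← ENNReal.ofReal_mul (frobSq_nonneg _)]
    exact ENNReal.ofReal_le_ofReal (norm_sq_mulVec_le_frobSq _ _)
  refine h1.trans ?_
  rw [lintegral_finsetSum' _ fun k _ => Finset.aemeasurable_fun_sum _ fun j _ =>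
    (hmeas _).enorm.pow_const 2]
  have h3 : ∀ k, ∫⁻ x in Ω, ∑ j, ‖mulFun Q (u.map (coordMap k j)).fst x‖ₑ ^ 2 ≤
      multiplierENorm bc Ω Q ^ 2 * ‖u‖ₑ ^ 2 := by
    intro k
    rw [lintegral_finsetSum' _ fun j _ => (hmeas _).enorm.pow_const 2,
      ← sum_enorm_map_coordMap u k, Finset.mul_sum]
    exact Finset.sum_le_sum fun j _ => lintegral_mulFun_le (formDomain.map hu _)
  refine (Finset.sum_le_sum fun k _ => h3 k).trans (le_of_eq ?_)
  have h4 : ENNReal.ofReal √(n : ℝ) ^ 2 = n := by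
    rw [← ENNReal.ofReal_pow (Real.sqrt_nonneg _), Real.sq_sqrt (Nat.cast_nonneg _),
      ENNReal.ofReal_natCast]
  rw [mul_pow, h4]
  simp [mul_assoc]

theorem MemM10.conjTranspose {d n : ℕ} {bc : BoundaryCondition} {Ω : Set (Space d)}
    {Q : MatFun d n} (hQ : MemM10 bc Ω Q) :
    MemM10 bc Ω (fun x => (Q x)ᴴ) ∧
      normM10 bc Ω (fun x => (Q x)ᴴ) ≤ √(n : ℝ) * normM10 bc Ω Q := by
  have h := multiplierENorm_conjTranspose_le (bc := bc) hQ.1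
  have h2 : ENNReal.ofReal √(n : ℝ) * multiplierENorm bc Ω Q < ⊤ :=
    ENNReal.mul_lt_top ENNReal.ofReal_lt_top hQ.2
  refine ⟨⟨fun i j => ?_, h.trans_lt h2⟩, ?_⟩
  · simp only [Matrix.conjTranspose_apply]
    exact continuous_star.comp_aestronglyMeasurable (hQ.1 j i)
  · have h3 := ENNReal.toReal_mono h2.ne h
    rwa [ENNReal.toReal_mul, ENNReal.toReal_ofReal (Real.sqrt_nonneg _)] at h3

/-! ### Mollification -/

open scoped Convolution

/-- The mollification of `g` by the normalized bump function `φ`. -/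
noncomputable def mollify {d : ℕ} {E : Type*} [NormedAddCommGroup E] [NormedSpace ℝ E]
    (φ : ContDiffBump (0 : Space d)) (g : Space d → E) : Space d → E :=
  φ.normed volume ⋆[ContinuousLinearMap.lsmul ℝ ℝ, volume] g

section Mollify

variable {d : ℕ} {E : Type*} [NormedAddCommGroup E] [NormedSpace ℝ E]

lemma mollify_eq {φ : ContDiffBump (0 : Space d)} {g : Space d → E} (x : Space d) :
    mollify φ g x = ∫ t, φ.normed volume (x - t) • g t := by
  rw [mollify, convolution_eq_swap]
  rfl

lemma contDiff_mollify [CompleteSpace E] (φ : ContDiffBump (0 : Space d)) {g : Space d → E}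
    (hg : LocallyIntegrable g) : ContDiff ℝ ∞ (mollify φ g) :=
  φ.hasCompactSupport_normed.contDiff_convolution_left _ (φ.contDiff_normed (n := ⊤)) hg

/-- The probability measure with density `φ`. -/
noncomputable def bumpMeasure (φ : ContDiffBump (0 : Space d)) : Measure (Space d) :=
  volume.withDensity fun t => ENNReal.ofReal (φ.normed volume t)

instance (φ : ContDiffBump (0 : Space d)) : IsProbabilityMeasure (bumpMeasure φ) := by
  constructor
  rw [bumpMeasure, withDensity_apply _ MeasurableSet.univ, setLIntegral_univ,
    ← ofReal_integral_eq_lintegral_ofReal φ.integrable_normed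
      (Eventually.of_forall φ.nonneg_normed), φ.integral_normed, ENNReal.ofReal_one]

lemma ae_bumpMeasure (φ : ContDiffBump (0 : Space d)) :
    ∀ᵐ t ∂bumpMeasure φ, t ∈ Metric.ball (0 : Space d) φ.rOut := by
  rw [bumpMeasure, ae_withDensity_iff (by
    exact φ.continuous_normed.measurable.ennreal_ofReal)]
  refine Eventually.of_forall fun t ht => ?_
  rw [← φ.support_normed_eq (μ := volume)]
  intro h0
  simp [h0] at ht

/-- As an average over a probability measure, mollification is open to Jensen's inequality and
preserves sup and Lipschitz bounds. -/
lemma mollify_eq_bumpMeasure (φ : ContDiffBump (0 : Space d)) (g : Space d → E) (x : Space d) :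
    mollify φ g x = ∫ t, g (x - t) ∂bumpMeasure φ := by
  rw [bumpMeasure, integral_withDensity_eq_integral_toReal_smul
    φ.continuous_normed.measurable.ennreal_ofReal (by simp)]
  rw [mollify, convolution_def]
  simp [ENNReal.toReal_ofReal (φ.nonneg_normed _)]

lemma enorm_sq_mollify_le (φ : ContDiffBump (0 : Space d)) {g : Space d → E}
    (hg : StronglyMeasurable g) (x : Space d) :
    ‖mollify φ g x‖ₑ ^ 2 ≤ ∫⁻ t, ‖g (x - t)‖ₑ ^ 2 ∂bumpMeasure φ := by
  have hm : AEStronglyMeasurable (fun t => g (x - t)) (bumpMeasure φ) :=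
    (hg.comp_measurable (measurable_const.sub measurable_id)).aestronglyMeasurable
  rw [← eLpNorm_two_sq]
  gcongr
  calc ‖mollify φ g x‖ₑ ≤ ∫⁻ t, ‖g (x - t)‖ₑ ∂bumpMeasure φ := by
        rw [mollify_eq_bumpMeasure]
        exact enorm_integral_le_lintegral_enorm _
    _ = eLpNorm (fun t => g (x - t)) 1 (bumpMeasure φ) := eLpNorm_one_eq_lintegral_enorm.symm
    _ ≤ eLpNorm (fun t => g (x - t)) 2 (bumpMeasure φ) :=
        eLpNorm_le_eLpNorm_of_exponent_le (by norm_num) hm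

/-- Jensen and Fubini: for each shift `t` in the support of the bump, `S - t` lies in `A`. The local
form, with two sets, dispenses with any extension beyond `Ω`. -/
lemma lintegral_mollify_le (φ : ContDiffBump (0 : Space d)) {g : Space d → E}
    (hg : StronglyMeasurable g) {S A : Set (Space d)} (hS : MeasurableSet S)
    (hSA : ∀ x ∈ S, Metric.ball x φ.rOut ⊆ A) :
    ∫⁻ x in S, ‖mollify φ g x‖ₑ ^ 2 ≤ ∫⁻ x in A, ‖g x‖ₑ ^ 2 := by
  refine (lintegral_mono fun x => enorm_sq_mollify_le φ hg x).trans ?_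
  rw [lintegral_lintegral_swap]
  · have key : ∀ t ∈ Metric.ball (0 : Space d) φ.rOut,
        ∫⁻ x in S, ‖g (x - t)‖ₑ ^ 2 ≤ ∫⁻ x in A, ‖g x‖ₑ ^ 2 := by
      intro t ht
      calc ∫⁻ x in S, ‖g (x - t)‖ₑ ^ 2 = ∫⁻ x, S.indicator (fun x => ‖g (x - t)‖ₑ ^ 2) x :=
            (lintegral_indicator hS _).symm
        _ ≤ ∫⁻ x, A.indicator (fun x => ‖g x‖ₑ ^ 2) (x - t) := by
            refine lintegral_mono fun x => ?_
            by_cases hx : x ∈ S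
            · have hxt : x - t ∈ A := hSA x hx (by simpa [dist_eq_norm] using ht)
              rw [indicator_of_mem hx, indicator_of_mem hxt]
            · rw [indicator_of_notMem hx]
              exact zero_le
        _ = ∫⁻ x, A.indicator (fun x => ‖g x‖ₑ ^ 2) x :=
            lintegral_sub_right_eq_self (fun x => A.indicator (fun x => ‖g x‖ₑ ^ 2) x) t
        _ ≤ _ := lintegral_indicator_le _ _
    calc ∫⁻ t, (∫⁻ x in S, ‖g (x - t)‖ₑ ^ 2) ∂bumpMeasure φ
        ≤ ∫⁻ _, (∫⁻ x in A, ‖g x‖ₑ ^ 2) ∂bumpMeasure φ := by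
          refine lintegral_mono_ae ?_
          filter_upwards [ae_bumpMeasure φ] with t ht using key t ht
      _ = ∫⁻ x in A, ‖g x‖ₑ ^ 2 := by simp
  · refine Measurable.aemeasurable ?_
    exact ((hg.comp_measurable (measurable_fst.sub measurable_snd)).enorm).pow_const 2

end Mollify

/-! ### Local smooth approximation of Sobolev functions -/

lemma L2.locallyIntegrable_indicator {d n : ℕ} {Ω : Set (Space d)} (hΩ : MeasurableSet Ω)
    (f : L2 Ω n) : LocallyIntegrable (Ω.indicator f) := by
  have h : MemLp (Ω.indicator f) 2 volume := (memLp_indicator_iff_restrict hΩ).2 (Lp.memLp f)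
  exact h.locallyIntegrable (by norm_num)

lemma L2.stronglyMeasurable_indicator {d n : ℕ} {Ω : Set (Space d)} (hΩ : MeasurableSet Ω)
    (f : L2 Ω n) : StronglyMeasurable (Ω.indicator f) :=
  (Lp.stronglyMeasurable f).indicator hΩ

/-- The derivative falls on the kernel, and `t ↦ φ(x - t)` is a test function in `Ω` as soon as the
closed ball lies in `Ω`. The sign from the reflection cancels the sign in the definition of the weak
derivative. -/
lemma fderiv_mollify {d n : ℕ} {Ω : Set (Space d)} (hΩ : MeasurableSet Ω) {j : Fin d} {u v : L2 Ω n}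
    (h : IsWeakDeriv Ω j u v) (φ : ContDiffBump (0 : Space d)) {x : Space d}
    (hx : Metric.closedBall x φ.rOut ⊆ Ω) :
    fderiv ℝ (mollify φ (Ω.indicator u)) x (EuclideanSpace.single j 1) =
      mollify φ (Ω.indicator v) x := by
  have hu := L2.locallyIntegrable_indicator hΩ u
  have hφ1 : ContDiff ℝ 1 (φ.normed (volume : Measure (Space d))) := φ.contDiff_normed (n := 1)
  have hφi : ContDiff ℝ ∞ (φ.normed (volume : Measure (Space d))) := φ.contDiff_normed (n := ⊤)
  have hd := φ.hasCompactSupport_normed.hasFDerivAt_convolution_left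
    (ContinuousLinearMap.lsmul ℝ ℝ) hφ1 hu x
  rw [mollify, hd.fderiv, convolution_eq_swap, ContinuousLinearMap.integral_apply]
  · have h1 : ∀ t, fderiv ℝ (fun t => φ.normed volume (x - t)) t (EuclideanSpace.single j 1) =
        - fderiv ℝ (φ.normed volume) (x - t) (EuclideanSpace.single j 1) := by
      intro t
      have h2 : HasFDerivAt (fun t => φ.normed volume (x - t))
          ((fderiv ℝ (φ.normed volume) (x - t)).comp (-ContinuousLinearMap.id ℝ (Space d))) t := by
        refine HasFDerivAt.comp t ((hφ1.differentiable (by norm_num)) _).hasFDerivAt ?_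
        simpa using (hasFDerivAt_id t).const_sub x
      rw [h2.fderiv]
      simp
    have hts : tsupport (fun t => φ.normed volume (x - t)) ⊆ Metric.closedBall x φ.rOut := by
      refine closure_minimal (fun t ht => ?_) Metric.isClosed_closedBall
      have h3 : x - t ∈ Function.support (φ.normed (volume : Measure (Space d))) := ht
      rw [φ.support_normed_eq] at h3
      rw [Metric.mem_closedBall, dist_comm, dist_eq_norm]
      exact (mem_ball_zero_iff.1 h3).le
    have h4 := h (fun t => φ.normed volume (x - t)) (hφi.comp (contDiff_const.sub contDiff_id))
      (HasCompactSupport.of_support_subset_isCompact (isCompact_closedBall x φ.rOut)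
        (subset_closure.trans hts)) (hts.trans hx)
    simp only [h1, neg_smul, integral_neg, neg_inj] at h4
    rw [mollify_eq]
    have h5 : ∀ (c : Space d → ℝ) (f : Space d → CVec n),
        (fun t => c t • Ω.indicator f t) = Ω.indicator fun t => c t • f t := by
      intro c f
      ext1 t
      by_cases ht : t ∈ Ω <;> simp [ht]
    rw [h5, integral_indicator hΩ, ← h4, ← integral_indicator hΩ, ← h5]
    rfl
  · have h6 := (φ.hasCompactSupport_normed (μ := (volume : Measure (Space d)))).fderiv
      (𝕜 := ℝ)
    exact (h6.convolutionExists_left _ (hφ1.continuous_fderiv (by norm_num)) hu x).integrable_swap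

/-- The square of the length of the gradient. -/
noncomputable def dirSq {d n : ℕ} (w : Space d → CVec n) (x : Space d) : ℝ≥0∞ :=
  ∑ j, ‖fderiv ℝ w x (EuclideanSpace.single j 1)‖ₑ ^ 2

lemma measurable_dirSq {d n : ℕ} {w : Space d → CVec n} (hw : ContDiff ℝ ∞ w) :
    Measurable (dirSq w) := by
  unfold dirSq
  refine Finset.measurable_fun_sum _ fun j _ => ?_
  exact (((hw.continuous_fderiv (by simp)).clm_apply continuous_const).enorm.measurable).pow_const 2

lemma enorm_sq_fderiv_apply_le {d n : ℕ} (w : Space d → CVec n) (x h : Space d) :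
    ‖fderiv ℝ w x h‖ₑ ^ 2 ≤ ‖h‖ₑ ^ 2 * dirSq w x := by
  have h0 : h = ∑ j, h j • (EuclideanSpace.single j 1 : Space d) := by
    ext i
    simp [Pi.single_apply]
  have h1 : ‖fderiv ℝ w x h‖ ^ 2 ≤
      ‖h‖ ^ 2 * ∑ j, ‖fderiv ℝ w x (EuclideanSpace.single j 1)‖ ^ 2 := by
    have h2 : ‖fderiv ℝ w x h‖ ≤ ∑ j, ‖h j‖ * ‖fderiv ℝ w x (EuclideanSpace.single j 1)‖ := by
      conv_lhs => rw [h0, map_sum]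
      refine (norm_sum_le _ _).trans (Finset.sum_le_sum fun j _ => ?_)
      rw [map_smul, norm_smul]
    calc ‖fderiv ℝ w x h‖ ^ 2 ≤
          (∑ j, ‖h j‖ * ‖fderiv ℝ w x (EuclideanSpace.single j 1)‖) ^ 2 := by gcongr
      _ ≤ _ := Finset.sum_mul_sq_le_sq_mul_sq _ _ _
      _ = _ := by rw [EuclideanSpace.norm_sq_eq]
  unfold dirSq
  simp only [enorm_sq_eq_ofReal]
  rw [← ENNReal.ofReal_sum_of_nonneg fun _ _ => sq_nonneg _, ← ENNReal.ofReal_mul (sq_nonneg _)]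
  exact ENNReal.ofReal_le_ofReal h1

/-- Bump functions whose supports shrink to zero. -/
noncomputable def shrinkingBump (d k : ℕ) : ContDiffBump (0 : Space d) where
  rIn := 1 / (k + 1) / 2
  rOut := 1 / (k + 1)
  rIn_pos := by positivity
  rIn_lt_rOut := half_lt_self (by positivity)

lemma tendsto_shrinkingBump (d : ℕ) :
    Tendsto (fun k => (shrinkingBump d k).rOut) atTop (𝓝 0) :=
  tendsto_one_div_add_atTop_nhds_zero_nat

theorem exists_smooth_approx {d n : ℕ} {Ω : Set (Space d)} (hΩ : MeasurableSet Ω) {p : Jet Ω n}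
    (hp : p ∈ sobolev Ω n) :
    ∃ w : ℕ → Space d → CVec n, (∀ k, ContDiff ℝ ∞ (w k)) ∧
      (∀ᵐ x ∂volume.restrict Ω, Tendsto (fun k => w k x) atTop (𝓝 (p.fst x))) ∧
      ∀ (S A : Set (Space d)) (δ : ℝ), MeasurableSet S → A ⊆ Ω → 0 < δ →
        (∀ x ∈ S, Metric.ball x δ ⊆ A) → ∀ᶠ k in atTop,
          ∫⁻ x in S, ‖w k x‖ₑ ^ 2 ≤ ∫⁻ x in A, ‖p.fst x‖ₑ ^ 2 ∧
          ∫⁻ x in S, dirSq (w k) x ≤ ∫⁻ x in A, gradSq p x := by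
  have hle : ∀ (f : L2 Ω n) x, ‖Ω.indicator f x‖ₑ ^ 2 ≤ ‖f x‖ₑ ^ 2 := by
    intro f x
    gcongr
    exact enorm_indicator_le_enorm_self _ _
  refine ⟨fun k => mollify (shrinkingBump d k) (Ω.indicator p.fst), fun k =>
    contDiff_mollify _ (L2.locallyIntegrable_indicator hΩ _), ?_, ?_⟩
  · rw [ae_restrict_iff' hΩ]
    -- The ratio of outer to inner radius is always 2; this boundedness is what Lebesgue
    -- differentiation needs.
    have h := ContDiffBump.ae_convolution_tendsto_right_of_locallyIntegrable
      (φ := shrinkingBump d) (K := 2) (tendsto_shrinkingBump d)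
      (Eventually.of_forall fun k => by simp only [shrinkingBump]; linarith)
      (L2.locallyIntegrable_indicator hΩ p.fst)
    filter_upwards [h] with x hx hxΩ
    rw [indicator_of_mem hxΩ] at hx
    exact hx
  · intro S A δ hS hA hδ hSA
    filter_upwards [(tendsto_shrinkingBump d).eventually (gt_mem_nhds hδ)] with k hk
    have hball : ∀ x ∈ S, Metric.ball x (shrinkingBump d k).rOut ⊆ A := fun x hx =>
      (Metric.ball_subset_ball hk.le).trans (hSA x hx)
    refine ⟨?_, ?_⟩
    · refine (lintegral_mollify_le _ (L2.stronglyMeasurable_indicator hΩ _) hS hball).trans ?_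
      exact lintegral_mono fun x => hle _ x
    · have h1 : ∫⁻ x in S, dirSq (mollify (shrinkingBump d k) (Ω.indicator p.fst)) x =
          ∫⁻ x in S, ∑ j, ‖mollify (shrinkingBump d k) (Ω.indicator (p.snd j)) x‖ₑ ^ 2 := by
        refine setLIntegral_congr_fun hS fun x hx => ?_
        refine Finset.sum_congr rfl fun j _ => ?_
        rw [fderiv_mollify hΩ (hp j)]
        exact (Metric.closedBall_subset_ball hk).trans ((hSA x hx).trans hA)
      rw [h1, lintegral_finsetSum]
      · refine (Finset.sum_le_sum fun j _ => lintegral_mollify_le _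
          (L2.stronglyMeasurable_indicator hΩ _) hS hball).trans ?_
        rw [← lintegral_finsetSum]
        · exact lintegral_mono fun x => Finset.sum_le_sum fun j _ => hle _ x
        · exact fun j _ => ((L2.stronglyMeasurable_indicator hΩ _).enorm).pow_const 2
      · intro j _
        exact ((contDiff_mollify _ (L2.locallyIntegrable_indicator hΩ
          (p.snd j))).continuous.enorm.measurable).pow_const 2

/-! ### A Poincaré inequality on convex sets -/

lemma sq_lintegral_le {α : Type*} [MeasurableSpace α] {μ : Measure α} {f : α → ℝ≥0∞}
    (hf : AEMeasurable f μ) : (∫⁻ x, f x ∂μ) ^ 2 ≤ μ univ * ∫⁻ x, f x ^ 2 ∂μ := by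
  have h := eLpNorm_le_eLpNorm_mul_rpow_measure_univ (p := 1) (q := 2) (by norm_num)
    hf.aestronglyMeasurable
  rw [eLpNorm_one_eq_lintegral_enorm] at h
  calc (∫⁻ x, f x ∂μ) ^ 2 ≤ (eLpNorm f 2 μ * μ univ ^ (1 / (1 : ℝ≥0∞).toReal -
        1 / (2 : ℝ≥0∞).toReal)) ^ 2 := by
        gcongr
        simpa using h
    _ = μ univ * ∫⁻ x, f x ^ 2 ∂μ := by
        rw [mul_pow, eLpNorm_two_sq, mul_comm]
        congr 1
        rw [← ENNReal.rpow_natCast, ← ENNReal.rpow_mul]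
        norm_num

lemma enorm_sub_sq_le_lintegral {d n : ℕ} {w : Space d → CVec n} (hw : ContDiff ℝ ∞ w)
    (x h : Space d) {s t : ℝ} (hst : s ≤ t) :
    ‖w (x + t • h) - w (x + s • h)‖ₑ ^ 2 ≤
      ENNReal.ofReal (t - s) * ∫⁻ r in Ioc s t, ‖fderiv ℝ w (x + r • h) h‖ₑ ^ 2 := by
  have hc : Continuous fun r : ℝ => fderiv ℝ w (x + r • h) h :=
    ((hw.continuous_fderiv (by simp)).comp (by fun_prop)).clm_apply continuous_const
  have hder : ∀ r ∈ uIcc s t, HasDerivAt (fun r : ℝ => w (x + r • h))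
      (fderiv ℝ w (x + r • h) h) r := by
    intro r _
    have h1 : HasDerivAt (fun r : ℝ => x + r • h) h r := by
      simpa using ((hasDerivAt_id r).smul_const h).const_add x
    exact ((hw.differentiable (by simp)) _).hasFDerivAt.comp_hasDerivAt r h1
  rw [← intervalIntegral.integral_eq_sub_of_hasDerivAt hder (hc.intervalIntegrable _ _),
    intervalIntegral.integral_of_le hst]
  calc ‖∫ r in Ioc s t, fderiv ℝ w (x + r • h) h‖ₑ ^ 2
      ≤ (∫⁻ r in Ioc s t, ‖fderiv ℝ w (x + r • h) h‖ₑ) ^ 2 := by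
        gcongr
        exact enorm_integral_le_lintegral_enorm _
    _ ≤ _ := by
        refine (sq_lintegral_le hc.enorm.measurable.aemeasurable).trans (le_of_eq ?_)
        simp

/-- Write `w(x + h) - w(x)` as the integral of the derivative along the segment, which stays in `B`
by convexity. For fixed `h` and `t`, translation by `t h` preserves the integral over `x`, so the
integrations over `t` and over `‖h‖ ≤ D` contribute only the volume of a ball. -/
lemma lintegral_sub_sq_le_of_contDiff {d n : ℕ} {w : Space d → CVec n} (hw : ContDiff ℝ ∞ w)
    {B : Set (Space d)} (hB : MeasurableSet B) (hBc : Convex ℝ B) {D : ℝ}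
    (hD : ∀ x ∈ B, ∀ y ∈ B, ‖y - x‖ ≤ D) :
    ∫⁻ x in B, ∫⁻ y in B, ‖w y - w x‖ₑ ^ 2 ≤
      ENNReal.ofReal D ^ 2 * volume (Metric.closedBall (0 : Space d) D) *
        ∫⁻ x in B, dirSq w x := by
  set G : Space d → ℝ≥0∞ := B.indicator (dirSq w) with hG
  have hGm : Measurable G := (measurable_dirSq hw).indicator hB
  set V := Metric.closedBall (0 : Space d) D with hV
  have hVm : MeasurableSet V := Metric.isClosed_closedBall.measurableSet
  have h1 : ∀ x ∈ B, ∫⁻ y in B, ‖w y - w x‖ₑ ^ 2 ≤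
      ∫⁻ h in V, ∫⁻ t in Ioc (0 : ℝ) 1, ENNReal.ofReal D ^ 2 * G (x + t • h) := by
    intro x hx
    rw [← lintegral_indicator hB, ← lintegral_indicator hVm,
      ← lintegral_add_left_eq_self _ x]
    refine lintegral_mono fun h => ?_
    by_cases hxh : x + h ∈ B
    · have hh : ‖h‖ ≤ D := by simpa using hD x hx _ hxh
      have hhV : h ∈ V := by simpa [hV] using hh
      rw [indicator_of_mem hxh, indicator_of_mem hhV]
      have h2 := enorm_sub_sq_le_lintegral hw x h zero_le_one
      simp only [one_smul, zero_smul, add_zero, sub_zero, ENNReal.ofReal_one, one_mul] at h2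
      refine h2.trans (setLIntegral_mono' measurableSet_Ioc fun t ht => ?_)
      refine (enorm_sq_fderiv_apply_le _ _ _).trans ?_
      have hmem : x + t • h ∈ B := by
        have := hBc.add_smul_mem hx hxh ⟨ht.1.le, ht.2⟩
        exact this
      rw [hG, indicator_of_mem hmem]
      gcongr
      rw [← ofReal_norm]
      exact ENNReal.ofReal_le_ofReal hh
    · rw [indicator_of_notMem hxh]
      exact zero_le
  have hm3 : Measurable fun z : (Space d × Space d) × ℝ =>
      ENNReal.ofReal D ^ 2 * G (z.1.1 + z.2 • z.1.2) :=
    (hGm.comp (by fun_prop)).const_mul _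
  have hm2 : Measurable fun z : Space d × Space d =>
      ∫⁻ t in Ioc (0 : ℝ) 1, ENNReal.ofReal D ^ 2 * G (z.1 + t • z.2) :=
    hm3.lintegral_prod_right'
  calc ∫⁻ x in B, ∫⁻ y in B, ‖w y - w x‖ₑ ^ 2
      ≤ ∫⁻ x in B, ∫⁻ h in V, ∫⁻ t in Ioc (0 : ℝ) 1, ENNReal.ofReal D ^ 2 * G (x + t • h) :=
        setLIntegral_mono' hB h1
    _ ≤ ∫⁻ x, ∫⁻ h in V, ∫⁻ t in Ioc (0 : ℝ) 1, ENNReal.ofReal D ^ 2 * G (x + t • h) :=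
        setLIntegral_le_lintegral _ _
    _ = ∫⁻ h in V, ∫⁻ x, ∫⁻ t in Ioc (0 : ℝ) 1, ENNReal.ofReal D ^ 2 * G (x + t • h) :=
        lintegral_lintegral_swap hm2.aemeasurable
    _ = ∫⁻ h in V, ∫⁻ t in Ioc (0 : ℝ) 1, ∫⁻ x, ENNReal.ofReal D ^ 2 * G (x + t • h) := by
        refine lintegral_congr fun h => lintegral_lintegral_swap (Measurable.aemeasurable ?_)
        exact (hGm.comp (by fun_prop)).const_mul _
    _ = ∫⁻ h in V, ∫⁻ t in Ioc (0 : ℝ) 1, ENNReal.ofReal D ^ 2 * ∫⁻ x in B, dirSq w x := by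
        refine lintegral_congr fun h => lintegral_congr fun t => ?_
        have hm1 : Measurable fun x => G (x + t • h) := hGm.comp (by fun_prop)
        rw [lintegral_const_mul _ hm1,
          lintegral_add_right_eq_self G (t • h), hG, lintegral_indicator hB]
    _ = _ := by
        simp
        ring

/-- A displacement allowed at both endpoints is allowed at their convex combinations, by combining
the two displaced points. -/
lemma convex_setOf_ball_subset {d : ℕ} {A : Set (Space d)} (hA : Convex ℝ A) (a : ℝ) :
    Convex ℝ {x | Metric.ball x a ⊆ A} := by
  intro x hx y hy s t hs ht hst z hz
  have hz' : ‖z - (s • x + t • y)‖ < a := by simpa [dist_eq_norm] using hz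
  set v := z - (s • x + t • y) with hv
  have h1 : x + v ∈ A := hx (by simpa [dist_eq_norm] using hz')
  have h2 : y + v ∈ A := hy (by simpa [dist_eq_norm] using hz')
  have h3 : z = s • (x + v) + t • (y + v) := by
    have : s • (x + v) + t • (y + v) = (s • x + t • y) + (s + t) • v := by module
    rw [this, hst, hv]
    module
  rw [h3]
  exact hA h1 h2 hs ht hst

lemma isClosed_setOf_ball_subset {d : ℕ} (A : Set (Space d)) (a : ℝ) :
    IsClosed {x | Metric.ball x a ⊆ A} := by
  have : {x | Metric.ball x a ⊆ A} = (Metric.thickening a Aᶜ)ᶜ := by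
    ext x
    simp only [mem_ofPred_eq, mem_compl_iff, Metric.mem_thickening_iff, not_exists, not_and, not_lt]
    constructor
    · intro h z hz
      by_contra hlt
      exact hz (h (by rw [Metric.mem_ball, dist_comm]; exact not_le.1 hlt))
    · intro h z hz
      by_contra hzA
      rw [Metric.mem_ball, dist_comm] at hz
      exact absurd (h z hzA) (not_le.2 hz)
  rw [this]
  exact Metric.isOpen_thickening.isClosed_compl

lemma IsOpen.iUnion_setOf_ball_subset {d : ℕ} {A : Set (Space d)} (hA : IsOpen A) :
    ⋃ k : ℕ, {x | Metric.ball x (1 / ((k : ℝ) + 1)) ⊆ A} = A := by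
  ext x
  simp only [mem_iUnion, mem_ofPred_eq]
  constructor
  · rintro ⟨k, hk⟩
    exact hk (Metric.mem_ball_self (by positivity))
  · intro hx
    obtain ⟨ε, hε, hb⟩ := Metric.isOpen_iff.1 hA x hx
    obtain ⟨k, hk⟩ := exists_nat_one_div_lt hε
    exact ⟨k, (Metric.ball_subset_ball hk.le).trans hb⟩

/-- Mollified functions are controlled only at a positive distance from the complement of `A`. The
inequality is proved on the convex inner parallel sets `B k` with a constant independent of `k`, and
these exhaust the open set `A`. -/
theorem lintegral_sub_sq_le {d n : ℕ} {Ω : Set (Space d)} (hΩ : MeasurableSet Ω) {p : Jet Ω n}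
    (hp : p ∈ sobolev Ω n) {A : Set (Space d)} (hA : IsOpen A) (hAc : Convex ℝ A) (hAΩ : A ⊆ Ω)
    {D : ℝ} (hD : ∀ x ∈ A, ∀ y ∈ A, ‖y - x‖ ≤ D) :
    ∫⁻ x in A, ∫⁻ y in A, ‖p.fst y - p.fst x‖ₑ ^ 2 ≤
      ENNReal.ofReal D ^ 2 * volume (Metric.closedBall (0 : Space d) D) *
        ∫⁻ x in A, gradSq p x := by
  obtain ⟨w, hw, hlim, happ⟩ := exists_smooth_approx hΩ hp
  set c := ENNReal.ofReal D ^ 2 * volume (Metric.closedBall (0 : Space d) D) with hc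
  set B : ℕ → Set (Space d) := fun k => {x | Metric.ball x (1 / ((k : ℝ) + 1)) ⊆ A} with hBdef
  have hBA : ∀ k, B k ⊆ A := fun k x hx => hx (Metric.mem_ball_self (by positivity))
  have hBm : ∀ k, MeasurableSet (B k) := fun k => (isClosed_setOf_ball_subset A _).measurableSet
  have hu : Measurable fun z : Space d × Space d => ‖p.fst z.2 - p.fst z.1‖ₑ ^ 2 := by
    have h0 : StronglyMeasurable (p.fst : Space d → CVec n) := Lp.stronglyMeasurable _
    exact (((h0.comp_measurable measurable_snd).sub
      (h0.comp_measurable measurable_fst)).enorm).pow_const 2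
  have hwm : ∀ k, Measurable fun z : Space d × Space d => ‖w k z.2 - w k z.1‖ₑ ^ 2 := fun k =>
    ((((hw k).continuous.comp continuous_snd).sub
      ((hw k).continuous.comp continuous_fst)).enorm.measurable).pow_const 2
  have hprod : ∀ S : Set (Space d), ∫⁻ x in S, ∫⁻ y in S, ‖p.fst y - p.fst x‖ₑ ^ 2 =
      ∫⁻ z in S ×ˢ S, ‖p.fst z.2 - p.fst z.1‖ₑ ^ 2 ∂(volume.prod volume) := by
    intro S
    rw [← Measure.prod_restrict, lintegral_prod _ hu.aemeasurable]
  have key : ∀ k, ∫⁻ z in B k ×ˢ B k, ‖p.fst z.2 - p.fst z.1‖ₑ ^ 2 ∂(volume.prod volume) ≤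
      c * ∫⁻ x in A, gradSq p x := by
    intro k
    rw [← Measure.prod_restrict]
    have hlimB := ae_mono (Measure.restrict_mono ((hBA k).trans hAΩ) le_rfl) hlim
    have hae : ∀ᵐ z ∂(volume.restrict (B k)).prod (volume.restrict (B k)),
        ‖p.fst z.2 - p.fst z.1‖ₑ ^ 2 =
          liminf (fun i => ‖w i z.2 - w i z.1‖ₑ ^ 2) atTop := by
      filter_upwards [Measure.quasiMeasurePreserving_fst.ae hlimB,
        Measure.quasiMeasurePreserving_snd.ae hlimB] with z h1 h2
      refine (Tendsto.liminf_eq ?_).symm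
      exact ((ENNReal.continuous_pow 2).tendsto _).comp ((h2.sub h1).enorm)
    -- Fatou's lemma on the product; it suffices that the smooth integrals are eventually bounded.
    rw [lintegral_congr_ae hae]
    refine (lintegral_liminf_le hwm).trans ?_
    refine liminf_le_of_frequently_le' (Eventually.frequently ?_)
    filter_upwards [happ (B k) A _ (hBm k) hAΩ (by positivity) (fun x hx => hx)] with i hi
    rw [lintegral_prod _ (hwm i).aemeasurable]
    refine (lintegral_sub_sq_le_of_contDiff (hw i) (hBm k) (convex_setOf_ball_subset hAc _)
      fun x hx y hy => hD x (hBA k hx) y (hBA k hy)).trans ?_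
    exact mul_le_mul_right hi.2 c
  have hunion : A ×ˢ A = ⋃ k, B k ×ˢ B k := by
    have hmono : Monotone B := by
      intro k l hkl x hx
      refine (Metric.ball_subset_ball ?_).trans hx
      gcongr
    rw [iUnion_prod_of_monotone hmono hmono, hBdef, IsOpen.iUnion_setOf_ball_subset hA]
  rw [hprod A, hunion, setLIntegral_iUnion_of_directed]
  · exact iSup_le key
  · refine Monotone.directed_le fun k l hkl => ?_
    have : B k ⊆ B l := fun x hx => (Metric.ball_subset_ball (by gcongr)).trans hx
    exact prod_mono this this

lemma enorm_sq_le_two_mul {E : Type*} [SeminormedAddCommGroup E] (a b : E) :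
    ‖a‖ₑ ^ 2 ≤ 2 * ‖b‖ₑ ^ 2 + 2 * ‖b - a‖ₑ ^ 2 := by
  simp only [enorm_sq_eq_ofReal]
  rw [← ENNReal.ofReal_ofNat, ← ENNReal.ofReal_mul (by norm_num),
    ← ENNReal.ofReal_mul (by norm_num), ← ENNReal.ofReal_add (by positivity) (by positivity)]
  refine ENNReal.ofReal_le_ofReal ?_
  have h1 : ‖a‖ ≤ ‖b‖ + ‖b - a‖ := by
    have := norm_sub_le b (b - a)
    rwa [sub_sub_cancel] at this
  nlinarith [sq_nonneg (‖b‖ - ‖b - a‖), norm_nonneg a, norm_nonneg b, norm_nonneg (b - a)]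

theorem lintegral_weight_mul_le {d n : ℕ} {Ω : Set (Space d)} (hΩ : MeasurableSet Ω) {p : Jet Ω n}
    (hp : p ∈ sobolev Ω n) {A : Set (Space d)} (hA : IsOpen A) (hAc : Convex ℝ A) (hAΩ : A ⊆ Ω)
    {D : ℝ} (hD : ∀ x ∈ A, ∀ y ∈ A, ‖y - x‖ ≤ D) {r : Space d → ℝ≥0∞} {κ : ℝ≥0∞} (hκ : κ ≠ ⊤)
    (hr : ∀ᵐ x ∂volume.restrict A, r x ≤ κ) :
    volume A * ∫⁻ x in A, r x * ‖p.fst x‖ₑ ^ 2 ≤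
      2 * (∫⁻ x in A, r x) * (∫⁻ x in A, ‖p.fst x‖ₑ ^ 2) +
        2 * κ * (ENNReal.ofReal D ^ 2 * volume (Metric.closedBall (0 : Space d) D)) *
          ∫⁻ x in A, gradSq p x := by
  have hu : StronglyMeasurable (p.fst : Space d → CVec n) := Lp.stronglyMeasurable _
  have hu2 : Measurable fun z : Space d × Space d => ‖p.fst z.2 - p.fst z.1‖ₑ ^ 2 :=
    (((hu.comp_measurable measurable_snd).sub
      (hu.comp_measurable measurable_fst)).enorm).pow_const 2
  -- Finiteness allows this constant to be pulled out of an integral over `x` although `r` is not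
  -- assumed measurable.
  have hfin : ∫⁻ x in A, ‖p.fst x‖ₑ ^ 2 ≠ ⊤ := by
    refine ne_top_of_le_ne_top ?_ (lintegral_mono_set hAΩ)
    rw [← L2.enorm_sq]
    simp
  calc volume A * ∫⁻ x in A, r x * ‖p.fst x‖ₑ ^ 2
      ≤ ∫⁻ x in A, volume A * (r x * ‖p.fst x‖ₑ ^ 2) := lintegral_const_mul_le _ _
    _ = ∫⁻ x in A, ∫⁻ _ in A, r x * ‖p.fst x‖ₑ ^ 2 := by simp [mul_comm]
    _ ≤ ∫⁻ x in A, ∫⁻ y in A, (2 * r x * ‖p.fst y‖ₑ ^ 2 +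
          2 * κ * ‖p.fst y - p.fst x‖ₑ ^ 2) := by
        refine lintegral_mono_ae ?_
        filter_upwards [hr] with x hx
        refine lintegral_mono fun y => ?_
        calc r x * ‖p.fst x‖ₑ ^ 2
            ≤ r x * (2 * ‖p.fst y‖ₑ ^ 2 + 2 * ‖p.fst y - p.fst x‖ₑ ^ 2) := by
              gcongr
              exact enorm_sq_le_two_mul _ _
          _ = 2 * r x * ‖p.fst y‖ₑ ^ 2 + 2 * r x * ‖p.fst y - p.fst x‖ₑ ^ 2 := by ring
          _ ≤ _ := by gcongr
    _ = ∫⁻ x in A, (r x * (2 * ∫⁻ y in A, ‖p.fst y‖ₑ ^ 2) +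
          2 * κ * ∫⁻ y in A, ‖p.fst y - p.fst x‖ₑ ^ 2) := by
        refine lintegral_congr fun x => ?_
        rw [lintegral_add_left ((hu.enorm.pow_const 2).const_mul _),
          lintegral_const_mul _ (hu.enorm.pow_const 2), lintegral_const_mul' _ _
            (ENNReal.mul_ne_top (by simp) hκ)]
        ring
    _ = _ := by
        rw [lintegral_add_right _ (hu2.lintegral_prod_right'.const_mul _),
          lintegral_mul_const' _ _ (ENNReal.mul_ne_top (by simp) hfin),
          lintegral_const_mul' _ _ (ENNReal.mul_ne_top (by simp) hκ)]
    _ ≤ _ := by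
        rw [mul_assoc (2 * κ)]
        exact add_le_add (by ring_nf; rfl) (by
          gcongr
          exact lintegral_sub_sq_le hΩ hp hA hAc hAΩ hD)

/-! ### Geometry of the boundary layer -/

lemma IsInwardUnitNormal.norm_eq_one {d : ℕ} {Ω : Set (Space d)} {y v : Space d}
    (h : IsInwardUnitNormal Ω y v) : ‖v‖ = 1 := by
  obtain ⟨f, -, hg, -, rfl⟩ := h
  rw [norm_smul, norm_inv, norm_norm, inv_mul_cancel₀ (norm_ne_zero_iff.2 hg)]

lemma inner_gradient_nonneg {d : ℕ} {f : Space d → ℝ} {y v : Space d}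
    (hf : DifferentiableAt ℝ f y) (hpos : ∀ᶠ s : ℝ in 𝓝[>] 0, f y ≤ f (y + s • v)) :
    0 ≤ inner ℝ (gradient f y) v := by
  have h1 : HasDerivAt (fun s : ℝ => f (y + s • v)) (inner ℝ (gradient f y) v) 0 := by
    have h2 : HasDerivAt (fun s : ℝ => y + s • v) v 0 := by
      simpa using ((hasDerivAt_id (0 : ℝ)).smul_const v).const_add y
    have h3 : HasFDerivAt f (fderiv ℝ f y) (y + (0 : ℝ) • v) := by simpa using hf.hasFDerivAt
    have h4 := h3.comp_hasDerivAt (0 : ℝ) h2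
    have h5 : inner ℝ (gradient f y) v = fderiv ℝ f y v := by
      rw [gradient, InnerProductSpace.toDual_symm_apply]
    rw [h5]
    exact h4
  have h6 := h1.hasDerivWithinAt (s := Ioi 0)
  rw [hasDerivWithinAt_iff_tendsto_slope' (by simp)] at h6
  refine ge_of_tendsto h6 ?_
  filter_upwards [hpos, self_mem_nhdsWithin] with s hs hs0
  rw [slope_def_field]
  refine div_nonneg ?_ ?_
  · simpa using hs
  · simpa using (le_of_lt (mem_Ioi.1 hs0))

/-- A functional that is nonnegative on an open half-space is a nonnegative multiple of the inward
normal of that half-space. -/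
lemma eq_smul_of_forall_inner_nonneg {E : Type*} [NormedAddCommGroup E] [InnerProductSpace ℝ E]
    {g e : E} (he : ‖e‖ = 1) (h : ∀ v, 0 < inner ℝ e v → 0 ≤ inner ℝ g v) :
    g = ‖g‖ • e := by
  set c : ℝ := inner ℝ g e with hc
  have hee : inner ℝ e e = (1 : ℝ) := by rw [real_inner_self_eq_norm_sq, he]; norm_num
  have hc0 : 0 ≤ c := h e (by rw [hee]; norm_num)
  set q := g - c • e with hq
  have heq : inner ℝ e q = (0 : ℝ) := by
    rw [hq, inner_sub_right, inner_smul_right, hee, hc, real_inner_comm]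
    ring
  have hgq : inner ℝ g q = ‖q‖ ^ 2 := by
    have : g = q + c • e := by rw [hq]; abel
    conv_lhs => rw [this]
    rw [inner_add_left, inner_smul_left, heq, real_inner_self_eq_norm_sq]
    simp
  have hq0 : q = 0 := by
    by_contra hne
    have hpos : 0 < ‖q‖ ^ 2 := by positivity
    -- The coefficient is chosen so that the inner product with `g` equals `c - (c + 1) = -1`.
    have h1 := h (e - ((c + 1) / ‖q‖ ^ 2) • q) (by
      rw [inner_sub_right, inner_smul_right, heq, hee]; norm_num)
    rw [inner_sub_right, inner_smul_right, hgq, div_mul_cancel₀ _ hpos.ne'] at h1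
    linarith
  have hgc : g = c • e := sub_eq_zero.1 hq0
  have hn : ‖g‖ = c := by
    conv_lhs => rw [hgc]
    rw [norm_smul, he, Real.norm_of_nonneg hc0, mul_one]
  rw [hn]
  exact hgc

/-- The ball about `x` touches the boundary at `y` from inside. Any direction making an acute angle
with `x - y` enters this ball, where `f > 0`, while `f y ≤ 0`. So the gradient pairs nonnegatively
with all such directions and is parallel to `x - y`. -/
lemma IsInwardUnitNormal.eq_add_smul {d : ℕ} {Ω : Set (Space d)} (hΩ : IsOpen Ω) {x y v : Space d}
    (hy : y ∈ frontier Ω) (h : IsInwardUnitNormal Ω y v) (hxy : 0 < dist x y)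
    (hball : Metric.ball x (dist x y) ⊆ Ω) : x = y + dist x y • v := by
  obtain ⟨f, hf, hg, hev, rfl⟩ := h
  set δ := dist x y with hδ
  have hyΩ : y ∉ Ω := by
    rw [hΩ.frontier_eq] at hy
    exact hy.2
  have hfy : f y ≤ 0 := not_lt.1 fun h0 => hyΩ (hev.self_of_nhds.2 h0)
  set e := δ⁻¹ • (x - y) with he
  have hxye : x - y = δ • e := by rw [he, smul_inv_smul₀ hxy.ne']
  have hen : ‖e‖ = 1 := by
    rw [he, norm_smul, norm_inv, ← dist_eq_norm, ← hδ, Real.norm_of_nonneg hxy.le,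
      inv_mul_cancel₀ hxy.ne']
  have hge : gradient f y = ‖gradient f y‖ • e := by
    refine eq_smul_of_forall_inner_nonneg hen fun v hv => ?_
    refine inner_gradient_nonneg (hf.differentiableAt (by norm_num)) ?_
    have hcont : Tendsto (fun s : ℝ => y + s • v) (𝓝[>] 0) (𝓝 y) := by
      have : Continuous fun s : ℝ => y + s • v := by fun_prop
      have h0 := this.tendsto 0
      simp only [zero_smul, add_zero] at h0
      exact h0.mono_left nhdsWithin_le_nhds
    -- This is exactly the condition `‖s v - δ e‖ < δ`, squared and divided by `s`.
    have hsmall : ∀ᶠ s : ℝ in 𝓝[>] 0, s * ‖v‖ ^ 2 < 2 * δ * inner ℝ e v := by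
      have hc : Tendsto (fun s : ℝ => s * ‖v‖ ^ 2) (𝓝[>] 0) (𝓝 0) := by
        have : Continuous fun s : ℝ => s * ‖v‖ ^ 2 := by fun_prop
        have h0 := this.tendsto 0
        simp only [zero_mul] at h0
        exact h0.mono_left nhdsWithin_le_nhds
      exact hc.eventually (gt_mem_nhds (by positivity))
    filter_upwards [hcont.eventually hev, hsmall, self_mem_nhdsWithin] with s h1 h2 h3
    have hs : 0 < s := h3
    refine hfy.trans (h1.1 (hball ?_)).le
    rw [Metric.mem_ball, dist_eq_norm]
    refine lt_of_pow_lt_pow_left₀ 2 hxy.le ?_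
    have h4 : y + s • v - x = s • v - δ • e := by rw [← hxye]; abel
    rw [h4, norm_sub_sq_real, norm_smul, norm_smul, inner_smul_left, inner_smul_right, hen,
      real_inner_comm, Real.norm_of_nonneg hs.le, Real.norm_of_nonneg hxy.le]
    simp only [conj_trivial]
    nlinarith
  have hv : ‖gradient f y‖⁻¹ • gradient f y = e := by
    conv_lhs => rw [hge]
    rw [norm_smul, hen, mul_one, norm_norm, inv_smul_smul₀ (norm_ne_zero_iff.2 hg)]
  rw [hv, ← hxye]
  abel

/-- Off the frontier, `Ω` and the complement of its closure separate. This serves both for the ball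
reaching to the nearest boundary point and for segments leaving `Ω`. -/
lemma IsPreconnected.subset_of_disjoint_frontier {X : Type*} [TopologicalSpace X] {s Ω : Set X}
    (hs : IsPreconnected s) (hΩ : IsOpen Ω) (hne : (s ∩ Ω).Nonempty)
    (hd : Disjoint s (frontier Ω)) : s ⊆ Ω := by
  refine hs.subset_left_of_subset_union hΩ isClosed_closure.isOpen_compl
    (disjoint_compl_right_iff_subset.2 subset_closure) (fun x hx => ?_) hne
  by_contra hn
  simp only [mem_union, mem_compl_iff, not_or, not_not] at hn
  exact disjoint_left.1 hd hx (by rw [hΩ.frontier_eq]; exact ⟨hn.2, hn.1⟩)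

lemma ball_infDist_frontier_subset {d : ℕ} {Ω : Set (Space d)} (hΩ : IsOpen Ω) {x : Space d}
    (hx : x ∈ Ω) : Metric.ball x (Metric.infDist x (frontier Ω)) ⊆ Ω := by
  rcases (Metric.infDist_nonneg (x := x) (s := frontier Ω)).eq_or_lt with h0 | h0
  · simp [← h0]
  · refine IsPreconnected.subset_of_disjoint_frontier (convex_ball _ _).isPreconnected hΩ
      ⟨x, Metric.mem_ball_self h0, hx⟩ (disjoint_left.2 fun z hz hzf => ?_)
    rw [Metric.mem_ball, dist_comm] at hz
    exact absurd (Metric.infDist_le_dist_of_mem hzf) (not_le.2 hz)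

/-- The map `(y, τ) ↦ y + τ ν(y)`. -/
noncomputable def normalMap {d : ℕ} (ν : Space d → Space d) (p : Space d × ℝ) : Space d :=
  p.1 + p.2 • ν p.1

/-- The part of `Ω` where the distance to the boundary belongs to `I`. -/
def shell {d : ℕ} (Ω : Set (Space d)) (I : Set ℝ) : Set (Space d) :=
  Ω ∩ (fun x => Metric.infDist x (frontier Ω)) ⁻¹' I

lemma infDist_frontier_pos {d : ℕ} {Ω : Set (Space d)} (hΩ : IsOpen Ω) {x : Space d} (hx : x ∈ Ω)
    (hne : (frontier Ω).Nonempty) : 0 < Metric.infDist x (frontier Ω) := by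
  rw [← isClosed_frontier.notMem_iff_infDist_pos hne, hΩ.frontier_eq]
  exact fun h => h.2 hx

lemma mem_boundaryLayer_iff {d : ℕ} {Ω : Set (Space d)} (hne : (frontier Ω).Nonempty) {t : ℝ}
    (ht : 0 ≤ t) {x : Space d} :
    x ∈ boundaryLayer Ω t ↔ x ∈ Ω ∧ Metric.infDist x (frontier Ω) ≤ t := by
  rw [boundaryLayer, mem_inter_iff, Metric.mem_cthickening_iff, Metric.infDist,
    ENNReal.le_ofReal_iff_toReal_le (Metric.infEDist_ne_top hne) ht]

lemma exists_eq_normalMap {d : ℕ} {Ω : Set (Space d)} (hΩ : IsOpen Ω) {ν : Space d → Space d}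
    (hν : ∀ y ∈ frontier Ω, IsInwardUnitNormal Ω y (ν y)) (hne : (frontier Ω).Nonempty)
    {x : Space d} (hx : x ∈ Ω) :
    ∃ y ∈ frontier Ω, x = normalMap ν (y, Metric.infDist x (frontier Ω)) := by
  obtain ⟨y, hy, hxy⟩ := isClosed_frontier.exists_infDist_eq_dist hne x
  refine ⟨y, hy, ?_⟩
  have h0 := infDist_frontier_pos hΩ hx hne
  have hb := ball_infDist_frontier_subset hΩ hx
  rw [hxy] at h0 hb ⊢
  exact (hν y hy).eq_add_smul hΩ hy h0 hb

/-- Identifies the normal coordinate `τ` with the distance to the boundary. The nearest boundary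
point gives one representation of `x` with parameter equal to the distance, and injectivity of the
normal coordinates makes it the only one. -/
lemma shell_eq_image {d : ℕ} {Ω : Set (Space d)} (hΩ : IsOpen Ω) {ν : Space d → Space d}
    (hν : ∀ y ∈ frontier Ω, IsInwardUnitNormal Ω y (ν y)) (hne : (frontier Ω).Nonempty) {τ₀ : ℝ}
    (hbij : BijOn (normalMap ν) (frontier Ω ×ˢ Ioc 0 τ₀) (boundaryLayer Ω τ₀)) {I : Set ℝ}
    (hI : I ⊆ Ioc 0 τ₀) : shell Ω I = normalMap ν '' (frontier Ω ×ˢ I) := by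
  ext x
  constructor
  · rintro ⟨hx, hxI⟩
    obtain ⟨y, hy, hxy⟩ := exists_eq_normalMap hΩ hν hne hx
    exact ⟨(y, _), ⟨hy, hxI⟩, hxy.symm⟩
  · rintro ⟨⟨y, τ⟩, ⟨hy, hτ⟩, rfl⟩
    have hmem : normalMap ν (y, τ) ∈ boundaryLayer Ω τ₀ := hbij.mapsTo ⟨hy, hI hτ⟩
    have hτ₀ : 0 ≤ τ₀ := (hI hτ).1.le.trans (hI hτ).2
    rw [mem_boundaryLayer_iff hne hτ₀] at hmem
    obtain ⟨y', hy', hxy⟩ := exists_eq_normalMap hΩ hν hne hmem.1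
    have h1 := hbij.injOn (x₁ := (y, τ)) (x₂ := (y', _)) ⟨hy, hI hτ⟩
      ⟨hy', infDist_frontier_pos hΩ hmem.1 hne, hmem.2⟩ hxy
    refine ⟨hmem.1, ?_⟩
    have h2 : τ = Metric.infDist (normalMap ν (y, τ)) (frontier Ω) := congrArg Prod.snd h1
    rw [mem_preimage, ← h2]
    exact hτ

lemma measurableSet_shell {d : ℕ} {Ω : Set (Space d)} (hΩ : IsOpen Ω) {I : Set ℝ}
    (hI : MeasurableSet I) : MeasurableSet (shell Ω I) :=
  hΩ.measurableSet.inter ((Metric.continuous_infDist_pt _).measurable hI)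

/-! ### Integration in boundary coordinates -/

/-- The point `(τ, s)`. -/
noncomputable def consPoint {m : ℕ} (q : ℝ × Space m) : Space (m + 1) :=
  WithLp.toLp 2 (Fin.cons q.1 (WithLp.ofLp q.2))

@[simp] lemma consPoint_zero {m : ℕ} (q : ℝ × Space m) : consPoint q 0 = q.1 := rfl

@[simp] lemma lateral_consPoint {m : ℕ} (q : ℝ × Space m) : lateral (consPoint q) = q.2 := rfl

/-- The measurable equivalence `(τ, s) ↦ x`. -/
noncomputable def consEquiv (m : ℕ) : ℝ × Space m ≃ᵐ Space (m + 1) :=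
  ((MeasurableEquiv.refl ℝ).prodCongr (MeasurableEquiv.toLp 2 (Fin m → ℝ)).symm).trans
    ((MeasurableEquiv.piFinSuccAbove (fun _ => ℝ) 0).symm.trans
      (MeasurableEquiv.toLp 2 (Fin (m + 1) → ℝ)))

lemma consEquiv_apply {m : ℕ} (q : ℝ × Space m) : consEquiv m q = consPoint q := by
  ext i
  refine Fin.cases ?_ (fun j => ?_) i <;> rfl

lemma measurePreserving_consPoint (m : ℕ) :
    MeasurePreserving (consPoint : ℝ × Space m → Space (m + 1)) := by
  have h1 : MeasurePreserving (Prod.map id WithLp.ofLp : ℝ × Space m → ℝ × (Fin m → ℝ)) :=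
    (MeasurePreserving.id volume).prod (PiLp.volume_preserving_ofLp (Fin m))
  have h2 : MeasurePreserving (MeasurableEquiv.piFinSuccAbove (fun _ : Fin (m + 1) => ℝ) 0).symm :=
    (volume_preserving_piFinSuccAbove (fun _ : Fin (m + 1) => ℝ) 0).symm _
  have h3 := (PiLp.volume_preserving_toLp (Fin (m + 1))).comp (h2.comp h1)
  convert h3 using 1
  ext1 q
  rw [← consEquiv_apply]
  rfl

lemma measurableEmbedding_consPoint (m : ℕ) :
    MeasurableEmbedding (consPoint : ℝ × Space m → Space (m + 1)) := by
  have h := (consEquiv m).measurableEmbedding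
  convert h using 1
  ext1 q
  exact (consEquiv_apply q).symm

/-- The set of the points `(τ, s)` with `τ ∈ I` and `s ∈ V`. -/
def coordBox {m : ℕ} (I : Set ℝ) (V : Set (Space m)) : Set (Space (m + 1)) :=
  {z | z 0 ∈ I ∧ lateral z ∈ V}

lemma continuous_lateral {m : ℕ} : Continuous (lateral : Space (m + 1) → Space m) := by
  unfold lateral
  fun_prop

lemma measurableSet_coordBox {m : ℕ} {I : Set ℝ} {V : Set (Space m)} (hI : MeasurableSet I)
    (hV : MeasurableSet V) : MeasurableSet (coordBox I V) := by
  have h0 : Measurable fun z : Space (m + 1) => z 0 := by fun_prop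
  exact (h0 hI).inter (continuous_lateral.measurable hV)

lemma lintegral_coordBox {m : ℕ} (I : Set ℝ) (V : Set (Space m)) {F : Space (m + 1) → ℝ≥0∞}
    (hF : AEMeasurable F (volume.restrict (coordBox I V))) :
    ∫⁻ z in coordBox I V, F z = ∫⁻ s in V, ∫⁻ τ in I, F (consPoint (τ, s)) := by
  have hpre : consPoint ⁻¹' (coordBox I V) = I ×ˢ V := by
    ext q
    simp [coordBox]
  have hmp := measurePreserving_consPoint m
  have hem := measurableEmbedding_consPoint m
  rw [← hmp.setLIntegral_comp_preimage_emb hem, hpre, Measure.volume_eq_prod,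
    ← Measure.prod_restrict, lintegral_prod_symm]
  rw [Measure.prod_restrict, ← Measure.volume_eq_prod, ← hpre]
  exact hF.comp_quasiMeasurePreserving
    ((hmp.restrict_preimage_emb hem _).quasiMeasurePreserving)

/-! ### The trace estimate in the boundary layer -/

/-- The value at `τ` is compared with the value at `r` by the fundamental theorem of calculus, then
averaged over `r`. The start `a` keeps the ray away from the boundary, and `a ≤ τ₀ / 2` leaves a ray
of length at least `τ₀ / 2`, so the constant is independent of `a`. -/
lemma enorm_sq_le_lintegral_ray {d n : ℕ} {w : Space d → CVec n} (hw : ContDiff ℝ ∞ w)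
    (y : Space d) {v : Space d} (hv : ‖v‖ = 1) {a τ₀ : ℝ} (hτ₀ : 0 < τ₀) (ha0 : 0 ≤ a)
    (ha : a ≤ τ₀ / 2) {τ : ℝ} (hτ : τ ∈ Ioc a τ₀) :
    ‖w (y + τ • v)‖ₑ ^ 2 ≤ ENNReal.ofReal (4 / τ₀ + 4 * τ₀) *
      ∫⁻ r in Ioc a τ₀, (‖w (y + r • v)‖ₑ ^ 2 + dirSq w (y + r • v)) := by
  set I := ∫⁻ r in Ioc a τ₀, ‖w (y + r • v)‖ₑ ^ 2 with hI
  set J := ∫⁻ r in Ioc a τ₀, dirSq w (y + r • v) with hJ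
  have hline : Continuous fun r : ℝ => y + r • v := by fun_prop
  have hm : Measurable fun r : ℝ => ‖w (y + r • v)‖ₑ ^ 2 :=
    ((hw.continuous.comp hline).enorm.measurable).pow_const 2
  have hsplit : ∫⁻ r in Ioc a τ₀, (‖w (y + r • v)‖ₑ ^ 2 + dirSq w (y + r • v)) = I + J :=
    lintegral_add_left hm _
  have hdiff : ∀ s t : ℝ, s ∈ Ioc a τ₀ → t ∈ Ioc a τ₀ → s ≤ t →
      ‖w (y + t • v) - w (y + s • v)‖ₑ ^ 2 ≤ ENNReal.ofReal τ₀ * J := by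
    intro s t hs ht hst
    refine (enorm_sub_sq_le_lintegral hw y v hst).trans ?_
    gcongr
    · linarith [hs.1, ht.2]
    · calc ∫⁻ r in Ioc s t, ‖fderiv ℝ w (y + r • v) v‖ₑ ^ 2
          ≤ ∫⁻ r in Ioc s t, dirSq w (y + r • v) := by
            refine lintegral_mono fun r => (enorm_sq_fderiv_apply_le w _ v).trans ?_
            rw [← ofReal_norm, hv]
            simp
        _ ≤ J := lintegral_mono_set (Ioc_subset_Ioc hs.1.le ht.2)
  have h1 : ∀ r ∈ Ioc a τ₀, ‖w (y + τ • v)‖ₑ ^ 2 ≤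
      2 * ‖w (y + r • v)‖ₑ ^ 2 + 2 * (ENNReal.ofReal τ₀ * J) := by
    intro r hr
    refine (enorm_sq_le_two_mul _ (w (y + r • v))).trans ?_
    gcongr
    rcases le_total τ r with h | h
    · exact hdiff τ r hτ hr h
    · rw [enorm_sub_rev]
      exact hdiff r τ hr hτ h
  have h2 : ENNReal.ofReal (τ₀ - a) * ‖w (y + τ • v)‖ₑ ^ 2 ≤
      2 * I + ENNReal.ofReal (τ₀ - a) * (2 * (ENNReal.ofReal τ₀ * J)) := by
    have h3 := setLIntegral_mono' (μ := volume) measurableSet_Ioc h1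
    rw [lintegral_add_left (hm.const_mul 2), lintegral_const_mul _ hm, setLIntegral_const,
      setLIntegral_const, Real.volume_Ioc, mul_comm, mul_comm _ (ENNReal.ofReal (τ₀ - a))] at h3
    exact h3
  have h4 : ENNReal.ofReal (τ₀ / 2) * ‖w (y + τ • v)‖ₑ ^ 2 ≤
      ENNReal.ofReal (2 + 2 * τ₀ ^ 2) * (I + J) := by
    calc ENNReal.ofReal (τ₀ / 2) * ‖w (y + τ • v)‖ₑ ^ 2
        ≤ ENNReal.ofReal (τ₀ - a) * ‖w (y + τ • v)‖ₑ ^ 2 := by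
          gcongr
          linarith
      _ ≤ _ := h2
      _ ≤ 2 * I + ENNReal.ofReal τ₀ * (2 * (ENNReal.ofReal τ₀ * J)) := by
          gcongr
          linarith
      _ = 2 * I + ENNReal.ofReal (2 * τ₀ ^ 2) * J := by
          rw [ENNReal.ofReal_mul (by norm_num), ENNReal.ofReal_pow hτ₀.le, ENNReal.ofReal_ofNat]
          ring
      _ ≤ ENNReal.ofReal (2 + 2 * τ₀ ^ 2) * I + ENNReal.ofReal (2 + 2 * τ₀ ^ 2) * J := by
          gcongr
          · rw [← ENNReal.ofReal_ofNat]
            exact ENNReal.ofReal_le_ofReal (by nlinarith)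
          · linarith
      _ = _ := (mul_add _ _ _).symm
  rw [hsplit]
  calc ‖w (y + τ • v)‖ₑ ^ 2
      = ENNReal.ofReal (2 / τ₀) * (ENNReal.ofReal (τ₀ / 2) * ‖w (y + τ • v)‖ₑ ^ 2) := by
        rw [← mul_assoc, ← ENNReal.ofReal_mul (by positivity)]
        have : 2 / τ₀ * (τ₀ / 2) = 1 := by field_simp
        rw [this, ENNReal.ofReal_one, one_mul]
    _ ≤ ENNReal.ofReal (2 / τ₀) * (ENNReal.ofReal (2 + 2 * τ₀ ^ 2) * (I + J)) := by gcongr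
    _ = _ := by
        rw [← mul_assoc, ← ENNReal.ofReal_mul (by positivity)]
        congr 2
        field_simp
        ring

lemma lintegral_ray_le {d n : ℕ} {w : Space d → CVec n} (hw : ContDiff ℝ ∞ w)
    (y : Space d) {v : Space d} (hv : ‖v‖ = 1) {a t τ₀ : ℝ} (hτ₀ : 0 < τ₀) (ha0 : 0 ≤ a)
    (ha : a ≤ τ₀ / 2) (ht : t ≤ τ₀) :
    ∫⁻ τ in Ioc a t, ‖w (y + τ • v)‖ₑ ^ 2 ≤
      ENNReal.ofReal t * ENNReal.ofReal (4 / τ₀ + 4 * τ₀) *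
        ∫⁻ r in Ioc a τ₀, (‖w (y + r • v)‖ₑ ^ 2 + dirSq w (y + r • v)) := by
  refine (setLIntegral_mono' measurableSet_Ioc fun τ hτ =>
    enorm_sq_le_lintegral_ray hw y hv hτ₀ ha0 ha (Ioc_subset_Ioc_right ht hτ)).trans ?_
  rw [setLIntegral_const, Real.volume_Ioc, mul_comm, mul_assoc]
  gcongr
  linarith

/-- The ray estimate is integrated over `s`. The change of variables is used in both directions, and
each costs a factor `M`. -/
lemma lintegral_chart_le {m n : ℕ} {w : Space (m + 1) → CVec n} (hw : ContDiff ℝ ∞ w)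
    {ν : Space (m + 1) → Space (m + 1)} {σ : Space m → Space (m + 1)} {V : Set (Space m)}
    (hV : MeasurableSet V) {τ₀ M : ℝ} (hτ₀ : 0 < τ₀) (hM : 0 < M)
    (hν : ∀ s ∈ V, ‖ν (σ s)‖ = 1) (hinj : InjOn (tubularMap ν σ) (coordBox (Ioc 0 τ₀) V))
    (hT : ∀ z ∈ coordBox (Ioc 0 τ₀) V, DifferentiableAt ℝ (tubularMap ν σ) z ∧
        M⁻¹ ≤ |(fderiv ℝ (tubularMap ν σ) z).det| ∧ |(fderiv ℝ (tubularMap ν σ) z).det| ≤ M)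
    {a t : ℝ} (ha0 : 0 ≤ a) (ha : a ≤ τ₀ / 2) (ht : t ≤ τ₀) :
    ∫⁻ x in tubularMap ν σ '' coordBox (Ioc a t) V, ‖w x‖ₑ ^ 2 ≤
      ENNReal.ofReal t * ENNReal.ofReal (M ^ 2 * (4 / τ₀ + 4 * τ₀)) *
        ∫⁻ x in tubularMap ν σ '' coordBox (Ioc a τ₀) V, (‖w x‖ₑ ^ 2 + dirSq w x) := by
  set T := tubularMap ν σ with hTdef
  have hsub : ∀ {b c : ℝ}, 0 ≤ b → c ≤ τ₀ → coordBox (Ioc b c) V ⊆ coordBox (Ioc 0 τ₀) V :=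
    fun hb hc z hz => ⟨Ioc_subset_Ioc hb hc hz.1, hz.2⟩
  have hmeas : ∀ b c : ℝ, MeasurableSet (coordBox (Ioc b c) V) := fun b c =>
    measurableSet_coordBox measurableSet_Ioc hV
  have hder : ∀ {b c : ℝ}, 0 ≤ b → c ≤ τ₀ → ∀ z ∈ coordBox (Ioc b c) V,
      HasFDerivWithinAt T (fderiv ℝ T z) (coordBox (Ioc b c) V) z := fun hb hc z hz =>
    (hT z (hsub hb hc hz)).1.hasFDerivAt.hasFDerivWithinAt
  have hTm : ∀ {b c : ℝ}, 0 ≤ b → c ≤ τ₀ → AEMeasurable T (volume.restrict (coordBox (Ioc b c) V)) :=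
    fun hb hc => ContinuousOn.aemeasurable
      (fun z hz => (hder hb hc z hz).continuousWithinAt) (hmeas _ _)
  have hwm : Measurable fun x => ‖w x‖ₑ ^ 2 := (hw.continuous.enorm.measurable).pow_const 2
  have hgm : Measurable fun x => ‖w x‖ₑ ^ 2 + dirSq w x := hwm.add (measurable_dirSq hw)
  calc ∫⁻ x in T '' coordBox (Ioc a t) V, ‖w x‖ₑ ^ 2
      = ∫⁻ z in coordBox (Ioc a t) V,
          ENNReal.ofReal |(fderiv ℝ T z).det| * ‖w (T z)‖ₑ ^ 2 :=
        lintegral_image_eq_lintegral_abs_det_fderiv_mul volume (hmeas _ _) (hder ha0 ht)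
          (hinj.mono (hsub ha0 ht)) _
    _ ≤ ∫⁻ z in coordBox (Ioc a t) V, ENNReal.ofReal M * ‖w (T z)‖ₑ ^ 2 := by
        refine setLIntegral_mono' (hmeas _ _) fun z hz => ?_
        gcongr
        exact (hT z (hsub ha0 ht hz)).2.2
    _ = ENNReal.ofReal M * ∫⁻ z in coordBox (Ioc a t) V, ‖w (T z)‖ₑ ^ 2 :=
        lintegral_const_mul' _ _ (by simp)
    _ = ENNReal.ofReal M * ∫⁻ s in V, ∫⁻ τ in Ioc a t, ‖w (σ s + τ • ν (σ s))‖ₑ ^ 2 := by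
        have h := lintegral_coordBox (Ioc a t) V (F := fun z => ‖w (T z)‖ₑ ^ 2)
          (hwm.comp_aemeasurable (hTm ha0 ht))
        rw [h]
        rfl
    _ ≤ ENNReal.ofReal M * ∫⁻ s in V, ENNReal.ofReal t * ENNReal.ofReal (4 / τ₀ + 4 * τ₀) *
          ∫⁻ r in Ioc a τ₀, (‖w (σ s + r • ν (σ s))‖ₑ ^ 2 + dirSq w (σ s + r • ν (σ s))) := by
        gcongr 1
        exact setLIntegral_mono' hV fun s hs => lintegral_ray_le hw _ (hν s hs) hτ₀ ha0 ha ht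
    _ = ENNReal.ofReal M * (ENNReal.ofReal t * ENNReal.ofReal (4 / τ₀ + 4 * τ₀) *
          ∫⁻ z in coordBox (Ioc a τ₀) V, (‖w (T z)‖ₑ ^ 2 + dirSq w (T z))) := by
        have h := lintegral_coordBox (Ioc a τ₀) V (F := fun z => ‖w (T z)‖ₑ ^ 2 + dirSq w (T z))
          (hgm.comp_aemeasurable (hTm ha0 le_rfl))
        rw [lintegral_const_mul' _ _ (ENNReal.mul_ne_top (by simp) (by simp)), h]
        rfl
    _ ≤ ENNReal.ofReal M * (ENNReal.ofReal t * ENNReal.ofReal (4 / τ₀ + 4 * τ₀) *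
          ∫⁻ z in coordBox (Ioc a τ₀) V, ENNReal.ofReal M *
            (ENNReal.ofReal |(fderiv ℝ T z).det| * (‖w (T z)‖ₑ ^ 2 + dirSq w (T z)))) := by
        gcongr 2
        refine setLIntegral_mono' (hmeas _ _) fun z hz => ?_
        rw [← mul_assoc, ← ENNReal.ofReal_mul hM.le]
        refine le_mul_of_one_le_left zero_le ?_
        rw [ENNReal.one_le_ofReal, ← mul_inv_cancel₀ hM.ne']
        exact mul_le_mul_of_nonneg_left (hT z (hsub ha0 le_rfl hz)).2.1 hM.le
    _ = ENNReal.ofReal M * (ENNReal.ofReal t * ENNReal.ofReal (4 / τ₀ + 4 * τ₀) *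
          (ENNReal.ofReal M * ∫⁻ x in T '' coordBox (Ioc a τ₀) V, (‖w x‖ₑ ^ 2 + dirSq w x))) := by
        rw [lintegral_const_mul' _ _ (by simp),
          lintegral_image_eq_lintegral_abs_det_fderiv_mul volume (hmeas _ _) (hder ha0 le_rfl)
          (hinj.mono (hsub ha0 le_rfl))]
    _ = _ := by
        rw [ENNReal.ofReal_mul (sq_nonneg M), ENNReal.ofReal_pow hM.le]
        ring

/-- The boundary is cut into countably many pieces, each of which lies in a chart. -/
lemma exists_chart_decomposition {m : ℕ} {Ω : Set (Space (m + 1))} (hΩ : IsOpen Ω)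
    (hne : (frontier Ω).Nonempty) (hreg : HasRegularBoundary Ω) :
    ∃ (ν : Space (m + 1) → Space (m + 1)) (τ₀ M : ℝ) (σ : ℕ → Space m → Space (m + 1))
      (V : ℕ → Set (Space m)), 0 < τ₀ ∧ 0 < M ∧ (∀ k, MeasurableSet (V k)) ∧
      (∀ k, ∀ s ∈ V k, ‖ν (σ k s)‖ = 1) ∧
      (∀ k, InjOn (tubularMap ν (σ k)) (coordBox (Ioc 0 τ₀) (V k))) ∧
      (∀ k, ∀ z ∈ coordBox (Ioc 0 τ₀) (V k), DifferentiableAt ℝ (tubularMap ν (σ k)) z ∧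
        M⁻¹ ≤ |(fderiv ℝ (tubularMap ν (σ k)) z).det| ∧
        |(fderiv ℝ (tubularMap ν (σ k)) z).det| ≤ M) ∧
      ∀ I ⊆ Ioc 0 τ₀,
        shell Ω I = ⋃ k, tubularMap ν (σ k) '' coordBox I (V k) ∧
        Pairwise (Function.onFun Disjoint fun k => tubularMap ν (σ k) '' coordBox I (V k)) := by
  obtain ⟨ν, τ₀, M, hτ₀, hM, hν, hbij, hch⟩ := hreg
  choose! U σ hU hσ hσi hyU hW hT using hch
  choose! W hWo hWeq using hW
  have hyW : ∀ y ∈ frontier Ω, y ∈ W y := fun y hy => by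
    have := hyU y hy
    rw [hWeq y hy] at this
    exact this.2
  -- By the Lindelöf property countably many chart neighbourhoods suffice; they are made disjoint
  -- below so that the integrals over the pieces add up.
  obtain ⟨S, hSf, hSc, hcov⟩ := TopologicalSpace.countable_cover_nhdsWithin (f := W)
    (s := frontier Ω) fun y hy =>
      mem_nhdsWithin_of_mem_nhds ((hWo y hy).mem_nhds (hyW y hy))
  have hSne : S.Nonempty := by
    obtain ⟨y, hy⟩ := hne
    obtain ⟨z, hz, -⟩ := mem_iUnion₂.1 (hcov hy)
    exact ⟨z, hz⟩
  obtain ⟨c, rfl⟩ := hSc.exists_eq_range hSne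
  have hc : ∀ k, c k ∈ frontier Ω := fun k => hSf (mem_range_self k)
  set P : ℕ → Set (Space (m + 1)) := disjointed fun k => W (c k) with hP
  have hPm : ∀ k, MeasurableSet (P k) :=
    MeasurableSet.disjointed fun k => (hWo _ (hc k)).measurableSet
  have hPW : ∀ k, P k ⊆ W (c k) := fun k => disjointed_subset _ k
  -- In terms of `normalMap` the pieces no longer depend on the charts, so its injectivity yields
  -- both the union and the disjointness.
  have himg : ∀ k I, tubularMap ν (σ (c k)) '' coordBox I (U (c k) ∩ σ (c k) ⁻¹' P k) =
      normalMap ν '' ((frontier Ω ∩ P k) ×ˢ I) := by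
    intro k I
    ext x
    constructor
    · rintro ⟨z, ⟨hz0, hzU, hzP⟩, rfl⟩
      have hmem : σ (c k) (lateral z) ∈ frontier Ω ∩ W (c k) := by
        rw [← hWeq _ (hc k)]
        exact mem_image_of_mem _ hzU
      exact ⟨(σ (c k) (lateral z), z 0), ⟨⟨hmem.1, hzP⟩, hz0⟩, rfl⟩
    · rintro ⟨⟨y, τ⟩, ⟨⟨hyf, hyP⟩, hτ⟩, rfl⟩
      have hmem : y ∈ σ (c k) '' U (c k) := by
        rw [hWeq _ (hc k)]
        exact ⟨hyf, hPW k hyP⟩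
      obtain ⟨s, hs, rfl⟩ := hmem
      exact ⟨consPoint (τ, s), ⟨hτ, hs, hyP⟩, rfl⟩
  have hmemf : ∀ k s, s ∈ U (c k) → σ (c k) s ∈ frontier Ω := by
    intro k s hs
    have : σ (c k) s ∈ frontier Ω ∩ W (c k) := by
      rw [← hWeq _ (hc k)]
      exact mem_image_of_mem _ hs
    exact this.1
  refine ⟨ν, τ₀, M, fun k => σ (c k), fun k => U (c k) ∩ σ (c k) ⁻¹' P k, hτ₀, hM, ?_, ?_, ?_,
    ?_, ?_⟩
  · intro k
    -- `σ` is continuous only on the open set `U`, so measurability of the preimage is obtained in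
    -- the subtype.
    have h1 : Continuous ((U (c k)).domRestrict (σ (c k))) :=
      (hσ _ (hc k)).continuousOn.domRestrict
    have h2 := (hU _ (hc k)).measurableSet.subtype_image (h1.measurable (hPm k))
    convert h2 using 1
    ext s
    simp only [mem_inter_iff, mem_preimage, mem_image, Subtype.exists, exists_and_right,
      exists_eq_right, domRestrict_apply]
    exact ⟨fun h => ⟨h.1, h.2⟩, fun ⟨h, h'⟩ => ⟨h, h'⟩⟩
  · exact fun k s hs => (hν _ (hmemf k s hs.1)).norm_eq_one
  · intro k z hz z' hz' hzz
    have h1 := hbij.injOn (x₁ := (σ (c k) (lateral z), z 0)) (x₂ := (σ (c k) (lateral z'), z' 0))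
      ⟨hmemf k _ hz.2.1, hz.1⟩ ⟨hmemf k _ hz'.2.1, hz'.1⟩ hzz
    rw [Prod.mk.injEq] at h1
    have h2 := hσi _ (hc k) hz.2.1 hz'.2.1 h1.1
    ext i
    refine Fin.cases h1.2 (fun j => ?_) i
    exact congrArg (fun s : Space m => s j) h2
  · intro k z hz
    have h := hT _ (hc k) z hz.1 hz.2.1
    exact ⟨h.1, h.2.2⟩
  · intro I hI
    simp only [himg]
    refine ⟨?_, ?_⟩
    · rw [shell_eq_image hΩ hν hne hbij hI, ← image_iUnion, ← iUnion_prod_const,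
        ← inter_iUnion, hP, iUnion_disjointed, inter_eq_left.2]
      rwa [biUnion_range] at hcov
    · intro k l hkl
      refine disjoint_left.2 ?_
      rintro _ ⟨⟨y, τ⟩, ⟨⟨hyf, hyP⟩, hτ⟩, rfl⟩ ⟨⟨y', τ'⟩, ⟨⟨hyf', hyP'⟩, hτ'⟩, heq⟩
      have h1 := hbij.injOn (x₁ := (y', τ')) (x₂ := (y, τ)) ⟨hyf', hI hτ'⟩ ⟨hyf, hI hτ⟩ heq
      have h2 : y' = y := congrArg Prod.fst h1
      subst h2
      exact disjoint_left.1 (disjoint_disjointed _ hkl) hyP hyP'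

lemma lintegral_shell_le {m n : ℕ} {Ω : Set (Space (m + 1))} (hΩ : IsOpen Ω)
    (hne : (frontier Ω).Nonempty) (hreg : HasRegularBoundary Ω) :
    ∃ τ₀ C : ℝ, 0 < τ₀ ∧ 0 < C ∧ ∀ w : Space (m + 1) → CVec n, ContDiff ℝ ∞ w →
      ∀ a t, 0 ≤ a → a ≤ τ₀ / 2 → t ≤ τ₀ →
        ∫⁻ x in shell Ω (Ioc a t), ‖w x‖ₑ ^ 2 ≤ ENNReal.ofReal t * ENNReal.ofReal C *
          ∫⁻ x in shell Ω (Ioc a τ₀), (‖w x‖ₑ ^ 2 + dirSq w x) := by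
  obtain ⟨ν, τ₀, M, σ, V, hτ₀, hM, hV, hν, hinj, hT, hdec⟩ :=
    exists_chart_decomposition hΩ hne hreg
  refine ⟨τ₀, M ^ 2 * (4 / τ₀ + 4 * τ₀), hτ₀, by positivity, fun w hw a t ha0 ha ht => ?_⟩
  have h1 := hdec (Ioc a t) (Ioc_subset_Ioc ha0 ht)
  have h2 := hdec (Ioc a τ₀) (Ioc_subset_Ioc_left ha0)
  have hmeas : ∀ k, MeasurableSet (tubularMap ν (σ k) '' coordBox (Ioc a τ₀) (V k)) := by
    intro k
    have hsub : coordBox (Ioc a τ₀) (V k) ⊆ coordBox (Ioc 0 τ₀) (V k) :=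
      fun z hz => ⟨Ioc_subset_Ioc_left ha0 hz.1, hz.2⟩
    exact measurable_image_of_fderivWithin (measurableSet_coordBox measurableSet_Ioc (hV k))
      (fun z hz => (hT k z (hsub hz)).1.hasFDerivAt.hasFDerivWithinAt) ((hinj k).mono hsub)
  calc ∫⁻ x in shell Ω (Ioc a t), ‖w x‖ₑ ^ 2
      ≤ ∑' k, ∫⁻ x in tubularMap ν (σ k) '' coordBox (Ioc a t) (V k), ‖w x‖ₑ ^ 2 := by
        rw [h1.1]
        exact lintegral_iUnion_le _ _
    _ ≤ ∑' k, ENNReal.ofReal t * ENNReal.ofReal (M ^ 2 * (4 / τ₀ + 4 * τ₀)) *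
          ∫⁻ x in tubularMap ν (σ k) '' coordBox (Ioc a τ₀) (V k), (‖w x‖ₑ ^ 2 + dirSq w x) :=
        ENNReal.tsum_le_tsum fun k =>
          lintegral_chart_le hw (hV k) hτ₀ hM (hν k) (hinj k) (hT k) ha0 ha ht
    _ = _ := by
        rw [ENNReal.tsum_mul_left, h2.1, lintegral_iUnion hmeas h2.2]

/-- The shells with distance greater than `a k` exhaust the layer as `a k → 0`. On each of them
mollification at scales below `a k` is legitimate and the bound does not depend on `k`. -/
theorem lintegral_boundaryLayer_le {m : ℕ} (n : ℕ) {Ω : Set (Space (m + 1))} (hΩ : IsOpen Ω)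
    (hreg : HasRegularBoundary Ω) :
    ∃ τ₀ C : ℝ, 0 < τ₀ ∧ 0 < C ∧ ∀ p ∈ sobolev Ω n, ∀ t, 0 ≤ t → t ≤ τ₀ →
      ∫⁻ x in boundaryLayer Ω t, ‖p.fst x‖ₑ ^ 2 ≤
        ENNReal.ofReal t * ENNReal.ofReal C * ‖p‖ₑ ^ 2 := by
  rcases (frontier Ω).eq_empty_or_nonempty with he | hne
  · refine ⟨1, 1, one_pos, one_pos, fun p _ t _ _ => ?_⟩
    simp [boundaryLayer, he]
  obtain ⟨τ₀, C, hτ₀, hC, hw⟩ := lintegral_shell_le (n := n) hΩ hne hreg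
  refine ⟨τ₀, C, hτ₀, hC, fun p hp t ht0 ht => ?_⟩
  obtain ⟨w, hws, hlim, happ⟩ := exists_smooth_approx hΩ.measurableSet hp
  set a : ℕ → ℝ := fun k => (1 / ((k : ℝ) + 1)) * (τ₀ / 2) with ha
  have ha0 : ∀ k, 0 < a k := fun k => by positivity
  have hale : ∀ k, a k ≤ τ₀ / 2 := by
    intro k
    have : 1 / ((k : ℝ) + 1) ≤ 1 := by
      rw [div_le_one (by positivity)]
      linarith [Nat.cast_nonneg (α := ℝ) k]
    exact mul_le_of_le_one_left (by positivity) this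
  have hanti : Antitone a := by
    intro k l hkl
    simp only [ha]
    gcongr
  have hatend : Tendsto a atTop (𝓝 0) := by
    simpa only [zero_mul] using
      (tendsto_one_div_add_atTop_nhds_zero_nat (𝕜 := ℝ)).mul_const (τ₀ / 2)
  have key : ∀ k, ∫⁻ x in shell Ω (Ioc (a k) t), ‖p.fst x‖ₑ ^ 2 ≤
      ENNReal.ofReal t * ENNReal.ofReal C * ‖p‖ₑ ^ 2 := by
    intro k
    have hlimS := ae_mono (Measure.restrict_mono
      (inter_subset_left : shell Ω (Ioc (a k) t) ⊆ Ω) le_rfl) hlim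
    have hae : ∀ᵐ x ∂volume.restrict (shell Ω (Ioc (a k) t)),
        ‖p.fst x‖ₑ ^ 2 = liminf (fun i => ‖w i x‖ₑ ^ 2) atTop := by
      filter_upwards [hlimS] with x hx
      exact (((ENNReal.continuous_pow 2).tendsto _).comp hx.enorm).liminf_eq.symm
    rw [lintegral_congr_ae hae]
    refine (lintegral_liminf_le fun i =>
      ((hws i).continuous.enorm.measurable).pow_const 2).trans ?_
    refine liminf_le_of_frequently_le' (Eventually.frequently ?_)
    filter_upwards [happ (shell Ω (Ioc (a k) τ₀)) Ω (a k)
      (measurableSet_shell hΩ measurableSet_Ioc) subset_rfl (ha0 k) (fun x hx =>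
        (Metric.ball_subset_ball hx.2.1.le).trans (ball_infDist_frontier_subset hΩ hx.1))]
      with i hi
    refine (hw (w i) (hws i) (a k) t (ha0 k).le (hale k) ht).trans ?_
    rw [lintegral_add_left (((hws i).continuous.enorm.measurable).pow_const 2), Jet.enorm_sq]
    exact mul_le_mul_right (add_le_add hi.1 hi.2) _
  have hunion : boundaryLayer Ω t = ⋃ k, shell Ω (Ioc (a k) t) := by
    ext x
    rw [mem_boundaryLayer_iff hne ht0, mem_iUnion]
    constructor
    · rintro ⟨hx, hxt⟩
      obtain ⟨k, hk⟩ := (hatend.eventually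
        (gt_mem_nhds (infDist_frontier_pos hΩ hx hne))).exists
      exact ⟨k, hx, hk, hxt⟩
    · rintro ⟨k, hx, hxt⟩
      exact ⟨hx, hxt.2⟩
  rw [hunion, setLIntegral_iUnion_of_directed]
  · exact iSup_le key
  · exact Monotone.directed_le fun k l hkl x hx => ⟨hx.1, Ioc_subset_Ioc_left (hanti hkl) hx.2⟩

/-! ### Scaled cells -/

open scoped Pointwise

lemma scaledCell_eq_smul {d : ℕ} (cell : Set (Space d)) {η : ℝ} (hη : 0 < η) (γ : Space d) :
    scaledCell cell η γ = η • (γ +ᵥ cell) := by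
  ext x
  rw [mem_smul_set_iff_inv_smul_mem₀ hη.ne', mem_vadd_set_iff_neg_vadd_mem, vadd_eq_add,
    neg_add_eq_sub]
  rfl

lemma convex_scaledCell {d : ℕ} {cell : Set (Space d)} (hc : Convex ℝ cell) {η : ℝ} (hη : 0 < η)
    (γ : Space d) : Convex ℝ (scaledCell cell η γ) := by
  rw [scaledCell_eq_smul cell hη]
  exact (hc.vadd γ).smul η

lemma volume_scaledCell {d : ℕ} (cell : Set (Space d)) {η : ℝ} (hη : 0 < η) (γ : Space d) :
    volume (scaledCell cell η γ) = ENNReal.ofReal (η ^ d) * volume cell := by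
  rw [scaledCell_eq_smul cell hη, Measure.addHaar_smul_of_nonneg _ hη.le, measure_vadd]
  simp

lemma norm_sub_le_of_mem_scaledCell {d : ℕ} {cell : Set (Space d)} {D : ℝ}
    (hD : ∀ x ∈ cell, ∀ y ∈ cell, ‖y - x‖ ≤ D) {η : ℝ} (hη : 0 < η) {γ x y : Space d}
    (hx : x ∈ scaledCell cell η γ) (hy : y ∈ scaledCell cell η γ) : ‖y - x‖ ≤ η * D := by
  have h := hD _ hx _ hy
  rw [sub_sub_sub_cancel_right, ← smul_sub, norm_smul, norm_inv, Real.norm_of_nonneg hη.le,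
    inv_mul_le_iff₀ hη] at h
  exact h

lemma interior_ae_eq_of_convex {d : ℕ} {A : Set (Space d)} (hA : Convex ℝ A) :
    interior A =ᵐ[volume] A :=
  interior_ae_eq_of_null_frontier (hA.addHaar_frontier volume)

lemma IsPeriodicityCell.exists_diam_bound {d : ℕ} {Γ : Submodule ℤ (Space d)} {cell : Set (Space d)}
    (h : IsPeriodicityCell Γ cell) : ∃ D : ℝ, 0 < D ∧ ∀ x ∈ cell, ∀ y ∈ cell, ‖y - x‖ ≤ D := by
  obtain ⟨D, hD⟩ := Metric.isBounded_iff.1 h.1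
  refine ⟨max D 1, by positivity, fun x hx y hy => ?_⟩
  rw [← dist_eq_norm]
  exact (hD hy hx).trans (le_max_left _ _)

lemma IsPeriodicityCell.volume_ne_zero {d : ℕ} {Γ : Submodule ℤ (Space d)} [Countable Γ]
    {cell : Set (Space d)} (h : IsPeriodicityCell Γ cell) : volume cell ≠ 0 := by
  have : VAddInvariantMeasure Γ (Space d) volume :=
    ⟨fun c s _ => measure_preimage_add volume (c : Space d) s⟩
  exact h.2.2.measure_ne_zero (NeZero.ne _)

lemma IsPeriodicityCell.volume_ne_top {d : ℕ} {Γ : Submodule ℤ (Space d)}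
    {cell : Set (Space d)} (h : IsPeriodicityCell Γ cell) : volume cell ≠ ⊤ :=
  h.1.measure_lt_top.ne

/-- Scaling by `η⁻¹` preserves null sets, so the covering by unit cells transfers. The domain moves
points into the cell by `g`, so the cell containing the point has index `-g`. -/
lemma IsPeriodicityCell.ae_exists_mem_scaledCell {d : ℕ} {Γ : Submodule ℤ (Space d)}
    {cell : Set (Space d)} (h : IsPeriodicityCell Γ cell) {η : ℝ} (hη : 0 < η) :
    ∀ᵐ x : Space d, ∃ γ : Γ, x ∈ scaledCell cell η γ := by
  have h1 := (Measure.quasiMeasurePreserving_smul (volume : Measure (Space d))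
    (inv_ne_zero hη.ne')).ae h.2.2.ae_covers
  filter_upwards [h1] with x hx
  obtain ⟨g, hg⟩ := hx
  refine ⟨-g, ?_⟩
  have h2 : η⁻¹ • x - ((-g : Γ) : Space d) = g +ᵥ (η⁻¹ • x) := by
    rw [Submodule.coe_neg, sub_neg_eq_add, add_comm]
    rfl
  change η⁻¹ • x - ((-g : Γ) : Space d) ∈ cell
  rw [h2]
  exact hg

lemma IsPeriodicityCell.pairwise_aedisjoint {d : ℕ} {Γ : Submodule ℤ (Space d)}
    {cell : Set (Space d)} (h : IsPeriodicityCell Γ cell) {η : ℝ} (hη : 0 < η) :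
    Pairwise (Function.onFun (AEDisjoint volume) fun γ : Γ => scaledCell cell η γ) := by
  intro γ γ' hne
  have h1 := (h.2.2.aedisjoint hne).preimage
    (Measure.quasiMeasurePreserving_smul (volume : Measure (Space d)) (inv_ne_zero hη.ne'))
  have h2 : ∀ g : Γ, (fun x : Space d => η⁻¹ • x) ⁻¹' (g +ᵥ cell) = scaledCell cell η g := by
    intro g
    ext x
    rw [mem_preimage, mem_vadd_set_iff_neg_vadd_mem]
    have h3 : -g +ᵥ η⁻¹ • x = η⁻¹ • x - (g : Space d) := by
      rw [sub_eq_neg_add]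
      rfl
    rw [h3]
    rfl
  simpa only [h2] using h1

/-- The weight `|R|²`. -/
noncomputable def weight {d n : ℕ} (R : MatFun d n) (x : Space d) : ℝ≥0∞ :=
  ENNReal.ofReal (matAbs (R x)) ^ 2

/-! ### The weighted bound on one cell and its summation -/

lemma enorm_sq_mulFun_le {d n : ℕ} (R : MatFun d n) (u : Space d → CVec n) (x : Space d) :
    ‖mulFun R u x‖ₑ ^ 2 ≤ weight R x * ‖u x‖ₑ ^ 2 := by
  rw [weight, ← mul_pow]
  gcongr
  exact enorm_mulFun_le R u x

/-- Boundedness of `R` and finite volume of the cell make the integrand integrable, so that the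
Bochner integral agrees with the extended one. -/
lemma cellBound_iff {d n : ℕ} {Ω : Set (Space d)} {Γ : Submodule ℤ (Space d)}
    {cell : Set (Space d)} (h : IsPeriodicityCell Γ cell) {R : MatFun d n} (hR : MemLinfty Ω R)
    {η ρ : ℝ} (hη : 0 < η) (hρ : 0 ≤ ρ) :
    CellBound Ω Γ cell R η ρ ↔ ∀ γ ∈ innerLattice Ω Γ cell η,
      ∫⁻ x in scaledCell cell η γ, weight R x ≤ ENNReal.ofReal (η ^ d) * ENNReal.ofReal ρ := by
  obtain ⟨K, hK⟩ := hR.exists_bound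
  refine forall₂_congr fun γ hγ => ?_
  have hsub := Measure.restrict_mono hγ.2 (le_refl (volume : Measure (Space d)))
  have hpow : 0 < η ^ d := by positivity
  have hint : IntegrableOn (fun x => (η ^ d)⁻¹ * matAbs (R x) ^ 2) (scaledCell cell η γ) := by
    refine ⟨?_, .restrict_of_bounded (C := (η ^ d)⁻¹ * K ^ 2) ?_ ?_⟩
    · have h1 := (aestronglyMeasurable_matAbs fun i j => (hR i j).1).mono_measure hsub
      exact (h1.pow 2).const_mul _
    · rw [volume_scaledCell cell hη]
      exact ENNReal.mul_lt_top ENNReal.ofReal_lt_top h.volume_ne_top.lt_top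
    · filter_upwards [ae_mono hsub (ae_matAbs_le hK)] with x hx
      rw [Real.norm_of_nonneg (by positivity)]
      gcongr
      exact matAbs_nonneg _
  have h2 : ENNReal.ofReal (∫ x in scaledCell cell η γ, (η ^ d)⁻¹ * matAbs (R x) ^ 2) =
      ENNReal.ofReal (η ^ d)⁻¹ * ∫⁻ x in scaledCell cell η γ, weight R x := by
    rw [ofReal_integral_eq_lintegral_ofReal hint (Eventually.of_forall fun x => by positivity),
      ← lintegral_const_mul' _ _ ENNReal.ofReal_ne_top]
    refine lintegral_congr fun x => ?_
    rw [weight, ENNReal.ofReal_mul (by positivity), ENNReal.ofReal_pow (matAbs_nonneg _)]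
  rw [← ENNReal.ofReal_le_ofReal_iff hρ, h2, ENNReal.ofReal_inv_of_pos hpow,
    ENNReal.inv_mul_le_iff (by simpa using hpow) ENNReal.ofReal_ne_top]

/-- The interior replaces the cell, since the frontier of a convex set is null. Cell volume, cell
bound and Poincaré constant all carry a factor `η^d`, which cancels. -/
lemma lintegral_mulFun_cell_le {d n : ℕ} {Ω : Set (Space d)} (hΩ : MeasurableSet Ω)
    {Γ : Submodule ℤ (Space d)} {cell : Set (Space d)} (h : IsPeriodicityCell Γ cell) {D : ℝ}
    (hD0 : 0 < D) (hD : ∀ x ∈ cell, ∀ y ∈ cell, ‖y - x‖ ≤ D) {R : MatFun d n}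
    (hR : MemLinfty Ω R) {K : ℝ} (hK : ∀ᵐ x ∂volume.restrict Ω, matAbs (R x) ≤ K)
    {η ρ : ℝ} (hη : 0 < η) (hρ : 0 ≤ ρ) (hcb : CellBound Ω Γ cell R η ρ) {p : Jet Ω n}
    (hp : p ∈ sobolev Ω n) {γ : Space d} (hγ : γ ∈ innerLattice Ω Γ cell η) :
    volume cell * ∫⁻ x in scaledCell cell η γ, ‖mulFun R p.fst x‖ₑ ^ 2 ≤
      2 * ENNReal.ofReal ρ * (∫⁻ x in scaledCell cell η γ, ‖p.fst x‖ₑ ^ 2) +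
        2 * ENNReal.ofReal K ^ 2 * (ENNReal.ofReal (η * D) ^ 2 *
          volume (Metric.closedBall (0 : Space d) D)) *
          ∫⁻ x in scaledCell cell η γ, gradSq p x := by
  set A := scaledCell cell η γ with hA
  have hconv : Convex ℝ A := convex_scaledCell h.2.1 hη γ
  have hae : volume.restrict (interior A) = volume.restrict A :=
    Measure.restrict_congr_set (interior_ae_eq_of_convex hconv)
  have hwt : ∀ᵐ x ∂volume.restrict (interior A), weight R x ≤ ENNReal.ofReal K ^ 2 := by
    rw [hae]
    filter_upwards [ae_mono (Measure.restrict_mono hγ.2 le_rfl) hK] with x hx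
    rw [weight]
    gcongr
  have h1 := lintegral_weight_mul_le hΩ hp isOpen_interior hconv.interior
    (interior_subset.trans hγ.2) (D := η * D)
    (fun x hx y hy => norm_sub_le_of_mem_scaledCell hD hη (interior_subset hx)
      (interior_subset hy)) (by simp) hwt
  rw [hae, measure_congr (interior_ae_eq_of_convex hconv), hA, volume_scaledCell cell hη,
    ← hA, Measure.addHaar_closedBall_mul _ _ hη.le hD0.le] at h1
  have hfr : Module.finrank ℝ (Space d) = d := by simp
  rw [hfr] at h1
  have h2 := (cellBound_iff h hR hη hρ).1 hcb γ hγ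
  have hN0 : ENNReal.ofReal (η ^ d) ≠ 0 := by
    have : 0 < η ^ d := by positivity
    simpa using this
  rw [← ENNReal.mul_le_mul_iff_right hN0 ENNReal.ofReal_ne_top]
  calc ENNReal.ofReal (η ^ d) * (volume cell * ∫⁻ x in A, ‖mulFun R p.fst x‖ₑ ^ 2)
      ≤ ENNReal.ofReal (η ^ d) * volume cell * ∫⁻ x in A, weight R x * ‖p.fst x‖ₑ ^ 2 := by
        rw [mul_assoc]
        gcongr with x
        exact enorm_sq_mulFun_le R _ x
    _ ≤ _ := h1
    _ ≤ 2 * (ENNReal.ofReal (η ^ d) * ENNReal.ofReal ρ) * (∫⁻ x in A, ‖p.fst x‖ₑ ^ 2) +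
        2 * ENNReal.ofReal K ^ 2 * (ENNReal.ofReal (η * D) ^ 2 * (ENNReal.ofReal (η ^ d) *
          volume (Metric.closedBall (0 : Space d) D))) * ∫⁻ x in A, gradSq p x := by
        gcongr
    _ = _ := by ring

/-- The segment from `x` to a point of the cell outside `Ω` meets the frontier, and its length is at
most the cell diameter. -/
lemma mem_boundaryLayer_of_not_subset {d : ℕ} {Ω : Set (Space d)} (hΩ : IsOpen Ω)
    {cell : Set (Space d)} {D : ℝ} (hD : ∀ x ∈ cell, ∀ y ∈ cell, ‖y - x‖ ≤ D) {η : ℝ} (hη : 0 < η)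
    {γ x : Space d} (hx : x ∈ Ω) (hxc : x ∈ scaledCell cell η γ)
    (hγ : ¬ scaledCell cell η γ ⊆ Ω) : x ∈ boundaryLayer Ω (η * D) := by
  obtain ⟨y, hy, hyΩ⟩ := not_subset.1 hγ
  have h1 : ¬ Disjoint (segment ℝ x y) (frontier Ω) := fun hd =>
    hyΩ (IsPreconnected.subset_of_disjoint_frontier (convex_segment x y).isPreconnected hΩ
      ⟨x, left_mem_segment ℝ x y, hx⟩ hd (right_mem_segment ℝ x y))
  obtain ⟨z, hz, hzf⟩ := not_disjoint_iff.1 h1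
  refine ⟨hx, Metric.mem_cthickening_of_dist_le x z _ _ hzf ?_⟩
  have h2 : dist x z ≤ dist x y := by
    have := dist_add_dist_of_mem_segment hz
    linarith [dist_nonneg (x := z) (y := y)]
  refine h2.trans ?_
  rw [dist_comm, dist_eq_norm]
  exact norm_sub_le_of_mem_scaledCell hD hη hxc hy

/-- Only countable subadditivity is used, so `f` need not be measurable. -/
lemma lintegral_le_boundaryLayer_add_tsum {d : ℕ} {Ω : Set (Space d)} (hΩ : IsOpen Ω)
    {Γ : Submodule ℤ (Space d)} [Countable Γ] {cell : Set (Space d)}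
    (h : IsPeriodicityCell Γ cell) {D : ℝ} (hD : ∀ x ∈ cell, ∀ y ∈ cell, ‖y - x‖ ≤ D) {η : ℝ}
    (hη : 0 < η) (f : Space d → ℝ≥0∞) :
    ∫⁻ x in Ω, f x ≤ (∫⁻ x in boundaryLayer Ω (η * D), f x) +
      ∑' γ : {γ : Γ // (γ : Space d) ∈ innerLattice Ω Γ cell η},
        ∫⁻ x in scaledCell cell η γ, f x := by
  calc ∫⁻ x in Ω, f x ≤ ∫⁻ x in boundaryLayer Ω (η * D) ∪
        ⋃ γ : {γ : Γ // (γ : Space d) ∈ innerLattice Ω Γ cell η}, scaledCell cell η γ, f x := by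
        refine lintegral_mono_set' ?_
        filter_upwards [h.ae_exists_mem_scaledCell hη] with x hx hxΩ
        obtain ⟨γ, hγ⟩ := hx
        by_cases hsub : scaledCell cell η γ ⊆ Ω
        · exact Or.inr (mem_iUnion.2 ⟨⟨γ, γ.2, hsub⟩, hγ⟩)
        · exact Or.inl (mem_boundaryLayer_of_not_subset hΩ hD hη hxΩ hγ hsub)
    _ ≤ _ := (lintegral_union_le _ _ _).trans (by
        gcongr
        exact lintegral_iUnion_le _ _)

lemma tsum_lintegral_innerLattice_le {d : ℕ} {Ω : Set (Space d)}
    {Γ : Submodule ℤ (Space d)} [Countable Γ] {cell : Set (Space d)}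
    (h : IsPeriodicityCell Γ cell) {η : ℝ} (hη : 0 < η) (f : Space d → ℝ≥0∞) :
    ∑' γ : {γ : Γ // (γ : Space d) ∈ innerLattice Ω Γ cell η},
      ∫⁻ x in scaledCell cell η γ, f x ≤ ∫⁻ x in Ω, f x := by
  rw [← lintegral_iUnion₀]
  · exact lintegral_mono_set (iUnion_subset fun γ => γ.2.2)
  · exact fun γ => (convex_scaledCell h.2.1 hη γ).nullMeasurableSet volume
  · exact fun γ γ' hne => h.pairwise_aedisjoint hη (fun heq => hne (Subtype.ext heq))

theorem exists_multiplierENorm_le_of_cellBound {m n : ℕ} {Ω : Set (Space (m + 1))}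
    (hΩ : IsOpen Ω) (hreg : HasRegularBoundary Ω) (bc : BoundaryCondition)
    {Γ : Submodule ℤ (Space (m + 1))} [Countable Γ] {cell : Set (Space (m + 1))}
    (h : IsPeriodicityCell Γ cell) {K : ℝ} (hK0 : 0 ≤ K) :
    ∃ C : ℝ, 0 < C ∧ ∀ R : MatFun (m + 1) n, MemLinfty Ω R →
      (∀ᵐ x ∂volume.restrict Ω, matAbs (R x) ≤ K) → ∀ η ρ : ℝ, 0 < η → 0 ≤ ρ →
        CellBound Ω Γ cell R η ρ →
          multiplierENorm bc Ω R ≤ ENNReal.ofReal (C * (√ρ + √η)) := by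
  obtain ⟨D, hD0, hD⟩ := h.exists_diam_bound
  obtain ⟨τ₀, C₀, hτ₀, hC₀, hlayer⟩ := lintegral_boundaryLayer_le n hΩ hreg
  set v := (volume cell).toReal with hv
  have hv0 : 0 < v := ENNReal.toReal_pos h.volume_ne_zero h.volume_ne_top
  have hvc : volume cell = ENNReal.ofReal v := (ENNReal.ofReal_toReal h.volume_ne_top).symm
  set b := (volume (Metric.closedBall (0 : Space (m + 1)) D)).toReal with hb
  have hb0 : 0 ≤ b := ENNReal.toReal_nonneg
  have hbc : volume (Metric.closedBall (0 : Space (m + 1)) D) = ENNReal.ofReal b :=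
    (ENNReal.ofReal_toReal Metric.isBounded_closedBall.measure_lt_top.ne).symm
  -- The three summands stand for the boundary layer, the cell means and the Poincaré term, the last
  -- using `(η D)² ≤ τ₀ D η`; the division removes the cell volume.
  set B : ℝ := (v * K ^ 2 * D * C₀ + 2 + 2 * K ^ 2 * (τ₀ * D * b)) / v with hB
  have hB0 : 0 < B := by positivity
  refine ⟨√B + K * √(D / τ₀), by positivity, fun R hR hRK η ρ hη hρ hcb => ?_⟩
  rcases le_or_gt (η * D) τ₀ with hle | hgt
  · have hmain : ∀ p ∈ formDomain bc Ω n, ∫⁻ x in Ω, ‖mulFun R p.fst x‖ₑ ^ 2 ≤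
        ENNReal.ofReal (B * (ρ + η)) * ‖p‖ₑ ^ 2 := by
      intro p hpV
      have hp : p ∈ sobolev Ω n := by
        cases bc with
        | dirichlet => exact hpV.1
        | robin => exact hpV
      have hu : ∫⁻ x in Ω, ‖p.fst x‖ₑ ^ 2 ≤ ‖p‖ₑ ^ 2 := by
        rw [Jet.enorm_sq]; exact le_self_add
      have hg : ∫⁻ x in Ω, gradSq p x ≤ ‖p‖ₑ ^ 2 := by
        rw [Jet.enorm_sq]; exact le_add_self
      have h1 : ∫⁻ x in boundaryLayer Ω (η * D), ‖mulFun R p.fst x‖ₑ ^ 2 ≤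
          ENNReal.ofReal K ^ 2 * (ENNReal.ofReal (η * D) * ENNReal.ofReal C₀ * ‖p‖ₑ ^ 2) := by
        refine (lintegral_mulFun_le_of_bound hRK inter_subset_left _).trans ?_
        gcongr
        exact hlayer p hp _ (by positivity) hle
      have h2 : volume cell * ∑' γ : {γ : Γ // (γ : Space (m + 1)) ∈ innerLattice Ω Γ cell η},
          ∫⁻ x in scaledCell cell η γ, ‖mulFun R p.fst x‖ₑ ^ 2 ≤
          2 * ENNReal.ofReal ρ * ‖p‖ₑ ^ 2 + 2 * ENNReal.ofReal K ^ 2 *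
            (ENNReal.ofReal (η * D) ^ 2 * ENNReal.ofReal b) * ‖p‖ₑ ^ 2 := by
        rw [← ENNReal.tsum_mul_left]
        refine (ENNReal.tsum_le_tsum fun γ => lintegral_mulFun_cell_le hΩ.measurableSet h hD0 hD
          hR hRK hη hρ hcb hp γ.2).trans ?_
        rw [ENNReal.tsum_add, ENNReal.tsum_mul_left, ENNReal.tsum_mul_left, hbc]
        gcongr
        · exact (tsum_lintegral_innerLattice_le h hη _).trans hu
        · exact (tsum_lintegral_innerLattice_le h hη _).trans hg
      have h3 : volume cell * ∫⁻ x in Ω, ‖mulFun R p.fst x‖ₑ ^ 2 ≤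
          ENNReal.ofReal (v * B * (ρ + η)) * ‖p‖ₑ ^ 2 := by
        calc volume cell * ∫⁻ x in Ω, ‖mulFun R p.fst x‖ₑ ^ 2
            ≤ ENNReal.ofReal v * (ENNReal.ofReal K ^ 2 *
                (ENNReal.ofReal (η * D) * ENNReal.ofReal C₀ * ‖p‖ₑ ^ 2)) +
              (2 * ENNReal.ofReal ρ * ‖p‖ₑ ^ 2 + 2 * ENNReal.ofReal K ^ 2 *
                (ENNReal.ofReal (η * D) ^ 2 * ENNReal.ofReal b) * ‖p‖ₑ ^ 2) := by
              refine (mul_le_mul_right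
                (lintegral_le_boundaryLayer_add_tsum hΩ h hD hη _) _).trans ?_
              rw [mul_add]
              refine add_le_add ?_ h2
              rw [hvc]
              exact mul_le_mul_right h1 _
          _ = ENNReal.ofReal (v * (K ^ 2 * (η * D * C₀)) + (2 * ρ +
                2 * K ^ 2 * ((η * D) ^ 2 * b))) * ‖p‖ₑ ^ 2 := by
              rw [ENNReal.ofReal_add (by positivity) (by positivity),
                ENNReal.ofReal_add (by positivity) (by positivity)]
              repeat rw [ENNReal.ofReal_mul (by positivity)]
              rw [ENNReal.ofReal_pow hK0, ENNReal.ofReal_pow (by positivity),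
                ENNReal.ofReal_mul hη.le, ENNReal.ofReal_ofNat]
              ring
          _ ≤ _ := by
              gcongr
              have h4 : v * B = v * K ^ 2 * D * C₀ + 2 + 2 * K ^ 2 * (τ₀ * D * b) := by
                rw [hB]; field_simp
              rw [h4]
              have h5 : (η * D) ^ 2 * b ≤ τ₀ * D * b * η := by
                have : (η * D) ^ 2 ≤ τ₀ * (η * D) := by
                  rw [sq]; gcongr
                calc (η * D) ^ 2 * b ≤ τ₀ * (η * D) * b := by gcongr
                  _ = _ := by ring
              have h6 : K ^ 2 * ((η * D) ^ 2 * b) ≤ K ^ 2 * (τ₀ * D * b * η) := by gcongr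
              have h7 : 0 ≤ (v * K ^ 2 * D * C₀ + 2 * K ^ 2 * (τ₀ * D * b)) * ρ := by positivity
              nlinarith
      rw [hvc, mul_assoc v, ENNReal.ofReal_mul hv0.le, mul_assoc] at h3
      exact (ENNReal.mul_le_mul_iff_right (by simpa using hv0) ENNReal.ofReal_ne_top).1 h3
    refine multiplierENorm_le fun p hp => (hmain p hp).trans ?_
    gcongr
    rw [← ENNReal.ofReal_pow (by positivity)]
    refine ENNReal.ofReal_le_ofReal ?_
    calc B * (ρ + η) ≤ B * (√ρ + √η) ^ 2 := by
          gcongr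
          have h8 := Real.sq_sqrt hρ
          have h9 := Real.sq_sqrt hη.le
          nlinarith [mul_nonneg (Real.sqrt_nonneg ρ) (Real.sqrt_nonneg η)]
      _ = (√B * (√ρ + √η)) ^ 2 := by rw [mul_pow, Real.sq_sqrt hB0.le]
      _ ≤ _ := by
          gcongr
          exact le_add_of_nonneg_right (by positivity)
  -- Beyond the range of the layer estimate, `√η` is bounded below and the trivial bound `K` is
  -- absorbed into the constant.
  · refine (multiplierENorm_le_of_bound hRK).trans (ENNReal.ofReal_le_ofReal ?_)
    have h1 : 1 ≤ √(D / τ₀) * √η := by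
      rw [← Real.sqrt_mul (by positivity), Real.one_le_sqrt, div_mul_eq_mul_div,
        one_le_div hτ₀, mul_comm]
      exact hgt.le
    calc K = K * 1 := (mul_one K).symm
      _ ≤ K * (√(D / τ₀) * √η) := by gcongr
      _ = K * √(D / τ₀) * √η := by ring
      _ ≤ _ := by
        gcongr
        · exact le_add_of_nonneg_left (by positivity)
        · exact le_add_of_nonneg_left (by positivity)

/-! ### Test functions -/

/-- Compactly supported smooth functions belong to both form domains, so the converse direction
needs no case distinction afterwards. -/
lemma exists_jet_of_contDiff {d n : ℕ} (bc : BoundaryCondition) {Ω : Set (Space d)}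
    {φ : Space d → CVec n} (hφ : ContDiff ℝ ∞ φ) (hc : HasCompactSupport φ)
    (hs : tsupport φ ⊆ Ω) :
    ∃ p ∈ formDomain bc Ω n, p.fst =ᵐ[volume.restrict Ω] φ ∧
      ‖p‖ₑ ^ 2 = (∫⁻ x in Ω, ‖φ x‖ₑ ^ 2) + ∫⁻ x in Ω, dirSq φ x := by
  set g : Fin d → Space d → CVec n := fun j x => fderiv ℝ φ x (EuclideanSpace.single j 1) with hg
  have hgc : ∀ j, Continuous (g j) := fun j =>
    (hφ.continuous_fderiv (by simp)).clm_apply continuous_const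
  have hgs : ∀ j, HasCompactSupport (g j) := fun j =>
    (hc.fderiv (𝕜 := ℝ)).comp_left (g := fun l : Space d →L[ℝ] CVec n =>
      l (EuclideanSpace.single j 1)) rfl
  have hm : MemLp φ 2 (volume.restrict Ω) :=
    hφ.continuous.memLp_of_hasCompactSupport hc
  have hgm : ∀ j, MemLp (g j) 2 (volume.restrict Ω) := fun j =>
    (hgc j).memLp_of_hasCompactSupport (hgs j)
  set p : Jet Ω n := WithLp.toLp 2 (hm.toLp φ, WithLp.toLp 2 fun j => (hgm j).toLp (g j)) with hp
  have h1 : p.fst =ᵐ[volume.restrict Ω] φ := hm.coeFn_toLp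
  have h2 : ∀ j, p.snd j =ᵐ[volume.restrict Ω] g j := fun j => (hgm j).coeFn_toLp
  have hzero : ∀ x ∉ Ω, φ x = 0 := fun x hx => image_eq_zero_of_notMem_tsupport fun h => hx (hs h)
  have hgzero : ∀ j, ∀ x ∉ Ω, g j x = 0 := fun j x hx => by
    have : fderiv ℝ φ x = 0 := by
      by_contra hne
      exact hx (hs (support_fderiv_subset ℝ hne))
    simp [hg, this]
  have hsob : p ∈ sobolev Ω n := by
    intro j ψ hψ hψc hψs
    have e1 : ∫ x in Ω, fderiv ℝ ψ x (EuclideanSpace.single j 1) • p.fst x =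
        ∫ x, fderiv ℝ ψ x (EuclideanSpace.single j 1) • φ x := by
      have e0 : ∫ x in Ω, fderiv ℝ ψ x (EuclideanSpace.single j 1) • φ x =
          ∫ x, fderiv ℝ ψ x (EuclideanSpace.single j 1) • φ x :=
        setIntegral_eq_integral_of_forall_compl_eq_zero fun x hx => by
          rw [hzero x hx, smul_zero]
      rw [← e0]
      refine integral_congr_ae ?_
      filter_upwards [h1] with x hx
      rw [hx]
    have e2 : ∫ x in Ω, ψ x • p.snd j x = ∫ x, ψ x • g j x := by
      have e0 : ∫ x in Ω, ψ x • g j x = ∫ x, ψ x • g j x :=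
        setIntegral_eq_integral_of_forall_compl_eq_zero fun x hx => by
          rw [hgzero j x hx, smul_zero]
      rw [← e0]
      refine integral_congr_ae ?_
      filter_upwards [h2 j] with x hx
      rw [hx]
    rw [e1, e2, integral_smul_fderiv_eq_neg_fderiv_smul_of_integrable, neg_neg]
    · exact (((hψ.continuous_fderiv (by simp)).clm_apply continuous_const).smul
        hφ.continuous).integrable_of_hasCompactSupport hc.smul_left
    · exact (hψ.continuous.smul (hgc j)).integrable_of_hasCompactSupport (hgs j).smul_left
    · exact (hψ.continuous.smul hφ.continuous).integrable_of_hasCompactSupport hc.smul_left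
    · exact fun x _ => (hψ.differentiable (by simp)) x
    · exact fun x _ => (hφ.differentiable (by simp)) x
  refine ⟨p, ?_, h1, ?_⟩
  · cases bc with
    | robin => exact hsob
    | dirichlet => exact ⟨hsob, subset_closure ⟨hsob, φ, hφ, hc, hs, h1⟩⟩
  · rw [Jet.enorm_sq]
    congr 1
    · refine lintegral_congr_ae ?_
      filter_upwards [h1] with x hx
      rw [hx]
    · refine lintegral_congr_ae ?_
      filter_upwards [ae_all_iff.2 h2] with x hx
      simp only [gradSq, dirSq, hx, hg]

lemma sum_enorm_sq_mulFun_single {d n : ℕ} (R : MatFun d n) (χ : Space d → ℝ) (x : Space d) :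
    ∑ k, ‖mulFun R (fun x => χ x • (EuclideanSpace.single k 1 : CVec n)) x‖ₑ ^ 2 =
      ENNReal.ofReal (frobSq (R x)) * ‖χ x‖ₑ ^ 2 := by
  have h : ∀ k, mulFun R (fun x => χ x • (EuclideanSpace.single k 1 : CVec n)) x =
      WithLp.toLp 2 (R x *ᵥ WithLp.ofLp (EuclideanSpace.single k (χ x : ℂ) : CVec n)) := by
    intro k
    rw [mulFun]
    congr 3
    ext i
    simp
  simp only [h, enorm_sq_eq_ofReal]
  rw [← ENNReal.ofReal_sum_of_nonneg fun _ _ => sq_nonneg _, sum_norm_sq_mulVec_single,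
    ENNReal.ofReal_mul (frobSq_nonneg _), Complex.norm_real]

/-- The multiplier norm controls the weight on the set where a cutoff function equals one. -/
theorem lintegral_weight_le {d n : ℕ} {bc : BoundaryCondition} {Ω S : Set (Space d)}
    {R : MatFun d n} (hR : ∀ i j, AEStronglyMeasurable (fun x => R x i j) (volume.restrict Ω))
    {χ : Space d → ℝ} (hχ : ContDiff ℝ ∞ χ) (hc : HasCompactSupport χ) (hs : tsupport χ ⊆ Ω)
    (hSm : MeasurableSet S) (hSΩ : S ⊆ Ω)
    (hS : ∀ x ∈ S, χ x = 1) :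
    ∫⁻ x in S, weight R x ≤ n ^ 3 * (multiplierENorm bc Ω R ^ 2 *
      ((∫⁻ x in Ω, ‖χ x‖ₑ ^ 2) +
        ∫⁻ x in Ω, ∑ j, ‖fderiv ℝ χ x (EuclideanSpace.single j 1)‖ₑ ^ 2)) := by
  -- Testing with `χ e_k` for all `k` recovers the Frobenius norm. The factor `n³` is `n²` from
  -- comparing `matAbs` with it, times `n` test functions.
  set φ : Fin n → Space d → CVec n := fun k x => χ x • EuclideanSpace.single k 1 with hφdef
  have hφ : ∀ k, ContDiff ℝ ∞ (φ k) := fun k => hχ.smul contDiff_const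
  have hφs : ∀ k, tsupport (φ k) ⊆ tsupport χ := fun k => tsupport_smul_subset_left χ _
  have hφc : ∀ k, HasCompactSupport (φ k) := fun k => hc.smul_right
  have hnφ : ∀ k x, ‖φ k x‖ₑ ^ 2 = ‖χ x‖ₑ ^ 2 := by
    intro k x
    simp only [enorm_sq_eq_ofReal, hφdef, norm_smul]
    simp
  have hdφ : ∀ k x, dirSq (φ k) x =
      ∑ j, ‖fderiv ℝ χ x (EuclideanSpace.single j 1)‖ₑ ^ 2 := by
    intro k x
    unfold dirSq
    refine Finset.sum_congr rfl fun j _ => ?_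
    have h1 : HasFDerivAt (φ k) ((fderiv ℝ χ x).smulRight (EuclideanSpace.single k 1)) x :=
      ((hχ.differentiable (by simp)) x).hasFDerivAt.smul_const _
    rw [h1.fderiv]
    simp only [enorm_sq_eq_ofReal, ContinuousLinearMap.smulRight_apply, norm_smul]
    simp
  choose p hpV hpφ hpn using fun k =>
    exists_jet_of_contDiff bc (hφ k) (hφc k) ((hφs k).trans hs)
  have hbound : ∀ k, ∫⁻ x in Ω, ‖mulFun R (φ k) x‖ₑ ^ 2 ≤ multiplierENorm bc Ω R ^ 2 *
      ((∫⁻ x in Ω, ‖χ x‖ₑ ^ 2) +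
        ∫⁻ x in Ω, ∑ j, ‖fderiv ℝ χ x (EuclideanSpace.single j 1)‖ₑ ^ 2) := by
    intro k
    have h1 := lintegral_mulFun_le (Q := R) (hpV k)
    rw [hpn k] at h1
    simp only [hnφ, hdφ] at h1
    refine le_trans (le_of_eq (lintegral_congr_ae ?_)) h1
    filter_upwards [hpφ k] with x hx
    simp only [mulFun, hx]
  have hmeas : ∀ k, AEMeasurable (fun x => ‖mulFun R (φ k) x‖ₑ ^ 2) (volume.restrict Ω) := by
    intro k
    refine (AEStronglyMeasurable.enorm ?_).pow_const 2
    refine (PiLp.continuous_toLp 2 _).comp_aestronglyMeasurable ?_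
    refine (aemeasurable_pi_lambda _ fun i =>
      AEStronglyMeasurable.aemeasurable ?_).aestronglyMeasurable
    simp only [Matrix.mulVec, dotProduct]
    refine Finset.aestronglyMeasurable_fun_sum _ fun j _ => (hR i j).mul ?_
    exact ((EuclideanSpace.proj (𝕜 := ℂ) j).continuous.comp
      (hφ k).continuous).aestronglyMeasurable
  have hw : ∀ x ∈ S, weight R x ≤ n ^ 2 * ∑ k, ‖mulFun R (φ k) x‖ₑ ^ 2 := by
    intro x hx
    rw [hφdef, sum_enorm_sq_mulFun_single, hS x hx, weight,
      ← ENNReal.ofReal_pow (matAbs_nonneg _)]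
    simp only [enorm_one, one_pow, mul_one]
    rw [← ENNReal.ofReal_natCast, ← ENNReal.ofReal_pow (Nat.cast_nonneg _),
      ← ENNReal.ofReal_mul (by positivity)]
    exact ENNReal.ofReal_le_ofReal (matAbs_sq_le_frobSq _)
  calc ∫⁻ x in S, weight R x ≤ ∫⁻ x in S, n ^ 2 * ∑ k, ‖mulFun R (φ k) x‖ₑ ^ 2 :=
        setLIntegral_mono' hSm hw
    _ ≤ ∫⁻ x in Ω, n ^ 2 * ∑ k, ‖mulFun R (φ k) x‖ₑ ^ 2 := lintegral_mono_set hSΩ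
    _ = n ^ 2 * ∑ k, ∫⁻ x in Ω, ‖mulFun R (φ k) x‖ₑ ^ 2 := by
        rw [lintegral_const_mul' _ _ (by simp), lintegral_finsetSum' _ fun k _ => hmeas k]
    _ ≤ n ^ 2 * ∑ _k : Fin n, multiplierENorm bc Ω R ^ 2 *
          ((∫⁻ x in Ω, ‖χ x‖ₑ ^ 2) +
            ∫⁻ x in Ω, ∑ j, ‖fderiv ℝ χ x (EuclideanSpace.single j 1)‖ₑ ^ 2) := by
        gcongr with k
        exact hbound k
    _ = _ := by
        rw [Finset.sum_const, Finset.card_univ, Fintype.card_fin, nsmul_eq_mul]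
        ring

/-! ### Cutoff functions adapted to a bounded set -/

theorem exists_cutoff {d : ℕ} {A : Set (Space d)} (hA : Bornology.IsBounded A) {a : ℝ}
    (ha : 0 < a) :
    ∃ χ : Space d → ℝ, ContDiff ℝ ∞ χ ∧ HasCompactSupport χ ∧ tsupport χ ⊆ A ∧
      (∀ x, ‖χ x‖ ≤ 1) ∧ (∀ x, ‖fderiv ℝ χ x‖ ≤ a⁻¹) ∧
      ∀ x, 4 * a < Metric.infDist x Aᶜ → χ x = 1 ∧ fderiv ℝ χ x = 0 := by
  set δ : Space d → ℝ := fun x => Metric.infDist x Aᶜ with hδ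
  have hδlip : ∀ x y, δ x ≤ δ y + ‖x - y‖ := fun x y => by
    rw [← dist_eq_norm]; exact Metric.infDist_le_infDist_add_dist
  -- A ramp from 0 at depth `2a` to 1 at depth `3a`, with Lipschitz constant `1/a`. Mollifying at
  -- radius `a` keeps that constant and spoils the constancy only between depths `a` and `4a`.
  set f : Space d → ℝ := fun x => max (min ((δ x - 2 * a) / a) 1) 0 with hf
  have hflip : ∀ x y, |f x - f y| ≤ a⁻¹ * ‖x - y‖ := by
    intro x y
    refine (abs_max_sub_max_le_abs _ _ _).trans ?_
    refine (abs_min_sub_min_le_max _ _ _ _).trans ?_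
    rw [sub_self, abs_zero, max_eq_left (abs_nonneg _), ← sub_div, abs_div, abs_of_pos ha,
      div_eq_inv_mul]
    gcongr
    rw [abs_le]
    constructor
    · have := hδlip y x
      rw [norm_sub_rev] at this
      linarith
    · linarith [hδlip x y]
  have hfcont : Continuous f := by
    have : Continuous δ := Metric.continuous_infDist_pt _
    fun_prop
  have hf1 : ∀ x, ‖f x‖ ≤ 1 := by
    intro x
    rw [Real.norm_of_nonneg (le_max_right _ _)]
    exact max_le (min_le_right _ _) zero_le_one
  set b : ContDiffBump (0 : Space d) := ⟨a / 2, a, by positivity, by linarith⟩ with hb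
  set χ := mollify b f with hχ
  have hint : ∀ x, Integrable (fun t => f (x - t)) (bumpMeasure b) := fun x =>
    Integrable.of_bound (hfcont.comp (by fun_prop)).aestronglyMeasurable 1
      (Eventually.of_forall fun t => hf1 _)
  have hχ1 : ∀ x, ‖χ x‖ ≤ 1 := by
    intro x
    rw [hχ, mollify_eq_bumpMeasure]
    have := norm_integral_le_of_norm_le_const (μ := bumpMeasure b) (f := fun t => f (x - t))
      (C := 1) (Eventually.of_forall fun t => hf1 _)
    simpa using this
  have hχlip : LipschitzWith (Real.toNNReal a⁻¹) χ := by
    refine LipschitzWith.of_dist_le_mul fun x y => ?_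
    rw [Real.coe_toNNReal _ (by positivity), dist_eq_norm, dist_eq_norm, hχ,
      mollify_eq_bumpMeasure, mollify_eq_bumpMeasure, ← integral_sub (hint x) (hint y)]
    have := norm_integral_le_of_norm_le_const (μ := bumpMeasure b)
      (f := fun t => f (x - t) - f (y - t)) (C := a⁻¹ * ‖x - y‖)
      (Eventually.of_forall fun t => by
        have := hflip (x - t) (y - t)
        rwa [sub_sub_sub_cancel_right] at this)
    simpa using this
  have hconst : ∀ x, 4 * a < δ x → χ x = 1 := by
    intro x hx
    have hval : ∀ y ∈ Metric.ball x a, f y = 1 := by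
      intro y hy
      have h1 := hδlip x y
      rw [← dist_eq_norm, dist_comm] at h1
      have h2 : dist y x < a := hy
      have h3 : 1 ≤ (δ y - 2 * a) / a := by
        rw [le_div_iff₀ ha]
        linarith
      simp [hf, min_eq_right h3]
    have := b.normed_convolution_eq_right (μ := volume) (g := f) (x₀ := x) fun y hy => by
      rw [hval y hy, hval x (Metric.mem_ball_self ha)]
    rw [hχ, mollify, this, hval x (Metric.mem_ball_self ha)]
  have hzero : ∀ x, δ x < a → χ x = 0 := by
    intro x hx
    have hval : ∀ y ∈ Metric.ball x a, f y = 0 := by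
      intro y hy
      have h1 := hδlip y x
      rw [← dist_eq_norm] at h1
      have h2 : dist y x < a := hy
      have h3 : (δ y - 2 * a) / a ≤ 0 := div_nonpos_of_nonpos_of_nonneg (by linarith) ha.le
      exact max_eq_right ((min_le_left _ _).trans h3)
    have := b.normed_convolution_eq_right (μ := volume) (g := f) (x₀ := x) fun y hy => by
      rw [hval y hy, hval x (Metric.mem_ball_self ha)]
    rw [hχ, mollify, this, hval x (Metric.mem_ball_self ha)]
  have hδc : Continuous δ := Metric.continuous_infDist_pt _
  have hts : tsupport χ ⊆ {x | a ≤ δ x} := by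
    refine closure_minimal (fun x hx => ?_) (isClosed_le continuous_const hδc)
    by_contra hlt
    exact hx (hzero x (not_le.1 hlt))
  have htsA : {x | a ≤ δ x} ⊆ A := by
    intro x hx
    by_contra hxA
    have h0 : δ x = 0 := Metric.infDist_zero_of_mem hxA
    have h1 : a ≤ δ x := hx
    linarith
  refine ⟨χ, contDiff_mollify b hfcont.locallyIntegrable, ?_, hts.trans htsA, hχ1, ?_, ?_⟩
  · exact Metric.isCompact_of_isClosed_isBounded (isClosed_tsupport χ) (hA.subset (hts.trans htsA))
  · intro x
    have := norm_fderiv_le_of_lipschitz ℝ hχlip (x₀ := x)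
    rwa [Real.coe_toNNReal _ (by positivity)] at this
  · intro x hx
    refine ⟨hconst x hx, ?_⟩
    have hev : χ =ᶠ[𝓝 x] fun _ => 1 := by
      filter_upwards [(isOpen_lt continuous_const hδc).mem_nhds hx] with y hy using hconst y hy
    rw [hev.fderiv_eq]
    simp

/-! ### Inner shells of convex sets -/

/-- Contract `A` towards `p` with ratio `1 - t/r`. Each image point is the centre of a ball of
radius `t` in `A`, a convex combination of the ball about `p` and a point of `A`. The shell thus
misses the image, and Bernoulli's inequality bounds the volume left over. -/
theorem volume_inner_shell_le {d : ℕ} (hd : 1 ≤ d) {A : Set (Space d)} (hA : Convex ℝ A)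
    (hAc : Aᶜ.Nonempty) (hfin : volume A ≠ ⊤) {p : Space d} {r t : ℝ} (hr : 0 < r) (ht : 0 < t)
    (hball : Metric.ball p r ⊆ A) :
    volume {x | x ∈ A ∧ Metric.infDist x Aᶜ < t} ≤ ENNReal.ofReal (d * (t / r)) * volume A := by
  have hd' : (1 : ℝ) ≤ d := by exact_mod_cast hd
  rcases le_or_gt 1 (t / r) with h1 | h1
  · refine (measure_mono fun x hx => hx.1).trans ?_
    refine le_mul_of_one_le_left zero_le ?_
    rw [ENNReal.one_le_ofReal]
    nlinarith
  set s := t / r with hs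
  have hs0 : 0 < s := by positivity
  set H := AffineMap.homothety p (1 - s) '' A with hH
  have hpA : p ∈ A := hball (Metric.mem_ball_self hr)
  have hform : ∀ y, AffineMap.homothety p (1 - s) y = s • p + (1 - s) • y := by
    intro y
    rw [AffineMap.homothety_apply, vsub_eq_sub, vadd_eq_add]
    module
  have hHA : H ⊆ A := by
    rintro _ ⟨y, hy, rfl⟩
    rw [hform]
    exact hA hpA hy hs0.le (by linarith) (by ring)
  have hHconv : Convex ℝ H := hA.affine_image _
  have hHdist : ∀ x ∈ H, t ≤ Metric.infDist x Aᶜ := by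
    rintro _ ⟨y, hy, rfl⟩
    rw [Metric.le_infDist hAc]
    intro z hz
    by_contra hlt
    refine hz ?_
    set x := AffineMap.homothety p (1 - s) y with hx
    have hzx : ‖z - x‖ < t := by
      rw [← dist_eq_norm, dist_comm]; exact not_le.1 hlt
    have hq : p + s⁻¹ • (z - x) ∈ A := by
      refine hball ?_
      rw [Metric.mem_ball, dist_eq_norm, add_sub_cancel_left, norm_smul, norm_inv,
        Real.norm_of_nonneg hs0.le, inv_mul_lt_iff₀ hs0, hs, div_mul_cancel₀ _ hr.ne']
      exact hzx
    have hz' : z = s • (p + s⁻¹ • (z - x)) + (1 - s) • y := by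
      rw [smul_add, smul_inv_smul₀ hs0.ne', hx, hform]
      module
    rw [hz']
    exact hA hq hy hs0.le (by linarith) (by ring)
  have hvol : volume H = ENNReal.ofReal ((1 - s) ^ d) * volume A := by
    rw [hH, Measure.addHaar_image_homothety, abs_of_nonneg (pow_nonneg (by linarith) _)]
    simp
  calc volume {x | x ∈ A ∧ Metric.infDist x Aᶜ < t} ≤ volume (A \ H) := by
        refine measure_mono fun x hx => ⟨hx.1, fun hxH => ?_⟩
        exact absurd hx.2 (not_lt.2 (hHdist x hxH))
    _ = volume A - volume H :=
        measure_sdiff hHA (hHconv.nullMeasurableSet volume) (measure_ne_top_of_subset hHA hfin)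
    _ ≤ _ := by
        rw [tsub_le_iff_right, hvol, ← add_mul, ← ENNReal.ofReal_add (by positivity)
          (pow_nonneg (by linarith) _)]
        refine le_mul_of_one_le_left zero_le ?_
        rw [ENNReal.one_le_ofReal]
        have := one_add_mul_le_pow (a := -s) (by linarith) d
        rw [← sub_eq_add_neg] at this
        linarith

/-! ### From multiplier norms to cell integrals -/

lemma exists_ball_subset_scaledCell {d : ℕ} {Γ : Submodule ℤ (Space d)} [Countable Γ]
    {cell : Set (Space d)} (h : IsPeriodicityCell Γ cell) :
    ∃ r : ℝ, 0 < r ∧ ∀ η : ℝ, 0 < η → ∀ γ : Space d, ∃ p,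
      Metric.ball p (η * r) ⊆ scaledCell cell η γ := by
  have hne : (interior cell).Nonempty := by
    refine nonempty_of_measure_ne_zero (μ := volume) ?_
    rw [measure_congr (interior_ae_eq_of_convex h.2.1)]
    exact h.volume_ne_zero
  obtain ⟨p, hp⟩ := hne
  obtain ⟨r, hr, hball⟩ := Metric.isOpen_iff.1 isOpen_interior p hp
  refine ⟨r, hr, fun η hη γ => ⟨η • (p + γ), fun x hx => ?_⟩⟩
  change η⁻¹ • x - γ ∈ cell
  refine interior_subset (hball ?_)
  rw [Metric.mem_ball, dist_eq_norm] at hx ⊢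
  have h1 : η⁻¹ • x - γ - p = η⁻¹ • (x - η • (p + γ)) := by
    rw [smul_sub, inv_smul_smul₀ hη.ne']
    abel
  rwa [h1, norm_smul, norm_inv, Real.norm_of_nonneg hη.le, inv_mul_lt_iff₀ hη]

lemma lintegral_weight_convex_le {m n : ℕ} {Ω : Set (Space (m + 1))} {bc : BoundaryCondition}
    {R : MatFun (m + 1) n} (hR : MemLinfty Ω R) {K : ℝ}
    (hRK : ∀ᵐ x ∂volume.restrict Ω, matAbs (R x) ≤ K) {A : Set (Space (m + 1))} (hA : IsOpen A)
    (hAc : Convex ℝ A) (hAb : Bornology.IsBounded A) (hAΩ : A ⊆ Ω) {p : Space (m + 1)} {r a : ℝ}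
    (hr : 0 < r) (ha : 0 < a) (hball : Metric.ball p r ⊆ A) :
    ∫⁻ x in A, weight R x ≤
      (n ^ 3 * (multiplierENorm bc Ω R ^ 2 * (1 + (m + 1 : ℕ) * ENNReal.ofReal a⁻¹ ^ 2 *
        ENNReal.ofReal ((m + 1 : ℕ) * (5 * a / r)))) +
        ENNReal.ofReal K ^ 2 * ENNReal.ofReal ((m + 1 : ℕ) * (5 * a / r))) * volume A := by
  obtain ⟨χ, hχ, hχc, hχs, hχ1, hχd, hχS⟩ := exists_cutoff hAb ha
  have hcont : Continuous fun x : Space (m + 1) => Metric.infDist x Aᶜ :=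
    Metric.continuous_infDist_pt _
  set S := {x | x ∈ A ∧ 4 * a < Metric.infDist x Aᶜ} with hS
  -- The bound `5a` exceeds `4a` so that the strict inequality still captures every point where the
  -- gradient of the cutoff may be nonzero.
  set H := {x | x ∈ A ∧ Metric.infDist x Aᶜ < 5 * a} with hH
  have hSm : MeasurableSet S := hA.measurableSet.inter (isOpen_lt continuous_const hcont).measurableSet
  have hHm : MeasurableSet H := hA.measurableSet.inter (isOpen_lt hcont continuous_const).measurableSet
  have hne : Aᶜ.Nonempty := by
    rw [nonempty_compl]
    rintro rfl
    exact NormedSpace.unbounded_univ ℝ (Space (m + 1)) hAb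
  have hvH : volume H ≤ ENNReal.ofReal ((m + 1 : ℕ) * (5 * a / r)) * volume A :=
    volume_inner_shell_le (by omega) hAc hne hAb.measure_lt_top.ne hr (by positivity) hball
  have hcover : A ⊆ S ∪ H := by
    intro x hx
    rcases lt_or_ge (4 * a) (Metric.infDist x Aᶜ) with h | h
    · exact Or.inl ⟨hx, h⟩
    · exact Or.inr ⟨hx, by linarith⟩
  have h1 : ∫⁻ x in Ω, ‖χ x‖ₑ ^ 2 ≤ volume A := by
    calc ∫⁻ x in Ω, ‖χ x‖ₑ ^ 2 ≤ ∫⁻ x, ‖χ x‖ₑ ^ 2 := setLIntegral_le_lintegral _ _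
      _ ≤ ∫⁻ x, A.indicator 1 x := by
          refine lintegral_mono fun x => ?_
          by_cases hx : x ∈ A
          · rw [indicator_of_mem hx, Pi.one_apply]
            refine pow_le_one' ?_ 2
            rw [← ofReal_norm, ENNReal.ofReal_le_one]
            exact hχ1 x
          · rw [image_eq_zero_of_notMem_tsupport fun h => hx (hχs h)]
            simp
      _ = volume A := lintegral_indicator_one hA.measurableSet
  have h2 : ∫⁻ x in Ω, ∑ j, ‖fderiv ℝ χ x (EuclideanSpace.single j 1)‖ₑ ^ 2 ≤
      (m + 1 : ℕ) * ENNReal.ofReal a⁻¹ ^ 2 * volume H := by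
    calc ∫⁻ x in Ω, ∑ j, ‖fderiv ℝ χ x (EuclideanSpace.single j 1)‖ₑ ^ 2
        ≤ ∫⁻ x, ∑ j, ‖fderiv ℝ χ x (EuclideanSpace.single j 1)‖ₑ ^ 2 :=
          setLIntegral_le_lintegral _ _
      _ ≤ ∫⁻ x, H.indicator (fun _ => (m + 1 : ℕ) * ENNReal.ofReal a⁻¹ ^ 2) x := by
          refine lintegral_mono fun x => ?_
          by_cases hx : x ∈ H
          · rw [indicator_of_mem hx]
            calc ∑ j, ‖fderiv ℝ χ x (EuclideanSpace.single j 1)‖ₑ ^ 2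
                ≤ ∑ _j : Fin (m + 1), ENNReal.ofReal a⁻¹ ^ 2 := by
                  refine Finset.sum_le_sum fun j _ => ?_
                  gcongr
                  rw [← ofReal_norm]
                  refine ENNReal.ofReal_le_ofReal ?_
                  refine ((fderiv ℝ χ x).le_opNorm _).trans ?_
                  simpa using hχd x
              _ = _ := by simp
          · rw [indicator_of_notMem hx]
            have h0 : fderiv ℝ χ x = 0 := by
              by_cases hxA : x ∈ A
              · refine (hχS x ?_).2
                have h5 : 5 * a ≤ Metric.infDist x Aᶜ := not_lt.1 fun hlt => hx ⟨hxA, hlt⟩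
                linarith
              · by_contra hne0
                exact hxA (hχs (support_fderiv_subset ℝ hne0))
            simp [h0]
      _ = _ := lintegral_indicator_const hHm _
  have h3 : ∫⁻ x in S, weight R x ≤ n ^ 3 * (multiplierENorm bc Ω R ^ 2 *
      (volume A + (m + 1 : ℕ) * ENNReal.ofReal a⁻¹ ^ 2 *
        (ENNReal.ofReal ((m + 1 : ℕ) * (5 * a / r)) * volume A))) := by
    refine (lintegral_weight_le (bc := bc) (fun i j => (hR i j).1) hχ hχc (hχs.trans hAΩ) hSm
      (fun x hx => hAΩ hx.1) fun x hx => (hχS x hx.2).1).trans ?_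
    refine mul_le_mul_right (mul_le_mul_right (add_le_add h1 (h2.trans ?_)) _) _
    exact mul_le_mul_right hvH _
  have h4 : ∫⁻ x in H, weight R x ≤ ENNReal.ofReal K ^ 2 *
      (ENNReal.ofReal ((m + 1 : ℕ) * (5 * a / r)) * volume A) := by
    calc ∫⁻ x in H, weight R x ≤ ∫⁻ _ in H, ENNReal.ofReal K ^ 2 := by
          refine lintegral_mono_ae ?_
          filter_upwards [ae_mono (Measure.restrict_mono
            (fun x hx => hAΩ hx.1 : H ⊆ Ω) le_rfl) hRK] with x hx
          rw [weight]
          gcongr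
      _ = ENNReal.ofReal K ^ 2 * volume H := setLIntegral_const _ _
      _ ≤ _ := mul_le_mul_right hvH _
  calc ∫⁻ x in A, weight R x ≤ ∫⁻ x in S ∪ H, weight R x := lintegral_mono_set hcover
    _ ≤ (∫⁻ x in S, weight R x) + ∫⁻ x in H, weight R x := lintegral_union_le _ _ _
    _ ≤ _ := add_le_add h3 h4
    _ = _ := by ring

theorem exists_cellBound_of_normM10 {m n : ℕ} (Ω : Set (Space (m + 1))) (bc : BoundaryCondition)
    {Γ : Submodule ℤ (Space (m + 1))} [Countable Γ] {cell : Set (Space (m + 1))}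
    (h : IsPeriodicityCell Γ cell) {K : ℝ} (hK0 : 0 ≤ K) :
    ∃ C : ℝ, 0 < C ∧ ∀ R : MatFun (m + 1) n, MemLinfty Ω R →
      (∀ᵐ x ∂volume.restrict Ω, matAbs (R x) ≤ K) → normM10 bc Ω R ≠ 0 →
        CellBound Ω Γ cell R √(normM10 bc Ω R) (C * √(normM10 bc Ω R)) := by
  obtain ⟨r, hr, hballs⟩ := exists_ball_subset_scaledCell h
  set v := (volume cell).toReal with hv
  have hv0 : 0 ≤ v := ENNReal.toReal_nonneg
  have hvc : volume cell = ENNReal.ofReal v := (ENNReal.ofReal_toReal h.volume_ne_top).symm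
  set c : ℝ := ((m + 1 : ℕ) : ℝ) with hc
  have hc0 : 0 < c := by positivity
  -- The summands come from `N² ≤ K √K η`, from the cutoff gradient and from the shell; the final `+
  -- 1` only keeps the constant positive.
  refine ⟨(n ^ 3 * (K * √K + 5 * c ^ 2 / r) + 5 * K ^ 2 * c / r) * v + 1, by positivity,
    fun R hR hRK hN => ?_⟩
  set N := normM10 bc Ω R with hNdef
  have hle : multiplierENorm bc Ω R ≤ ENNReal.ofReal K := multiplierENorm_le_of_bound hRK
  have hEN : multiplierENorm bc Ω R = ENNReal.ofReal N :=
    (ENNReal.ofReal_toReal (hle.trans_lt ENNReal.ofReal_lt_top).ne).symm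
  have hN0 : 0 < N := lt_of_le_of_ne ENNReal.toReal_nonneg hN.symm
  have hNK : N ≤ K := ENNReal.toReal_le_of_le_ofReal hK0 hle
  set η := √N with hη
  have hη0 : 0 < η := Real.sqrt_pos.2 hN0
  have hηN : η ^ 2 = N := Real.sq_sqrt hN0.le
  have hηK : η ≤ √K := Real.sqrt_le_sqrt hNK
  rw [cellBound_iff h hR hη0 (by positivity)]
  intro γ hγ
  obtain ⟨p, hp⟩ := hballs η hη0 γ
  have hconv : Convex ℝ (scaledCell cell η γ) := convex_scaledCell h.2.1 hη0 γ
  have hae := interior_ae_eq_of_convex hconv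
  obtain ⟨D, -, hD⟩ := h.exists_diam_bound
  have hbdd : Bornology.IsBounded (interior (scaledCell cell η γ)) := by
    refine Metric.isBounded_iff.2 ⟨η * D, fun x hx y hy => ?_⟩
    rw [dist_eq_norm]
    exact norm_sub_le_of_mem_scaledCell hD hη0 (interior_subset hy) (interior_subset hx)
  -- Cutoff width `N = η²` on a cell of size `η`: the gradient factor `N⁻²` cancels `N²`, and the
  -- relative shell volume is of order `η`.
  have h1 := lintegral_weight_convex_le (bc := bc) hR hRK isOpen_interior hconv.interior hbdd
    (interior_subset.trans hγ.2) (r := η * r) (a := N) (by positivity) hN0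
    (interior_maximal hp Metric.isOpen_ball)
  rw [Measure.restrict_congr_set hae, measure_congr hae, volume_scaledCell cell hη0, hEN, hvc]
    at h1
  refine h1.trans ?_
  have h2 : c * (5 * N / (η * r)) = 5 * c * η / r := by
    rw [← hηN]; field_simp
  rw [← hc, h2, ← ENNReal.ofReal_natCast (m + 1), ← hc, ← ENNReal.ofReal_natCast n,
    ← ENNReal.ofReal_one]
  rw [← ENNReal.ofReal_pow (by positivity), ← ENNReal.ofReal_pow (by positivity),
    ← ENNReal.ofReal_pow (by positivity), ← ENNReal.ofReal_pow (by positivity),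
    ← ENNReal.ofReal_mul (by positivity), ← ENNReal.ofReal_mul (by positivity),
    ← ENNReal.ofReal_add (by positivity) (by positivity), ← ENNReal.ofReal_mul (by positivity),
    ← ENNReal.ofReal_mul (by positivity), ← ENNReal.ofReal_mul (by positivity),
    ← ENNReal.ofReal_add (by positivity) (by positivity), ← ENNReal.ofReal_mul (by positivity),
    ← ENNReal.ofReal_mul (by positivity), ← ENNReal.ofReal_mul (by positivity)]
  refine ENNReal.ofReal_le_ofReal ?_
  have h3 : N ^ 2 * (1 + c * N⁻¹ ^ 2 * (5 * c * η / r)) = N ^ 2 + 5 * c ^ 2 / r * η := by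
    field_simp
  have h4 : N ^ 2 ≤ K * √K * η := by
    calc N ^ 2 = N * η * η := by rw [mul_assoc, ← sq, hηN, sq]
      _ ≤ K * √K * η := by gcongr
  have hpow : 0 ≤ η ^ (m + 1) := by positivity
  calc (n ^ 3 * (N ^ 2 * (1 + c * N⁻¹ ^ 2 * (5 * c * η / r))) + K ^ 2 * (5 * c * η / r)) *
        (η ^ (m + 1) * v)
      ≤ (n ^ 3 * (K * √K * η + 5 * c ^ 2 / r * η) + K ^ 2 * (5 * c * η / r)) *
        (η ^ (m + 1) * v) := by
        rw [h3]
        gcongr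
    _ = η ^ (m + 1) *
        (((n ^ 3 * (K * √K + 5 * c ^ 2 / r) + 5 * K ^ 2 * c / r) * v) * η) := by ring
    _ ≤ _ := by
        gcongr
        linarith

/-- A cutoff equal to one on a small ball forces the weight to vanish almost everywhere there, and a
locally null set is null. -/
lemma ae_eq_zero_of_multiplierENorm_eq_zero {d n : ℕ} {Ω : Set (Space d)} (hΩ : IsOpen Ω)
    {bc : BoundaryCondition} {R : MatFun d n}
    (hR : ∀ i j, AEStronglyMeasurable (fun x => R x i j) (volume.restrict Ω))
    (h0 : multiplierENorm bc Ω R = 0) : ∀ᵐ x ∂volume.restrict Ω, R x = 0 := by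
  rw [ae_restrict_iff' hΩ.measurableSet]
  refine measure_null_of_locally_null _ fun x hx => ?_
  have hxΩ : x ∈ Ω := by
    by_contra hn
    exact hx fun h => absurd h hn
  obtain ⟨ε, hε, hb⟩ := Metric.isOpen_iff.1 hΩ x hxΩ
  set f : ContDiffBump x := ⟨ε / 4, ε / 2, by positivity, by linarith⟩ with hf
  have hS : Metric.ball x (ε / 4) ⊆ Ω := (Metric.ball_subset_ball (by linarith)).trans hb
  have hts : tsupport f ⊆ Ω := by
    rw [f.tsupport_eq]
    exact (Metric.closedBall_subset_ball (by rw [hf]; simp only; linarith)).trans hb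
  have h1 := lintegral_weight_le (bc := bc) hR f.contDiff f.hasCompactSupport hts
    Metric.isOpen_ball.measurableSet hS fun y hy => f.one_of_mem_closedBall
      (Metric.ball_subset_closedBall hy)
  rw [h0] at h1
  simp only [ne_eq, OfNat.ofNat_ne_zero, not_false_eq_true, zero_pow, zero_mul, mul_zero,
    nonpos_iff_eq_zero] at h1
  have hm : AEMeasurable (weight R) (volume.restrict (Metric.ball x (ε / 4))) :=
    (((aestronglyMeasurable_matAbs hR).mono_measure
      (Measure.restrict_mono hS le_rfl)).aemeasurable.ennreal_ofReal).pow_const 2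
  rw [lintegral_eq_zero_iff' hm, Filter.EventuallyEq,
    ae_restrict_iff' Metric.isOpen_ball.measurableSet] at h1
  refine ⟨{y | y ∈ Ω → R y = 0}ᶜ ∩ Metric.ball x (ε / 4),
    inter_mem_nhdsWithin _ (Metric.ball_mem_nhds x (by positivity)), ?_⟩
  refine measure_mono_null (fun y hy => ?_) h1
  intro hw
  refine hy.1 fun _ => matAbs_eq_zero ?_
  have h2 := hw hy.2
  simp only [weight, Pi.zero_apply, ne_eq, OfNat.ofNat_ne_zero, not_false_eq_true,
    pow_eq_zero_iff, ENNReal.ofReal_eq_zero] at h2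
  exact le_antisymm h2 (matAbs_nonneg _)

end Multipliers

/-! ### The theorem -/

open Multipliers
theorem theorem6 (m n : ℕ) (hn : 1 ≤ n)
    (Ω : Set (Space (m + 1))) (hΩ_open : IsOpen Ω) (hΩ_conn : IsConnected Ω)
    (hΩ_reg : HasRegularBoundary Ω) (bc : BoundaryCondition)
    (Γ : Submodule ℤ (Space (m + 1))) [DiscreteTopology Γ] [IsZLattice ℝ Γ]
    (cell : Set (Space (m + 1))) (hcell : IsPeriodicityCell Γ cell) :
    (∀ {ι : Type*} (l : Filter ι) (Q : ι → MatFun (m + 1) n) (Q₀ : MatFun (m + 1) n),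
      (∀ i, MemLinfty Ω (Q i)) → (∃ K : ℝ≥0, ∀ i, linftyNorm Ω (Q i) ≤ K) → MemLinfty Ω Q₀ →
      (∃ C : ℝ, 0 < C ∧ ∀ η ρ : ι → ℝ, (∀ i, 0 < η i) → (∀ i, 0 ≤ ρ i) →
        (∀ i, CellBound Ω Γ cell (Q i - Q₀) (η i) (ρ i)) →
        Tendsto η l (𝓝 0) → Tendsto ρ l (𝓝 0) →
        ConvergesM10 bc Ω l Q Q₀ ∧
          ∀ i, normM10 bc Ω (Q i - Q₀) ≤ C * (√(ρ i) + √(η i))) ∧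
      (ConvergesM10 bc Ω l Q Q₀ → ∃ C : ℝ, 0 < C ∧
        (∀ i, normM10 bc Ω (Q i - Q₀) ≠ 0 →
          CellBound Ω Γ cell (Q i - Q₀) (√(normM10 bc Ω (Q i - Q₀)))
            (C * √(normM10 bc Ω (Q i - Q₀)))) ∧
        (∀ i, normM10 bc Ω (Q i - Q₀) = 0 → Q i =ᵐ[volume.restrict Ω] Q₀) ∧
        Tendsto (fun i => √(normM10 bc Ω (Q i - Q₀))) l (𝓝 0) ∧
        Tendsto (fun i => C * √(normM10 bc Ω (Q i - Q₀))) l (𝓝 0))) ∧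
    (∀ Q : MatFun (m + 1) n, MemM10 bc Ω Q →
      MemM10 bc Ω (fun x => (Q x)ᴴ) ∧
        normM10 bc Ω (fun x => (Q x)ᴴ) ≤ √(n : ℝ) * normM10 bc Ω Q) := by
  have : Countable Γ := inferInstance
  refine ⟨fun {ι} l Q Q₀ hQ hK hQ₀ => ?_, fun Q hQ => hQ.conjTranspose⟩
  obtain ⟨K, hK⟩ := hK
  obtain ⟨K₀, hK₀⟩ := hQ₀.exists_bound
  have hR : ∀ i, MemLinfty Ω (Q i - Q₀) := fun i => (hQ i).sub hQ₀
  have hRK : ∀ i, ∀ᵐ x ∂volume.restrict Ω, matAbs ((Q i - Q₀) x) ≤ (K : ℝ) + K₀ := by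
    intro i
    filter_upwards [ae_matAbs_le (hK i), ae_matAbs_le hK₀] with x h1 h2
    exact (matAbs_sub_le _ _).trans (add_le_add h1 h2)
  have hK0 : (0 : ℝ) ≤ (K : ℝ) + K₀ := by positivity
  refine ⟨?_, fun hconv => ?_⟩
  -- The constant depends only on the domain, the cell and the uniform bound `K + K₀`, so it
  -- precedes `η` and `ρ`.
  · obtain ⟨C, hC, hbound⟩ := exists_multiplierENorm_le_of_cellBound (n := n) hΩ_open hΩ_reg bc
      hcell hK0
    refine ⟨C, hC, fun η ρ hη hρ hcb hηl hρl => ?_⟩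
    have hle : ∀ i, normM10 bc Ω (Q i - Q₀) ≤ C * (√(ρ i) + √(η i)) := fun i =>
      ENNReal.toReal_le_of_le_ofReal (by positivity)
        (hbound _ (hR i) (hRK i) (η i) (ρ i) (hη i) (hρ i) (hcb i))
    refine ⟨⟨fun i => (hQ i).memM10 bc, hQ₀.memM10 bc, ?_⟩, hle⟩
    refine squeeze_zero (fun i => ENNReal.toReal_nonneg) hle ?_
    simpa using (hρl.sqrt.add hηl.sqrt).const_mul C
  · obtain ⟨C, hC, hbound⟩ := exists_cellBound_of_normM10 (n := n) Ω bc hcell hK0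
    have hlim : Tendsto (fun i => √(normM10 bc Ω (Q i - Q₀))) l (𝓝 0) := by
      simpa using hconv.2.2.sqrt
    refine ⟨C, hC, fun i hi => hbound _ (hR i) (hRK i) hi, fun i hi => ?_, hlim, ?_⟩
    -- A zero real norm could also come from an infinite extended norm, which boundedness excludes.
    · have h0 : multiplierENorm bc Ω (Q i - Q₀) = 0 :=
        ((ENNReal.toReal_eq_zero_iff _).1 hi).resolve_right ((hR i).memM10 bc).2.ne
      filter_upwards [ae_eq_zero_of_multiplierENorm_eq_zero hΩ_open (fun a b => (hR i a b).1) h0]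
        with x hx
      exact sub_eq_zero.1 hx
    · simpa using hlim.const_mul C
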